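/- **Notation.** Greek indices run over $0,\dots,3$; repeated upper and lower indices are summed; $p_0,\dots,p_3$ is the standard basis of $\mathbb R^{1,3}$ and $\eta=\mathrm{diag}(1,-1,-1,-1)$ raises and lowers indices. Let $p\in\{1,2\}$ and let $E=W^{1,p}_0([0,1],\mathbb R^{1,3})$ be the space of absolutely continuous curves $\sigma$ on $[0,1]$ with $\sigma(0)=0$ and $\dot\sigma\in L_p$, normed by $\|\sigma\|=\|\dot\sigma\|_{L_p}$; let $E_0=\{u\in E: u(1)=0\}$. For $\sigma\in E$ and $r\in[0,1]$ put $\sigma^r(t)=\sigma(rt)$. Let $\gamma^\mu\in M_4(\mathbb C)$ be Dirac matrices: $\gamma^\mu\gamma^\nu+\gamma^\nu\gamma^\mu=2\eta^{\mu\nu}I_4$, $\gamma_0^*=\gamma_0$, $\gamma_k^*=-\gamma_k$ for $k=1,2,3$. For $\varphi=\sum_{\alpha=1}^4\varphi_\alpha\otimes g_\alpha\in\mathbb C^N\otimes\mathbb C^4$ (with $\{g_\alpha\}$ the standard basis of $\mathbb C^4$) let $\overline\varphi\gamma_\mu\varphi=\sum_\alpha((I_N\otimes\gamma_0\gamma_\mu)\varphi)_\alpha\otimes\varphi_\alpha^*\in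 M_N(\mathbb C)$. Let $pr_{su(N)}$ be the orthogonal projection of $u(N)$ onto $su(N)$, $X\mapsto X-\frac1N\mathrm{tr}(X)I_N$, and let $m\in\mathbb R$. Let $A=A_\mu dx^\mu$ be a $C^\infty$ $su(N)$-valued 1-form on $\mathbb R^{1,3}$ and let $\psi\in C^\infty(\mathbb R^{1,3},\mathbb C^N\otimes\mathbb C^4)$. Put $F_{\mu\nu}=\partial_\mu A_\nu-\partial_\nu A_\mu+[A_\mu,A_\nu]$ and $\nabla_\mu\phi=\partial_\mu\phi+[A_\mu,\phi]$. For $\sigma\in E$ and $0\le s\le t\le1$ let $U^A_{t,s}(\sigma)\in M_N(\mathbb C)$ be the solution, absolutely continuous in $t$ and in $s$, of $\frac{d}{dt}U^A_{t,s}=-A_\mu(\sigma(t))\dot\sigma^\mu(t)U^A_{t,s}$ and $\frac{d}{ds}U^A_{t,s}=U^A_{t,s}A_\mu(\sigma(s))\dot\sigma^\mu(s)$ (almost everywhere), $U^A_{t,t}=I_N$. Put $U^A_{0,1}=(U^A_{1,0})^{-1}$ and $\Psi^{A,\psi}(\sigma)=(U^A_{0,1}(\sigma)\otimes I_4)\psi(\sigma(1))$.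 *Endpoint derivatives.* Let $V$ be a finite-dimensional real vector space and $f\in C^1(E,V)$. If for every $\sigma\in E$ there are $V$-valued Borel measures $\nu_0,\dots,\nu_3$ on $[0,1]$ with $f'(\sigma)u=\sum_\mu\int_0^1u^\mu(t)\,\nu_\mu(dt)$ for all $u\in E$, then $D_\mu f(\sigma)=\nu_\mu(\{1\})$. *Lévy d'Alembertian.* Let $f\in C^2(E,V)$. If for every $\sigma\in E$ there are $V$-valued coefficients $Q^V_{\mu\nu}\in L_1([0,1]^2)$, $Q^L_{\mu\nu}=Q^L_{\nu\mu}\in L_1[0,1]$, $Q^S_{\mu\nu}=-Q^S_{\nu\mu}\in L_\infty[0,1]$ such that for all $u,v\in E_0$ $$f''(\sigma)(u,v)=\int_0^1\!\!\int_0^1Q^V_{\mu\nu}(t,s)u^\mu(t)v^\nu(s)\,dt\,ds+\int_0^1Q^L_{\mu\nu}(t)u^\mu(t)v^\nu(t)\,dt+\frac12\int_0^1Q^S_{\mu\nu}(t)(\dot u^\mu(t)v^\nu(t)+\dot v^\mu(t)u^\nu(t))\,dt,$$ then $\Box_Lf(\sigma)=\int_0^1\eta^{\mu\nu}Q^L_{\mu\nu}(t)\,dt$.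 **Theorem.** The pair $(A,\psi)$ is a solution of the Yang–Mills–Dirac equations $$(I_N\otimes\gamma^\mu)(\partial_\mu+A_\mu\otimes I_4)\psi+im\psi=0,\qquad \nabla^\mu F_{\mu\nu}=-pr_{su(N)}(i\,\overline\psi\gamma_\nu\psi)\quad\text{on }\mathbb R^{1,3}$$ if and only if $\Psi^{A,\psi}$ is in the domain of each $D_\mu$, $U^A_{1,0}$ is in the domain of $\Box_L$, and for all $\sigma\in E$ $$(I_N\otimes\gamma^\mu)D_\mu\Psi^{A,\psi}(\sigma)+im\Psi^{A,\psi}(\sigma)=0,$$ $$\Box_LU^A_{1,0}(\sigma)=U^A_{1,0}(\sigma)\,pr_{su(N)}\Bigl(i\int_0^1\overline{\Psi^{A,\psi}(\sigma^r)}\gamma_\nu\Psi^{A,\psi}(\sigma^r)\,\dot\sigma^\nu(r)\,dr\Bigr).$$ -/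

import Mathlib

/-!
Along a curve the transport `U = U_{t,0}` solves a linear Volterra equation whose operator is
invertible and depends smoothly on `σ`, so `U` is a smooth function of `σ ∈ E`. Differentiating the
equation, `U'(σ)u = -U_{t,0} ∫₀ᵗ U⁻¹ (∂_u A)(σ̇) U - U_{t,0} ∫₀ᵗ U⁻¹ A(u̇) U`, and integrating the
last term by parts trades `u̇` for the curvature and a boundary term:
`U⁻¹ U'(σ)u = -U⁻¹ A(u) U + ∫₀ᵗ U⁻¹ F(σ̇, u) U`. At `t = 1` the boundary term is the endpoint
measure, so `D_μ Ψ(σ) = U_{0,1} (∂_μ + A_μ) ψ(σ(1))`, and since every point is an endpoint the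
first equation is the Dirac equation. Differentiating once more in `E₀`, the Lévy part of the
second derivative of `U_{1,0}` is the symmetrisation of `U⁻¹ (∇F)(σ̇, ·) U`, whose trace gives
`□_L U_{1,0}(σ) = -U_{1,0} ∫₀¹ U⁻¹ (∇^μ F_{μν}) U σ̇^ν`.

The trace in `□_L` is single-valued: on the curves `√2 sin(π n t) p_μ` the antisymmetric singular
part vanishes, the Volterra part tends to `0` by the Riemann–Lebesgue lemma, and the Lévy part
tends to `∫₀¹ Q^L_{μμ}`. Hence the second equation says that `∫₀¹ U⁻¹ K(σ̇) U = 0` on every curve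
for the one-form `K_ν = ∇^μ F_{μν} + pr_{su(N)}(i ψ̄ γ_ν ψ)`. Replacing `σ` by `σ^r` and
differentiating in `r` removes the integral, and `K` vanishes since a curve may pass through any
point with any velocity.
-/

open MeasureTheory Set
open scoped ContDiff ENNReal Matrix

noncomputable section

namespace LevyYM

/-! ### Minkowski space and curves of Sobolev class -/

/-- Underlying vector space of `ℝ^{1,3}`, with Greek indices in `Fin 4`. -/
abbrev Mink : Type := EuclideanSpace ℝ (Fin 4)

/-- The vectors `p_μ` of the standard basis. -/
def basisVec (μ : Fin 4) : Mink := EuclideanSpace.single μ 1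

/-- The Minkowski metric `diag(1,-1,-1,-1)`; the matrices `(η_{μν})` and `(η^{μν})` coincide. -/
def eta (μ ν : Fin 4) : ℝ := if μ = ν then (if μ = 0 then 1 else -1) else 0

/-- Lebesgue measure on `[0,1]`. -/
abbrev leb : Measure ℝ := volume.restrict (Icc (0 : ℝ) 1)

/-- Extension of a function on `[0,1]` to `ℝ`, constant on either side. -/
abbrev extendI {X : Type*} (f : unitInterval → X) : ℝ → X := IccExtend (zero_le_one' ℝ) f

theorem ae_differentiableAt_of_ac {f : ℝ → Mink} (hf : AbsolutelyContinuousOnInterval f 0 1) :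
    ∀ᵐ t ∂leb, DifferentiableAt ℝ f t := by
  rw [ae_restrict_iff' measurableSet_Icc]
  filter_upwards [hf.boundedVariationOn.ae_differentiableAt_of_mem_uIcc] with t ht h
  exact ht (by rwa [uIcc_of_le zero_le_one])

/-- `W₀^{1,p}([0,1], ℝ^{1,3})`: absolutely continuous curves starting at the origin whose
derivative is in `L_p`. -/
def curveSubmodule (p : ℝ≥0∞) : Submodule ℝ (unitInterval → Mink) where
  carrier := {σ | σ 0 = 0 ∧ AbsolutelyContinuousOnInterval (extendI σ) 0 1 ∧
    MemLp (deriv (extendI σ)) p leb}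
  zero_mem' := by
    have h : extendI (0 : unitInterval → Mink) = fun _ => 0 := rfl
    refine ⟨rfl, ?_, ?_⟩
    · rw [h]
      exact (LipschitzWith.const (0 : Mink)).lipschitzOnWith.absolutelyContinuousOnInterval
    · rw [h]
      simp
  add_mem' := by
    rintro σ τ ⟨h0, h1, h2⟩ ⟨k0, k1, k2⟩
    have h : extendI (σ + τ) = extendI σ + extendI τ := rfl
    refine ⟨by simp [h0, k0], ?_, ?_⟩
    · rw [h]
      exact h1.add k1
    · refine (h2.add k2).ae_eq ?_
      filter_upwards [ae_differentiableAt_of_ac h1, ae_differentiableAt_of_ac k1] with t a b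
      rw [h]
      exact (deriv_add a b).symm
  smul_mem' := by
    rintro c σ ⟨h0, h1, h2⟩
    have h : extendI (c • σ) = c • extendI σ := rfl
    refine ⟨by simp [h0], ?_, ?_⟩
    · rw [h]
      exact h1.const_smul c
    · refine (h2.const_smul c).ae_eq ?_
      filter_upwards [ae_differentiableAt_of_ac h1] with t a
      rw [h]
      exact (deriv_const_smul c a).symm

/-- The space `E = W₀^{1,p}([0,1], ℝ^{1,3})` of curves. -/
def Curve (p : ℝ≥0∞) : Type := curveSubmodule p

namespace Curve

variable {p : ℝ≥0∞}

instance instAddCommGroup : AddCommGroup (Curve p) :=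
  inferInstanceAs (AddCommGroup (curveSubmodule p))

instance instModule : Module ℝ (Curve p) := inferInstanceAs (Module ℝ (curveSubmodule p))

/-- The point `σ(t)` for `t ∈ [0,1]` (constant continuation outside `[0,1]`). -/
def val (σ : Curve p) : ℝ → Mink := extendI σ.1

/-- The velocity `dσ/dt`, meaningful for almost all `t ∈ [0,1]`. -/
def vel (σ : Curve p) : ℝ → Mink := deriv σ.val

theorem memLp_vel (σ : Curve p) : MemLp σ.vel p leb := σ.2.2.2

/-- The velocity as a linear map to `L_p`. -/
def velL (p : ℝ≥0∞) : Curve p →ₗ[ℝ] Lp Mink p leb where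
  toFun σ := (memLp_vel σ).toLp σ.vel
  map_add' σ τ := by
    rw [← MemLp.toLp_add]
    apply MemLp.toLp_congr
    filter_upwards [ae_differentiableAt_of_ac σ.2.2.1, ae_differentiableAt_of_ac τ.2.2.1]
      with t a b
    exact deriv_add a b
  map_smul' c σ := by
    rw [RingHom.id_apply, ← MemLp.toLp_const_smul]
    apply MemLp.toLp_congr
    filter_upwards [ae_differentiableAt_of_ac σ.2.2.1] with t a
    exact deriv_const_smul c a

theorem velL_injective : Function.Injective (velL p) := by
  rw [injective_iff_map_eq_zero]
  intro σ h
  have h1 : σ.vel =ᵐ[leb] 0 := by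
    have h2 : (memLp_vel σ).toLp σ.vel = (MemLp.zero' (p := p) (μ := leb)).toLp
      (fun _ : ℝ => (0 : Mink)) := h
    exact (MemLp.toLp_eq_toLp_iff _ _).1 h2
  have h3 : ∀ᵐ t, t ∈ uIcc (0 : ℝ) 1 → HasDerivAt σ.val 0 t := by
    have h4 : ∀ᵐ t ∂leb, HasDerivAt σ.val 0 t := by
      filter_upwards [h1, ae_differentiableAt_of_ac σ.2.2.1] with t a b
      have := b.hasDerivAt
      have e : deriv (extendI σ.1) t = 0 := a
      rwa [e] at this
    rw [uIcc_of_le zero_le_one]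
    exact (ae_restrict_iff' measurableSet_Icc).1 h4
  obtain ⟨C, hC⟩ := AbsolutelyContinuousOnInterval.const_of_ae_hasDerivAt_zero σ.2.2.1 h3
  rw [uIcc_of_le zero_le_one] at hC
  have key : ∀ t : unitInterval, σ.1 t = C := fun t => by
    rw [← hC t t.2]
    exact (IccExtend_val _ _ _).symm
  have hC0 : C = 0 := by rw [← key 0, σ.2.1]
  exact Subtype.ext (funext fun t => (key t).trans hC0)

/-- The norm is `‖σ‖ = ‖dσ/dt‖_{L_p}`. -/
instance instNormedAddCommGroup [Fact (1 ≤ p)] : NormedAddCommGroup (Curve p) :=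
  NormedAddCommGroup.induced (Curve p) (Lp Mink p leb) (velL p) velL_injective

instance instNormedSpace [Fact (1 ≤ p)] : NormedSpace ℝ (Curve p) :=
  NormedSpace.induced ℝ (Curve p) (Lp Mink p leb) (velL p)

theorem shrink_mem (σ : Curve p) (r : unitInterval) :
    (fun t : unitInterval => σ.1 (r * t)) ∈ curveSubmodule p := by
  obtain ⟨h0, h1, h2⟩ := σ.2
  have hext : ∀ t ∈ Icc (0 : ℝ) 1,
      extendI (fun t : unitInterval => σ.1 (r * t)) t = σ.val (r * t) := by
    intro t ht
    have hrt : (r : ℝ) * t ∈ Icc (0 : ℝ) 1 :=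
      ⟨mul_nonneg r.2.1 ht.1, mul_le_one₀ r.2.2 ht.1 ht.2⟩
    rw [extendI, IccExtend_of_mem _ _ ht, val, extendI, IccExtend_of_mem _ _ hrt]
    rfl
  refine ⟨by simpa using h0, ?_, ?_⟩
  · rw [absolutelyContinuousOnInterval_iff] at h1 ⊢
    intro ε hε
    obtain ⟨δ, hδ, H⟩ := h1 ε hε
    refine ⟨δ, hδ, ?_⟩
    rintro ⟨n, I⟩ ⟨hI, hd⟩ hlen
    simp only [uIcc_of_le (zero_le_one' ℝ)] at hI
    have hr0 : (0 : ℝ) ≤ r := r.2.1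
    have hle : ∑ i ∈ Finset.range n, dist ((r : ℝ) * (I i).1) (r * (I i).2) < δ := by
      refine lt_of_le_of_lt (Finset.sum_le_sum fun i _ => ?_) hlen
      rw [Real.dist_eq, Real.dist_eq, ← mul_sub, abs_mul, abs_of_nonneg hr0]
      exact mul_le_of_le_one_left (abs_nonneg _) r.2.2
    have hm : ((n, fun i => ((r : ℝ) * (I i).1, (r : ℝ) * (I i).2)) : ℕ × (ℕ → ℝ × ℝ)) ∈
        AbsolutelyContinuousOnInterval.disjWithin 0 1 := by
      refine ⟨fun i hi => ?_, fun i hi j hj hij => ?_⟩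
      · simp only [uIcc_of_le (zero_le_one' ℝ)]
        obtain ⟨a, b⟩ := hI i hi
        exact ⟨⟨mul_nonneg hr0 a.1, mul_le_one₀ r.2.2 a.1 a.2⟩,
          ⟨mul_nonneg hr0 b.1, mul_le_one₀ r.2.2 b.1 b.2⟩⟩
      · have hij' := hd hi hj hij
        simp only [Function.onFun] at hij' ⊢
        rcases hr0.eq_or_lt with h | h
        · simp [← h]
        · rw [Set.disjoint_left] at hij' ⊢
          have key : ∀ a b x : ℝ, x ∈ uIoc (r * a) (r * b) → x / r ∈ uIoc a b := by
            intro a b x hx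
            rw [mem_uIoc] at hx ⊢
            rcases hx with hx | hx
            · exact Or.inl ⟨(lt_div_iff₀' h).2 hx.1, (div_le_iff₀' h).2 hx.2⟩
            · exact Or.inr ⟨(lt_div_iff₀' h).2 hx.1, (div_le_iff₀' h).2 hx.2⟩
          exact fun x hx hx' => hij' (key _ _ _ hx) (key _ _ _ hx')
    have := H _ hm hle
    refine lt_of_eq_of_lt (Finset.sum_congr rfl fun i hi => ?_) this
    obtain ⟨a, b⟩ := hI i hi
    rw [hext _ a, hext _ b]
    rfl
  · rcases r.2.1.eq_or_lt with h | h
    · have hr : r = 0 := Subtype.ext h.symm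
      have : extendI (fun t : unitInterval => σ.1 (r * t)) = fun _ => σ.1 0 := by
        funext t
        simp [extendI, IccExtend, hr]
      rw [this]
      simp
    · have hcomp : MemLp (fun t => σ.vel (r * t)) p leb := by
        have hmeas : Measurable fun t : ℝ => (r : ℝ) * t := measurable_const_mul _
        have hmap : Measure.map (fun t : ℝ => (r : ℝ) * t) leb ≤
            ENNReal.ofReal |(r : ℝ)⁻¹| • leb := by
          have hsub : Icc (0 : ℝ) 1 ⊆ (fun t : ℝ => (r : ℝ) * t) ⁻¹' Icc 0 1 := fun t ht =>
            ⟨mul_nonneg r.2.1 ht.1, mul_le_one₀ r.2.2 ht.1 ht.2⟩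
          calc Measure.map (fun t : ℝ => (r : ℝ) * t) leb
              ≤ Measure.map (fun t : ℝ => (r : ℝ) * t)
                  (volume.restrict ((fun t : ℝ => (r : ℝ) * t) ⁻¹' Icc 0 1)) :=
                Measure.map_mono (Measure.restrict_mono hsub le_rfl) hmeas
            _ = (Measure.map (fun t : ℝ => (r : ℝ) * t) volume).restrict (Icc 0 1) :=
                (Measure.restrict_map hmeas measurableSet_Icc).symm
            _ = ENNReal.ofReal |(r : ℝ)⁻¹| • leb := by
                rw [Real.map_volume_mul_left h.ne', Measure.restrict_smul]
        have h3 : MemLp σ.vel p (Measure.map (fun t : ℝ => (r : ℝ) * t) leb) :=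
          (h2.smul_measure ENNReal.ofReal_ne_top).mono_measure hmap
        exact h3.comp_of_map hmeas.aemeasurable
      refine (hcomp.const_smul (r : ℝ)).ae_eq ?_
      have hIoo : ∀ᵐ t ∂leb, t ∈ Ioo (0 : ℝ) 1 := by
        rw [leb, ← Measure.restrict_congr_set Ioo_ae_eq_Icc]
        exact ae_restrict_mem measurableSet_Ioo
      filter_upwards [hIoo] with t ht
      have e : extendI (fun t : unitInterval => σ.1 (r * t)) =ᶠ[nhds t]
          fun t => σ.val (r * t) := by
        filter_upwards [Ioo_mem_nhds ht.1 ht.2] with s hs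
        exact hext s ⟨hs.1.le, hs.2.le⟩
      rw [e.deriv_eq]
      exact (deriv_comp_mul_left (r : ℝ) σ.val t).symm

/-- The curve `σ^r`, `σ^r(t) = σ(rt)`. -/
def shrink (r : unitInterval) (σ : Curve p) : Curve p :=
  ⟨fun t => σ.1 (r * t), shrink_mem σ r⟩

end Curve

/-! ### Gauge fields, spinors and the Yang-Mills-Dirac equations -/

/-- `M_N(ℂ)`. -/
abbrev Mat (N : ℕ) : Type := Matrix (Fin N) (Fin N) ℂ

/-- `ℂ^N ⊗ ℂ^4`: the vector `∑_{a,α} φ_{aα} e_a ⊗ g_α` is stored as the matrix `(φ_{aα})`, whose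
`α`-th column is `φ_α ∈ ℂ^N`. -/
abbrev Spinor (N : ℕ) : Type := Matrix (Fin N) (Fin 4) ℂ

attribute [local instance] Matrix.frobeniusNormedAddCommGroup Matrix.frobeniusNormedSpace

/-- `su(N)`. -/
def su (N : ℕ) : Set (Mat N) := {X | Xᴴ = -X ∧ X.trace = 0}

/-- The orthogonal projection of `u(N)` onto `su(N)`, with respect to `tr(X* Y)`:
it removes the component along the scalar matrices. -/
def prSu {N : ℕ} (X : Mat N) : Mat N := X - (X.trace / N) • (1 : Mat N)

theorem prSu_mem {N : ℕ} {X : Mat N} (hX : Xᴴ = -X) : prSu X ∈ su N := by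
  rcases Nat.eq_zero_or_pos N with rfl | hN
  · exact ⟨Subsingleton.elim _ _, by simp [Matrix.trace]⟩
  have hN' : (N : ℂ) ≠ 0 := by exact_mod_cast hN.ne'
  have ht : star X.trace = -X.trace := by
    rw [← Matrix.trace_conjTranspose, hX, Matrix.trace_neg]
  refine ⟨?_, ?_⟩
  · rw [prSu, Matrix.conjTranspose_sub, Matrix.conjTranspose_smul, hX, Matrix.conjTranspose_one,
      star_div₀, ht]
    simp only [star_natCast, neg_div, neg_smul]
    abel
  · simp [prSu, Matrix.trace_sub, Matrix.trace_smul, hN']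

theorem trace_conjTranspose_mul_sub_prSu {N : ℕ} (X : Mat N) {Y : Mat N} (hY : Y ∈ su N) :
    (Yᴴ * (X - prSu X)).trace = 0 := by
  simp [prSu, Matrix.trace_conjTranspose, hY.2]

/-- Partial derivative `∂_μ f`. -/
def pd {V : Type*} [NormedAddCommGroup V] [NormedSpace ℝ V] (μ : Fin 4) (f : Mink → V) :
    Mink → V := fun x => fderiv ℝ f x (basisVec μ)

/-- Covariant derivative `∇_μ φ = ∂_μ φ + [A_μ, φ]`. -/
def covD {N : ℕ} (A : Fin 4 → Mink → Mat N) (μ : Fin 4) (φ : Mink → Mat N) : Mink → Mat N :=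
  fun x => pd μ φ x + (A μ x * φ x - φ x * A μ x)

/-- Curvature `F_{μν} = ∂_μ A_ν - ∂_ν A_μ + [A_μ, A_ν]`. -/
def curv {N : ℕ} (A : Fin 4 → Mink → Mat N) (μ ν : Fin 4) : Mink → Mat N :=
  fun x => pd μ (A ν) x - pd ν (A μ) x + (A μ x * A ν x - A ν x * A μ x)

/-- Dirac matrices `γ^0, …, γ^3`. -/
structure IsDirac (γ : Fin 4 → Matrix (Fin 4) (Fin 4) ℂ) : Prop where
  clifford : ∀ μ ν, γ μ * γ ν + γ ν * γ μ = (2 * eta μ ν) • (1 : Matrix (Fin 4) (Fin 4) ℂ)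
  conj_zero : (γ 0)ᴴ = γ 0
  conj_space : ∀ μ, μ ≠ 0 → (γ μ)ᴴ = -γ μ

/-- `γ_μ = η_{μν} γ^ν`. -/
def lowerGamma (γ : Fin 4 → Matrix (Fin 4) (Fin 4) ℂ) (μ : Fin 4) : Matrix (Fin 4) (Fin 4) ℂ :=
  ∑ ν, eta μ ν • γ ν

/-- `(I_N ⊗ M) φ` for `M ∈ M_4(ℂ)`. -/
def spinAct {N : ℕ} (M : Matrix (Fin 4) (Fin 4) ℂ) (φ : Spinor N) : Spinor N :=
  Matrix.of fun a α => ∑ β, M α β * φ a β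

/-- `(X ⊗ I_4) φ` for `X ∈ M_N(ℂ)`. -/
def colorAct {N : ℕ} (X : Mat N) (φ : Spinor N) : Spinor N :=
  Matrix.of fun a α => ∑ b, X a b * φ b α

/-- The operator `φ̄ γ_μ φ = ∑_α ((I_N ⊗ γ_0 γ_μ) φ)_α ⊗ φ_α^*` on `ℂ^N`. -/
def bilin {N : ℕ} (γ : Fin 4 → Matrix (Fin 4) (Fin 4) ℂ) (μ : Fin 4) (φ : Spinor N) : Mat N :=
  Matrix.of fun a b =>
    ∑ α, spinAct (lowerGamma γ 0 * lowerGamma γ μ) φ a α * star (φ b α)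

/-- The Yang-Mills-Dirac equations
`(I_N ⊗ γ^μ)(∂_μ + A_μ ⊗ I_4)ψ + i m ψ = 0`, `∇^μ F_{μν} = -pr_{su(N)}(i ψ̄ γ_ν ψ)`. -/
def IsYangMillsDirac {N : ℕ} (γ : Fin 4 → Matrix (Fin 4) (Fin 4) ℂ) (m : ℝ)
    (A : Fin 4 → Mink → Mat N) (ψ : Mink → Spinor N) : Prop :=
  (∀ x, (∑ μ, spinAct (γ μ) (pd μ ψ x + colorAct (A μ x) (ψ x))) +
      (Complex.I * m) • ψ x = 0) ∧
  (∀ x ν, ∑ μ, ∑ κ, eta μ κ • covD A κ (curv A μ ν) x =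
      -prSu (Complex.I • bilin γ ν (ψ x)))

/-! ### Parallel transport -/

section

variable {N : ℕ} {p : ℝ≥0∞}

/-- `A_μ(σ(t)) dσ^μ/dt`. -/
def connAlong (A : Fin 4 → Mink → Mat N) (σ : Curve p) (t : ℝ) : Mat N :=
  ∑ μ, σ.vel t μ • A μ (σ.val t)

/-- `U t s`, `0 ≤ s ≤ t ≤ 1`, solves the equations of parallel transport along `σ`:
`dU_{t,s}/dt = -A_μ(σ(t)) σ̇^μ(t) U_{t,s}`, `dU_{t,s}/ds = U_{t,s} A_μ(σ(s)) σ̇^μ(s)`,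
`U_{t,t} = I_N`. As `σ` is only absolutely continuous, the solution is absolutely continuous in each
variable and the equations hold almost everywhere. -/
structure IsParallelTransport (A : Fin 4 → Mink → Mat N) (σ : Curve p) (U : ℝ → ℝ → Mat N) :
    Prop where
  ac_left : ∀ s ∈ Icc (0 : ℝ) 1, AbsolutelyContinuousOnInterval (fun t => U t s) s 1
  deriv_left : ∀ s ∈ Icc (0 : ℝ) 1, ∀ᵐ t, t ∈ Ioo s 1 →
    HasDerivAt (fun t => U t s) (-(connAlong A σ t * U t s)) t
  ac_right : ∀ t ∈ Icc (0 : ℝ) 1, AbsolutelyContinuousOnInterval (fun s => U t s) 0 t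
  deriv_right : ∀ t ∈ Icc (0 : ℝ) 1, ∀ᵐ s, s ∈ Ioo 0 t →
    HasDerivAt (fun s => U t s) (U t s * connAlong A σ s) s
  diag : ∀ t ∈ Icc (0 : ℝ) 1, U t t = 1

/-- `U^A_{1,0}(σ)`, from the solution of the equations of parallel transport (which is unique
for `0 ≤ s ≤ t ≤ 1`). -/
def transport (A : Fin 4 → Mink → Mat N) (σ : Curve p) : Mat N :=
  Classical.epsilon (IsParallelTransport A σ) 1 0

/-- `Ψ^{A,ψ}(σ) = (U^A_{0,1}(σ) ⊗ I_4) ψ(σ(1))`, where `U^A_{0,1} = (U^A_{1,0})⁻¹`. -/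
def transportedSpinor (A : Fin 4 → Mink → Mat N) (ψ : Mink → Spinor N) (σ : Curve p) : Spinor N :=
  colorAct (transport A σ)⁻¹ (ψ (σ.val 1))

end

/-! ### Endpoint derivation and Lévy d'Alembertian -/

section

variable {p : ℝ≥0∞} [Fact (1 ≤ p)] {V : Type*} [NormedAddCommGroup V] [NormedSpace ℝ V]

/-- `T ∈ dom S_h` and `S_h(T) = v`: `T(u) = ∫₀¹ (u(t), ν(dt))` for a Borel measure `ν` on `[0,1]`
with values in `V ⊗ ℝ^4` (components `ν_μ`; finiteness of the variation is automatic when `V` is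
finite-dimensional), and `v = (h, ν({1}))`. -/
def HasEndpointValue (h : Mink) (T : Curve p →L[ℝ] V) (v : V) : Prop :=
  ∃ ν : Fin 4 → VectorMeasure unitInterval V,
    (∀ μ, IsFiniteMeasure (ν μ).variation) ∧
    (∀ u : Curve p, T u =
      ∑ μ, (ν μ).integral (fun t => u.val t μ) (ContinuousLinearMap.lsmul ℝ ℝ)) ∧
    v = ∑ μ, h μ • ν μ {1}

/-- `f` is in the domain of the endpoint derivation `D_h`, and `D_h f = f'`. -/
def HasEndpointDeriv (h : Mink) (f f' : Curve p → V) : Prop :=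
  ContDiff ℝ 1 f ∧ ∀ σ, HasEndpointValue h (fderiv ℝ f σ) (f' σ)

/-- The continuous bilinear map `Q` is in the domain `T²_E` of the Lévy trace for the Minkowski
metric, and its Lévy trace is `w`. -/
def HasLevyTrace (Q : Curve p →L[ℝ] Curve p →L[ℝ] V) (w : V) : Prop :=
  ∃ (QV : Fin 4 → Fin 4 → ℝ × ℝ → V) (QL QS : Fin 4 → Fin 4 → ℝ → V),
    (∀ μ ν, Integrable (QV μ ν) (leb.prod leb)) ∧
    (∀ μ ν, Integrable (QL μ ν) leb) ∧
    (∀ μ ν, MemLp (QS μ ν) ∞ leb) ∧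
    (∀ μ ν, QL μ ν =ᵐ[leb] QL ν μ) ∧
    (∀ μ ν, QS μ ν =ᵐ[leb] -QS ν μ) ∧
    (∀ u v : Curve p, u.val 1 = 0 → v.val 1 = 0 →
      Q u v =
        (∫ x, ∑ μ, ∑ ν, (u.val x.1 μ * v.val x.2 ν) • QV μ ν x ∂(leb.prod leb)) +
        (∫ t, ∑ μ, ∑ ν, (u.val t μ * v.val t ν) • QL μ ν t ∂leb) +
        (1 / 2 : ℝ) • ∫ t, ∑ μ, ∑ ν,
          (u.vel t μ * v.val t ν + v.vel t μ * u.val t ν) • QS μ ν t ∂leb) ∧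
    w = ∫ t, ∑ μ, ∑ ν, eta μ ν • QL μ ν t ∂leb

/-- `f` is in the domain of the Lévy d'Alembertian `□_L`, and `□_L f = g`. -/
def HasLevyDAlembertian (f g : Curve p → V) : Prop :=
  ContDiff ℝ 2 f ∧ ∀ σ, HasLevyTrace (fderiv ℝ (fderiv ℝ f) σ) (g σ)

end

end LevyYM

end

attribute [local instance] Matrix.frobeniusNormedAddCommGroup Matrix.frobeniusNormedSpace

noncomputable section

namespace LevyYM

open Filter Topology

section Interval

theorem intervalIntegrable_of_integrable_leb {V : Type*} [NormedAddCommGroup V] {g : ℝ → V}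
    (hg : Integrable g leb) {a b : ℝ} (ha : a ∈ Icc (0 : ℝ) 1) (hb : b ∈ Icc (0 : ℝ) 1) :
    IntervalIntegrable g volume a b :=
  intervalIntegrable_iff.2 <|
    IntegrableOn.mono_set (t := Icc 0 1) hg (uIoc_subset_uIcc.trans (uIcc_subset_Icc ha hb))

theorem ae_leb_mem_Ioo : ∀ᵐ t ∂leb, t ∈ Ioo (0 : ℝ) 1 := by
  rw [leb, ← Measure.restrict_congr_set Ioo_ae_eq_Icc]
  exact ae_restrict_mem measurableSet_Ioo

theorem integral_leb_eq_intervalIntegral {V : Type*} [NormedAddCommGroup V] [NormedSpace ℝ V]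
    (g : ℝ → V) : ∫ t, g t ∂leb = ∫ t in (0 : ℝ)..1, g t := by
  rw [intervalIntegral.integral_of_le zero_le_one, integral_Icc_eq_integral_Ioc]

theorem intervalIntegral_congr_ae_leb {V : Type*} [NormedAddCommGroup V] [NormedSpace ℝ V]
    {f g : ℝ → V} (t : unitInterval) (h : f =ᵐ[leb] g) :
    ∫ s in (0 : ℝ)..t, f s = ∫ s in (0 : ℝ)..t, g s := by
  refine intervalIntegral.integral_congr_ae ?_
  filter_upwards [(ae_restrict_iff' measurableSet_Icc).1 h] with s hs hst
  rw [uIoc_of_le t.2.1] at hst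
  exact hs ⟨hst.1.le, hst.2.trans t.2.2⟩

theorem integrable_clm_apply_of_continuousOn {X V : Type*} [NormedAddCommGroup X]
    [NormedSpace ℝ X] [NormedAddCommGroup V] [NormedSpace ℝ V] {φ : ℝ → X →L[ℝ] V} {g : ℝ → X}
    (hφ : ContinuousOn φ (Icc 0 1)) (hg : Integrable g leb) :
    Integrable (fun t => φ t (g t)) leb := by
  obtain ⟨C, hC⟩ := isCompact_Icc.exists_bound_of_continuousOn hφ
  have hφm : AEStronglyMeasurable φ leb := hφ.aestronglyMeasurable measurableSet_Icc
  refine (hg.norm.const_mul C).mono'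
    ((ContinuousLinearMap.id ℝ (X →L[ℝ] V)).aestronglyMeasurable_comp₂ hφm
      hg.aestronglyMeasurable) ?_
  filter_upwards [ae_restrict_mem measurableSet_Icc] with t ht
  exact ((φ t).le_opNorm _).trans (mul_le_mul_of_nonneg_right (hC t ht) (norm_nonneg _))

theorem continuous_extendI {X : Type*} [TopologicalSpace X] {f : unitInterval → X}
    (hf : Continuous f) : Continuous (extendI f) :=
  hf.comp continuous_projIcc

theorem extendI_coe {X : Type*} (f : unitInterval → X) (t : unitInterval) : extendI f t = f t :=
  IccExtend_val _ _ _

end Interval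

section WeakDeriv

theorem absolutelyContinuousOnInterval_of_dist_le {X Y : Type*} [PseudoMetricSpace X]
    [PseudoMetricSpace Y] {f : ℝ → X} {g : ℝ → Y} {a b : ℝ} (c : ℝ)
    (hg : AbsolutelyContinuousOnInterval g a b)
    (h : ∀ x ∈ uIcc a b, ∀ y ∈ uIcc a b, dist (f x) (f y) ≤ c * dist (g x) (g y)) :
    AbsolutelyContinuousOnInterval f a b := by
  rw [absolutelyContinuousOnInterval_iff] at hg ⊢
  intro ε hε
  obtain ⟨δ, hδ, hg⟩ := hg (ε / (|c| + 1)) (by positivity)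
  refine ⟨δ, hδ, fun I hI hlen => ?_⟩
  calc ∑ i ∈ Finset.range I.1, dist (f (I.2 i).1) (f (I.2 i).2)
      ≤ ∑ i ∈ Finset.range I.1, (|c| + 1) * dist (g (I.2 i).1) (g (I.2 i).2) := by
        refine Finset.sum_le_sum fun i hi => (h _ (hI.1 i hi).1 _ (hI.1 i hi).2).trans ?_
        gcongr
        linarith [le_abs_self c]
    _ = (|c| + 1) * ∑ i ∈ Finset.range I.1, dist (g (I.2 i).1) (g (I.2 i).2) :=
        (Finset.mul_sum _ _ _).symm
    _ < (|c| + 1) * (ε / (|c| + 1)) := by gcongr; exact hg I hI hlen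
    _ = ε := by field

theorem absolutelyContinuousOnInterval_primitive {V : Type*} [NormedAddCommGroup V]
    [NormedSpace ℝ V] {g : ℝ → V} (hg : Integrable g leb) :
    AbsolutelyContinuousOnInterval (fun t => ∫ s in (0 : ℝ)..t, g s) 0 1 := by
  have h0 : (0 : ℝ) ∈ Icc (0 : ℝ) 1 := by simp
  have h1 : (1 : ℝ) ∈ Icc (0 : ℝ) 1 := by simp
  have hnorm := (intervalIntegrable_of_integrable_leb hg.norm h0
    h1).absolutelyContinuousOnInterval_intervalIntegral (c := 0) (by simp)
  refine absolutelyContinuousOnInterval_of_dist_le 1 hnorm fun x hx y hy => ?_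
  rw [uIcc_of_le zero_le_one] at hx hy
  rw [one_mul, dist_eq_norm, dist_eq_norm, intervalIntegral.integral_interval_sub_left
    (intervalIntegrable_of_integrable_leb hg h0 hx) (intervalIntegrable_of_integrable_leb hg h0 hy),
    intervalIntegral.integral_interval_sub_left
    (intervalIntegrable_of_integrable_leb hg.norm h0 hx)
    (intervalIntegrable_of_integrable_leb hg.norm h0 hy)]
  exact intervalIntegral.norm_integral_le_abs_integral_norm

variable {V V₁ V₂ : Type*} [NormedAddCommGroup V] [NormedSpace ℝ V] [NormedAddCommGroup V₁]
  [NormedSpace ℝ V₁] [NormedAddCommGroup V₂] [NormedSpace ℝ V₂]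

/-- `f` is absolutely continuous on `[0,1]` and its almost everywhere derivative is the
integrable function `f'`. -/
structure HasWeakDeriv (f f' : ℝ → V) : Prop where
  absolutelyContinuousOnInterval : AbsolutelyContinuousOnInterval f 0 1
  integrable : Integrable f' leb
  ae_hasDerivAt : ∀ᵐ t ∂leb, HasDerivAt f (f' t) t

namespace HasWeakDeriv

variable {f f' g g' : ℝ → V}

theorem primitive [CompleteSpace V] (hg : Integrable g leb) :
    HasWeakDeriv (fun t => ∫ s in (0 : ℝ)..t, g s) g where
  absolutelyContinuousOnInterval := absolutelyContinuousOnInterval_primitive hg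
  integrable := hg
  ae_hasDerivAt := by
    rw [ae_restrict_iff' measurableSet_Icc]
    filter_upwards [(intervalIntegrable_of_integrable_leb hg (a := 0) (b := 1)
      (by simp) (by simp)).ae_hasDerivAt_integral] with t ht htI
    rw [uIcc_of_le zero_le_one] at ht
    exact ht htI 0 (by simp)

theorem const (c : V) : HasWeakDeriv (fun _ => c) (fun _ => 0) :=
  ⟨(LipschitzWith.const c).lipschitzOnWith.absolutelyContinuousOnInterval, integrable_zero _ _ _,
    .of_forall fun t => hasDerivAt_const t c⟩

theorem add (hf : HasWeakDeriv f f') (hg : HasWeakDeriv g g') :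
    HasWeakDeriv (fun t => f t + g t) (fun t => f' t + g' t) :=
  ⟨hf.1.add hg.1, hf.integrable.add hg.integrable, by
    filter_upwards [hf.ae_hasDerivAt, hg.ae_hasDerivAt] with t a b using a.add b⟩

theorem neg (hf : HasWeakDeriv f f') : HasWeakDeriv (fun t => -f t) (fun t => -f' t) :=
  ⟨hf.1.neg, hf.integrable.neg, by filter_upwards [hf.ae_hasDerivAt] with t a using a.neg⟩

theorem sub (hf : HasWeakDeriv f f') (hg : HasWeakDeriv g g') :
    HasWeakDeriv (fun t => f t - g t) (fun t => f' t - g' t) := by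
  simpa only [sub_eq_add_neg] using hf.add hg.neg

theorem congr_deriv (hf : HasWeakDeriv f f') (h : f' =ᵐ[leb] g') : HasWeakDeriv f g' :=
  ⟨hf.1, hf.integrable.congr h, by
    filter_upwards [hf.ae_hasDerivAt, h] with t a b using b ▸ a⟩

theorem congr (hf : HasWeakDeriv f f') (h : ∀ t ∈ Icc (0 : ℝ) 1, f t = g t) :
    HasWeakDeriv g f' := by
  refine ⟨absolutelyContinuousOnInterval_of_dist_le 1 hf.1 fun x hx y hy => ?_,
    hf.integrable, ?_⟩
  · rw [uIcc_of_le zero_le_one] at hx hy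
    rw [h x hx, h y hy, one_mul]
  · filter_upwards [hf.ae_hasDerivAt, ae_leb_mem_Ioo] with t hft ht
    refine hft.congr_of_eventuallyEq ?_
    filter_upwards [Ioo_mem_nhds ht.1 ht.2] with s hs using (h s ⟨hs.1.le, hs.2.le⟩).symm

theorem continuousOn (hf : HasWeakDeriv f f') : ContinuousOn f (Icc 0 1) := by
  simpa only [uIcc_of_le zero_le_one] using hf.1.continuousOn

theorem eq_of_deriv_zero (hf : HasWeakDeriv f fun _ => 0) {t : ℝ} (ht : t ∈ Icc (0 : ℝ) 1) :
    f t = f 0 := by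
  have hderiv : ∀ᵐ t, t ∈ uIcc (0 : ℝ) 1 → HasDerivAt f 0 t := by
    rw [uIcc_of_le zero_le_one]
    exact (ae_restrict_iff' measurableSet_Icc).1 hf.ae_hasDerivAt
  obtain ⟨C, hC⟩ := hf.1.const_of_ae_hasDerivAt_zero hderiv
  rw [uIcc_of_le zero_le_one] at hC
  rw [hC t ht, hC 0 (by simp)]

theorem eq_add_integral [CompleteSpace V] (hf : HasWeakDeriv f f') {t : ℝ}
    (ht : t ∈ Icc (0 : ℝ) 1) : f t = f 0 + ∫ s in (0 : ℝ)..t, f' s := by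
  have h := ((hf.sub (primitive hf.integrable)).congr_deriv
    (g' := fun _ => 0) (.of_forall fun t => sub_self _)).eq_of_deriv_zero ht
  simp only [intervalIntegral.integral_same, sub_zero] at h
  rw [← h, sub_add_cancel]

theorem comp {Φ : V₁ → V₂} (hΦ : ContDiff ℝ 1 Φ) {f f' : ℝ → V₁} (hf : HasWeakDeriv f f') :
    HasWeakDeriv (fun t => Φ (f t)) (fun t => fderiv ℝ Φ (f t) (f' t)) := by
  refine ⟨?_, integrable_clm_apply_of_continuousOn
    ((hΦ.continuous_fderiv one_ne_zero).comp_continuousOn hf.continuousOn) hf.integrable, ?_⟩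
  · obtain ⟨K, hK⟩ := (hΦ.locallyLipschitz.locallyLipschitzOn
      (s := f '' Icc 0 1)).exists_lipschitzOnWith_of_compact
      (isCompact_Icc.image_of_continuousOn hf.continuousOn)
    refine absolutelyContinuousOnInterval_of_dist_le K hf.1 fun x hx y hy => ?_
    rw [uIcc_of_le zero_le_one] at hx hy
    exact hK.dist_le_mul _ (mem_image_of_mem f hx) _ (mem_image_of_mem f hy)
  · filter_upwards [hf.ae_hasDerivAt] with t ht
    exact (hΦ.differentiable one_ne_zero _).hasFDerivAt.comp_hasDerivAt t ht

theorem clm_comp (L : V₁ →L[ℝ] V₂) {f f' : ℝ → V₁} (hf : HasWeakDeriv f f') :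
    HasWeakDeriv (fun t => L (f t)) (fun t => L (f' t)) := by
  simpa only [L.fderiv] using hf.comp L.contDiff

theorem bilin (B : V₁ →L[ℝ] V₂ →L[ℝ] V) {f f' : ℝ → V₁} {g g' : ℝ → V₂}
    (hf : HasWeakDeriv f f') (hg : HasWeakDeriv g g') :
    HasWeakDeriv (fun t => B (f t) (g t)) (fun t => B (f' t) (g t) + B (f t) (g' t)) := by
  have hpair := (hf.clm_comp (ContinuousLinearMap.inl ℝ V₁ V₂)).add
    (hg.clm_comp (ContinuousLinearMap.inr ℝ V₁ V₂))
  have hB := hpair.comp (Φ := fun x : V₁ × V₂ => B x.1 x.2) B.isBoundedBilinearMap.contDiff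
  simp only [ContinuousLinearMap.inl_apply, ContinuousLinearMap.inr_apply, Prod.mk_add_mk,
    zero_add, add_zero] at hB
  refine hB.congr_deriv (.of_forall fun t => ?_)
  simp [(B.isBoundedBilinearMap.hasFDerivAt (f t, g t)).fderiv, add_comm]

theorem mul {R : Type*} [NormedRing R] [NormedAlgebra ℝ R] {f f' g g' : ℝ → R}
    (hf : HasWeakDeriv f f') (hg : HasWeakDeriv g g') :
    HasWeakDeriv (fun t => f t * g t) (fun t => f' t * g t + f t * g' t) :=
  hf.bilin (ContinuousLinearMap.mul ℝ R) hg

theorem integral_mul_pow {h : ℝ → ℝ} (hh : Integrable h leb) (n : ℕ) :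
    HasWeakDeriv (fun t => (∫ s in (0 : ℝ)..t, h s) ^ (n + 1))
      (fun t => h t * ((n + 1 : ℝ) * (∫ s in (0 : ℝ)..t, h s) ^ n)) :=
  ((primitive hh).comp (Φ := fun x : ℝ => x ^ (n + 1)) (by fun_prop)).congr_deriv
    (.of_forall fun t => by simp [fderiv_eq_smul_deriv])

end HasWeakDeriv

end WeakDeriv

section ContinuousMaps

variable {α X Y Z : Type*} [TopologicalSpace α] [CompactSpace α] [NormedAddCommGroup X]
  [NormedSpace ℝ X] [NormedAddCommGroup Y] [NormedSpace ℝ Y] [NormedAddCommGroup Z]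
  [NormedSpace ℝ Z]

/-- The pointwise action of a continuous bilinear map on continuous functions. -/
def pointwise (B : X →L[ℝ] Y →L[ℝ] Z) : C(α, X) →L[ℝ] C(α, Y) →L[ℝ] C(α, Z) :=
  LinearMap.mkContinuous₂
    (LinearMap.mk₂ ℝ (fun (f : C(α, X)) (g : C(α, Y)) =>
        (⟨fun t => B (f t) (g t), by fun_prop⟩ : C(α, Z)))
      (fun _ _ _ => by ext; simp) (fun _ _ _ => by ext; simp) (fun _ _ _ => by ext; simp)
      (fun _ _ _ => by ext; simp)) ‖B‖ (fun f g => by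
    rw [ContinuousMap.norm_le _ (by positivity)]
    intro t
    refine (B.le_opNorm₂ _ _).trans ?_
    gcongr
    · exact f.norm_coe_le_norm t
    · exact g.norm_coe_le_norm t)

theorem hasFDerivAt_continuousMap_comp (f : C(X, Y)) (f' : C(X, X →L[ℝ] Y))
    (hf : ∀ x, HasFDerivAt f (f' x) x) (σ : C(α, X)) :
    HasFDerivAt (fun σ : C(α, X) => f.comp σ)
      (pointwise (ContinuousLinearMap.id ℝ (X →L[ℝ] Y)) (f'.comp σ)) σ := by
  rw [hasFDerivAt_iff_isLittleO, Asymptotics.isLittleO_iff]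
  intro c hc
  have hcont : Continuous fun σ : C(α, X) => f'.comp σ := ContinuousMap.continuous_postcomp f'
  obtain ⟨δ, hδ, hclose⟩ := (Metric.continuousAt_iff (f := fun σ : C(α, X) => f'.comp σ)
    (a := σ)).1 hcont.continuousAt c hc
  filter_upwards [Metric.ball_mem_nhds σ hδ] with τ hτ
  rw [ContinuousMap.norm_le _ (by positivity)]
  intro t
  have hsegment : ∀ z ∈ segment ℝ (σ t) (τ t), ‖f' z - f' (σ t)‖ ≤ c := by
    intro z hz
    rw [segment_eq_image'] at hz
    obtain ⟨θ, hθ, rfl⟩ := hz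
    have hdist : dist (σ + θ • (τ - σ)) σ < δ := by
      rw [dist_eq_norm, add_sub_cancel_left, norm_smul, Real.norm_of_nonneg hθ.1]
      exact (mul_le_of_le_one_left (norm_nonneg _) hθ.2).trans_lt (mem_ball_iff_norm.1 hτ)
    exact (dist_eq_norm _ _).symm.trans_le
      ((ContinuousMap.dist_lt_iff hc).1 (hclose hdist) t).le
  refine ((convex_segment (σ t) (τ t)).norm_image_sub_le_of_norm_hasFDerivWithin_le'
    (fun z _ => (hf z).hasFDerivWithinAt) hsegment (left_mem_segment ℝ _ _)
    (right_mem_segment ℝ _ _)).trans ?_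
  gcongr
  exact (τ - σ).norm_coe_le_norm t

end ContinuousMaps

theorem contDiff_continuousMap_comp_nat.{u, v, w} {α : Type w} [TopologicalSpace α]
    [CompactSpace α] {X : Type u} [NormedAddCommGroup X] [NormedSpace ℝ X] (n : ℕ) :
    ∀ {Y : Type (max u v)} [NormedAddCommGroup Y] [NormedSpace ℝ Y] (f : C(X, Y)),
      ContDiff ℝ n f → ContDiff ℝ n (fun σ : C(α, X) => f.comp σ) := by
  induction n with
  | zero =>
    intro Y _ _ f _
    exact contDiff_zero.2 (ContinuousMap.continuous_postcomp f)
  | succ n ih =>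
    intro Y _ _ f hf
    push_cast at hf ⊢
    obtain ⟨hdiff, -, hf'⟩ := contDiff_succ_iff_fderiv.1 hf
    let f' : C(X, X →L[ℝ] Y) := ⟨fderiv ℝ f, hf'.continuous⟩
    have hderiv := fun σ : C(α, X) =>
      hasFDerivAt_continuousMap_comp f f' (fun x => (hdiff x).hasFDerivAt) σ
    refine contDiff_succ_iff_fderiv.2 ⟨fun σ => (hderiv σ).differentiableAt, by simp, ?_⟩
    rw [funext fun σ => (hderiv σ).fderiv]
    exact (ContinuousLinearMap.contDiff _).comp (ih f' hf')

theorem contDiff_continuousMap_comp.{u, v, w} {α : Type w} [TopologicalSpace α] [CompactSpace α]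
    {X : Type u} [NormedAddCommGroup X] [NormedSpace ℝ X] {Y : Type (max u v)}
    [NormedAddCommGroup Y] [NormedSpace ℝ Y] (f : C(X, Y)) (hf : ContDiff ℝ ∞ f) :
    ContDiff ℝ ∞ (fun σ : C(α, X) => f.comp σ) :=
  contDiff_infty.2 fun n => contDiff_continuousMap_comp_nat n f (contDiff_infty.1 hf n)

section Volterra

variable {X V : Type*} [NormedAddCommGroup X] [NormedSpace ℝ X] [NormedAddCommGroup V]
  [NormedSpace ℝ V]

theorem integrable_extendI_apply (h : Lp X 1 leb) (w : C(unitInterval, X →L[ℝ] V)) :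
    Integrable (fun s => extendI w s (h s)) leb :=
  integrable_clm_apply_of_continuousOn (continuous_extendI w.continuous).continuousOn
    (L1.integrable_coeFn h)

theorem intervalIntegrable_extendI_apply (h : Lp X 1 leb) (w : C(unitInterval, X →L[ℝ] V))
    (t : unitInterval) : IntervalIntegrable (fun s => extendI w s (h s)) volume 0 t :=
  intervalIntegrable_of_integrable_leb (integrable_extendI_apply h w) (by simp) t.2

/-- The primitive `t ↦ ∫₀ᵗ w(s) h(s) ds`. -/
def primitiveC (h : Lp X 1 leb) (w : C(unitInterval, X →L[ℝ] V)) : C(unitInterval, V) :=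
  ⟨fun t => ∫ s in (0 : ℝ)..t, extendI w s (h s), by
    have hac := absolutelyContinuousOnInterval_primitive (integrable_extendI_apply h w)
    exact hac.continuousOn.comp_continuous continuous_subtype_val
      fun t => (uIcc_of_le (zero_le_one' ℝ)).symm ▸ t.2⟩

theorem norm_primitiveC_le (h : Lp X 1 leb) (w : C(unitInterval, X →L[ℝ] V)) :
    ‖primitiveC h w‖ ≤ ‖h‖ * ‖w‖ := by
  rw [ContinuousMap.norm_le _ (by positivity)]
  intro t
  have hint (t : unitInterval) : IntervalIntegrable (fun s => ‖w‖ * ‖h s‖) volume 0 t :=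
    (intervalIntegrable_of_integrable_leb (L1.integrable_coeFn h).norm (by simp) t.2).const_mul _
  calc ‖∫ s in (0 : ℝ)..t, extendI w s (h s)‖ ≤ ∫ s in (0 : ℝ)..t, ‖w‖ * ‖h s‖ := by
        refine intervalIntegral.norm_integral_le_of_norm_le t.2.1 (.of_forall fun s _ => ?_)
          (hint t)
        exact ((extendI w s).le_opNorm _).trans
          (mul_le_mul_of_nonneg_right (w.norm_coe_le_norm _) (norm_nonneg _))
    _ ≤ ∫ s in (0 : ℝ)..1, ‖w‖ * ‖h s‖ :=
        intervalIntegral.integral_mono_interval le_rfl t.2.1 t.2.2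
          (.of_forall fun s => by positivity) (hint 1)
    _ = ‖h‖ * ‖w‖ := by
        rw [← integral_leb_eq_intervalIntegral, integral_const_mul, L1.norm_eq_integral_norm,
          mul_comm]

/-- The primitive `t ↦ ∫₀ᵗ w(s) h(s) ds` as a continuous bilinear function of `h` and `w`. -/
def volterra : Lp X 1 leb →L[ℝ] C(unitInterval, X →L[ℝ] V) →L[ℝ] C(unitInterval, V) :=
  LinearMap.mkContinuous₂
    (LinearMap.mk₂ ℝ (fun (h : Lp X 1 leb) (w : C(unitInterval, X →L[ℝ] V)) => primitiveC h w)
      (fun h k w => by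
        ext t
        refine (intervalIntegral_congr_ae_leb t ?_).trans (intervalIntegral.integral_add
          (intervalIntegrable_extendI_apply h w t) (intervalIntegrable_extendI_apply k w t))
        filter_upwards [Lp.coeFn_add h k] with s hs
        simp only [hs, Pi.add_apply, map_add])
      (fun c h w => by
        ext t
        refine (intervalIntegral_congr_ae_leb t ?_).trans (intervalIntegral.integral_smul c _)
        filter_upwards [Lp.coeFn_smul c h] with s hs
        simp only [hs, Pi.smul_apply, map_smul])
      (fun h w z => by
        ext t
        exact intervalIntegral.integral_add (intervalIntegrable_extendI_apply h w t)
          (intervalIntegrable_extendI_apply h z t))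
      (fun c h w => by
        ext t
        exact intervalIntegral.integral_smul _ _))
    1 fun h w => by
      rw [one_mul]
      exact norm_primitiveC_le h w

theorem volterra_apply (h : Lp X 1 leb) (w : C(unitInterval, X →L[ℝ] V)) (t : unitInterval) :
    volterra h w t = ∫ s in (0 : ℝ)..t, extendI w s (h s) := rfl

theorem hasWeakDeriv_volterra [CompleteSpace V] (h : Lp X 1 leb)
    (w : C(unitInterval, X →L[ℝ] V)) :
    HasWeakDeriv (extendI (volterra h w)) (fun s => extendI w s (h s)) := by
  refine (HasWeakDeriv.primitive (integrable_extendI_apply h w)).congr fun t ht => ?_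
  exact (extendI_coe (volterra h w) ⟨t, ht⟩).symm

theorem norm_pow_apply_le_of_norm_apply_le_integral
    (K : C(unitInterval, V) →L[ℝ] C(unitInterval, V)) {h : ℝ → ℝ}
    (hh : Integrable h leb) (h0 : ∀ s, 0 ≤ h s)
    (hK : ∀ w t, ‖K w t‖ ≤ ∫ s in (0 : ℝ)..t, h s * ‖extendI w s‖) (n : ℕ)
    (w : C(unitInterval, V)) (t : unitInterval) :
    ‖(K ^ n) w t‖ ≤ ‖w‖ * ((∫ s in (0 : ℝ)..t, h s) ^ n / n.factorial) := by
  induction n generalizing t with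
  | zero => simpa using w.norm_coe_le_norm t
  | succ n ih =>
    have hpow := HasWeakDeriv.integral_mul_pow hh n
    have hint := intervalIntegrable_of_integrable_leb hpow.integrable (a := 0) (b := t)
      (by simp) t.2
    calc ‖(K ^ (n + 1)) w t‖ = ‖K ((K ^ n) w) t‖ := by rw [pow_succ', mul_apply_eq_comp]
      _ ≤ ∫ s in (0 : ℝ)..t, h s * ‖extendI ((K ^ n) w) s‖ := hK _ t
      _ ≤ ∫ s in (0 : ℝ)..t, (‖w‖ / (n + 1).factorial) *
          (h s * ((n + 1 : ℝ) * (∫ r in (0 : ℝ)..s, h r) ^ n)) := by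
        refine intervalIntegral.integral_mono_on t.2.1 ?_ (hint.const_mul _) fun s hs => ?_
        · exact (intervalIntegrable_of_integrable_leb hh (by simp) t.2).mul_continuousOn
            (continuous_extendI ((K ^ n) w).continuous).norm.continuousOn
        · have hs' : s ∈ Icc (0 : ℝ) 1 := ⟨hs.1, hs.2.trans t.2.2⟩
          rw [extendI, IccExtend_of_mem _ _ hs']
          refine (mul_le_mul_of_nonneg_left (ih ⟨s, hs'⟩) (h0 s)).trans_eq ?_
          rw [Nat.factorial_succ]
          push_cast
          field
      _ = ‖w‖ * ((∫ s in (0 : ℝ)..t, h s) ^ (n + 1) / (n + 1).factorial) := by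
        rw [intervalIntegral.integral_const_mul, hpow.eq_add_integral t.2]
        simp only [intervalIntegral.integral_same, zero_pow n.succ_ne_zero, zero_add]
        ring

theorem isUnit_one_add_of_norm_pow_lt_one {S : Type*} [NormedRing S] [CompleteSpace S] (K : S)
    {n : ℕ} (hK : ‖K ^ n‖ < 1) : IsUnit (1 + K) := by
  have hneg : ‖(-K) ^ n‖ < 1 := by
    rcases neg_one_pow_eq_or S n with e | e <;> simpa [neg_pow K, e] using hK
  have hunit := isUnit_one_sub_of_norm_lt_one hneg
  rw [← mul_neg_geom_sum, sub_neg_eq_add] at hunit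
  refine ((Commute.isUnit_mul_iff (Commute.sum_right _ _ _ fun i _ => ?_)).1 hunit).1
  exact (Commute.one_left _).add_left ((Commute.refl K).neg_right.pow_right i)

theorem isUnit_one_add_of_norm_apply_le_integral [CompleteSpace V]
    (K : C(unitInterval, V) →L[ℝ] C(unitInterval, V)) {h : ℝ → ℝ}
    (hh : Integrable h leb) (h0 : ∀ s, 0 ≤ h s)
    (hK : ∀ w t, ‖K w t‖ ≤ ∫ s in (0 : ℝ)..t, h s * ‖extendI w s‖) : IsUnit (1 + K) := by
  set H := ∫ s in (0 : ℝ)..1, h s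
  have hH : 0 ≤ H := intervalIntegral.integral_nonneg zero_le_one fun s _ => h0 s
  have hKn (n : ℕ) : ‖K ^ n‖ ≤ H ^ n / n.factorial := by
    refine ContinuousLinearMap.opNorm_le_bound _ (by positivity) fun w => ?_
    rw [ContinuousMap.norm_le _ (by positivity)]
    intro t
    refine (norm_pow_apply_le_of_norm_apply_le_integral K hh h0 hK n w t).trans ?_
    rw [mul_comm]
    gcongr
    · exact intervalIntegral.integral_nonneg t.2.1 fun s _ => h0 s
    · exact intervalIntegral.integral_mono_interval le_rfl t.2.1 t.2.2 (.of_forall h0)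
        (intervalIntegrable_of_integrable_leb hh (by simp) (by simp))
  obtain ⟨n, hn⟩ := ((FloorSemiring.tendsto_pow_div_factorial_atTop H).eventually
    (gt_mem_nhds zero_lt_one)).exists
  exact isUnit_one_add_of_norm_pow_lt_one K ((hKn n).trans_lt hn)

end Volterra

namespace Curve

variable {p : ℝ≥0∞}

theorem val_zero (σ : Curve p) : σ.val 0 = 0 :=
  (extendI_coe σ.1 0).trans σ.2.1

variable [hp : Fact (1 ≤ p)]

theorem hasWeakDeriv (σ : Curve p) : HasWeakDeriv σ.val σ.vel :=
  ⟨σ.2.2.1, (memLp_vel σ).integrable hp.out, by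
    filter_upwards [ae_differentiableAt_of_ac σ.2.2.1] with t ht using ht.hasDerivAt⟩

theorem curveSubmodule_le_curveSubmodule_one : curveSubmodule p ≤ curveSubmodule 1 :=
  fun _ hσ => ⟨hσ.1, hσ.2.1, hσ.2.2.mono_exponent hp.out⟩

/-- The velocity as an element of `L_1`, depending continuously on the curve for every `p`. -/
def velL1 : Curve p →L[ℝ] Lp Mink 1 leb :=
  LinearMap.mkContinuous ((velL 1).comp (Submodule.inclusion curveSubmodule_le_curveSubmodule_one))
    1 fun σ => by
      have : IsProbabilityMeasure leb := ⟨by simp⟩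
      rw [one_mul]
      change ‖((memLp_vel σ).mono_exponent hp.out).toLp σ.vel‖ ≤ ‖(memLp_vel σ).toLp σ.vel‖
      rw [Lp.norm_toLp, Lp.norm_toLp]
      exact ENNReal.toReal_mono (memLp_vel σ).2.ne
        (eLpNorm_le_eLpNorm_of_exponent_le hp.out (memLp_vel σ).1)

theorem coeFn_velL1 (σ : Curve p) : velL1 σ =ᵐ[leb] σ.vel :=
  MemLp.coeFn_toLp ((memLp_vel σ).mono_exponent hp.out)

/-- The inclusion of the space of curves in the space of continuous functions. -/
def posL : Curve p →L[ℝ] C(unitInterval, Mink) :=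
  (ContinuousLinearMap.flip (𝕜 := ℝ) (𝕜₂ := ℝ) (𝕜₃ := ℝ) (E := Lp Mink 1 leb)
    (F := C(unitInterval, Mink →L[ℝ] Mink)) (G := C(unitInterval, Mink)) volterra
    (ContinuousMap.const _ (ContinuousLinearMap.id ℝ Mink))).comp velL1

@[simp] theorem posL_apply (σ : Curve p) (t : unitInterval) : posL σ t = σ.val t := by
  have hval := σ.hasWeakDeriv.eq_add_integral t.2
  rw [σ.val_zero, zero_add, ← intervalIntegral_congr_ae_leb t σ.coeFn_velL1] at hval
  exact hval.symm

@[simp] theorem extendI_posL (σ : Curve p) : extendI (posL σ) = σ.val := by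
  have hcoe : ⇑(posL σ) = σ.1 := funext fun t => (posL_apply σ t).trans (extendI_coe σ.1 t)
  rw [hcoe, val]

end Curve

section Bilinear

variable {E X Y Z : Type*} [NormedAddCommGroup E] [NormedSpace ℝ E] [NormedAddCommGroup X]
  [NormedSpace ℝ X] [NormedAddCommGroup Y] [NormedSpace ℝ Y] [NormedAddCommGroup Z]
  [NormedSpace ℝ Z]

theorem contDiff_bilin (B : X →L[ℝ] Y →L[ℝ] Z) {f : E → X} {g : E → Y} {n : WithTop ℕ∞}
    (hf : ContDiff ℝ n f) (hg : ContDiff ℝ n g) : ContDiff ℝ n fun y => B (f y) (g y) :=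
  (B.contDiff.comp hf).clm_apply hg

theorem fderiv_bilin_apply (B : X →L[ℝ] Y →L[ℝ] Z) {f : E → X} {g : E → Y} {x : E}
    (hf : DifferentiableAt ℝ f x) (hg : DifferentiableAt ℝ g x) (u : E) :
    fderiv ℝ (fun y => B (f y) (g y)) x u =
      B (fderiv ℝ f x u) (g x) + B (f x) (fderiv ℝ g x u) := by
  rw [(B.hasFDerivAt_of_bilinear hf.hasFDerivAt hg.hasFDerivAt).fderiv]
  simp [add_comm]

theorem fderiv_eq_of_add_bilin_eq_const {D : Type*} [NormedAddCommGroup D] [NormedSpace ℝ D]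
    (T : X →L[ℝ] Y →L[ℝ] Z) (S : D →L[ℝ] Z →L[ℝ] Y)
    (h : E →L[ℝ] X) {f : E → D} {W : E → Z} (hf : Differentiable ℝ f) (hW : Differentiable ℝ W)
    {c : Z} (hc : ∀ σ, W σ + T (h σ) (S (f σ) (W σ)) = c) (σ u : E) :
    fderiv ℝ W σ u = -(T (h u) (S (f σ) (W σ)) + T (h σ) (S (fderiv ℝ f σ u) (W σ)) +
      T (h σ) (S (f σ) (fderiv ℝ W σ u))) := by
  have hS : Differentiable ℝ fun σ => S (f σ) (W σ) := (S.differentiable.comp hf).clm_apply hW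
  have hT : Differentiable ℝ fun σ => T (h σ) (S (f σ) (W σ)) :=
    (T.differentiable.comp h.differentiable).clm_apply hS
  have hzero : fderiv ℝ (fun σ => W σ + T (h σ) (S (f σ) (W σ))) σ u = 0 := by
    rw [funext hc, fderiv_fun_const, Pi.zero_apply, zero_apply]
  rw [fderiv_fun_add (hW σ) (hT σ), add_apply, fderiv_bilin_apply T h.differentiableAt (hS σ),
    fderiv_bilin_apply S (hf σ) (hW σ), ContinuousLinearMap.fderiv, map_add] at hzero
  rw [add_assoc]
  exact eq_neg_of_add_eq_zero_left hzero

end Bilinear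

section CompPosition

variable {Y : Type*} [NormedAddCommGroup Y] [NormedSpace ℝ Y] {p : ℝ≥0∞} [Fact (1 ≤ p)]
  {f : C(Mink, Y)}

/-- The derivative of a smooth function as a continuous map. -/
def fderivC (hf : ContDiff ℝ ∞ f) : C(Mink, Mink →L[ℝ] Y) :=
  ⟨fderiv ℝ f, hf.continuous_fderiv (by simp)⟩

/-- Evaluation of a linear map at a vector, as a bilinear map. -/
abbrev evalB (X Y : Type*) [NormedAddCommGroup X] [NormedSpace ℝ X] [NormedAddCommGroup Y]
    [NormedSpace ℝ Y] : (X →L[ℝ] Y) →L[ℝ] X →L[ℝ] Y :=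
  ContinuousLinearMap.id ℝ (X →L[ℝ] Y)

theorem contDiff_comp_posL (hf : ContDiff ℝ ∞ f) :
    ContDiff ℝ ∞ fun σ : Curve p => f.comp (Curve.posL σ) :=
  (contDiff_continuousMap_comp f hf).comp Curve.posL.contDiff

theorem fderiv_comp_posL (hf : ContDiff ℝ ∞ f) (σ u : Curve p) :
    fderiv ℝ (fun σ : Curve p => f.comp (Curve.posL σ)) σ u =
      pointwise (evalB Mink Y) ((fderivC hf).comp (Curve.posL σ)) (Curve.posL u) := by
  have h := (hasFDerivAt_continuousMap_comp (α := unitInterval) f (fderivC hf)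
    (fun x => (hf.differentiable (by simp) x).hasFDerivAt) (Curve.posL σ)).comp σ
    Curve.posL.hasFDerivAt
  exact congrArg (fun T : Curve p →L[ℝ] C(unitInterval, Y) => T u) h.fderiv

theorem hasWeakDeriv_comp_val {f : C(Mink, Mink →L[ℝ] Y)} (hf : ContDiff ℝ ∞ f) (σ u : Curve p) :
    HasWeakDeriv (fun t => f (σ.val t) (u.val t)) (fun t =>
      fderiv ℝ f (σ.val t) (σ.vel t) (u.val t) + f (σ.val t) (u.vel t)) :=
  (σ.hasWeakDeriv.comp (Φ := f) (hf.of_le (by simp))).bilin (evalB Mink Y) u.hasWeakDeriv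

end CompPosition

section Transport

variable {R : Type*} [NormedRing R] [NormedAlgebra ℝ R] {p : ℝ≥0∞} [Fact (1 ≤ p)]

/-- `(L, w) ↦ (v ↦ L v * w)`. -/
def actR : (Mink →L[ℝ] R) →L[ℝ] R →L[ℝ] (Mink →L[ℝ] R) :=
  ((ContinuousLinearMap.compL ℝ Mink R R).comp (ContinuousLinearMap.mul ℝ R).flip).flip

/-- `(w, L) ↦ (v ↦ w * L v)`. -/
def actL : R →L[ℝ] (Mink →L[ℝ] R) →L[ℝ] (Mink →L[ℝ] R) :=
  (ContinuousLinearMap.compL ℝ Mink R R).comp (ContinuousLinearMap.mul ℝ R)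

/-- The Volterra operator `w ↦ ∫₀ᵗ T(A(σ(s)), w(s))(σ̇(s)) ds` of the linear equation
`w' = -T(A(σ), w)(σ̇)` along `σ`. Parallel transport is the case `T = actR`. -/
def connOp (T : (Mink →L[ℝ] R) →L[ℝ] R →L[ℝ] (Mink →L[ℝ] R)) (A : C(Mink, Mink →L[ℝ] R))
    (σ : Curve p) : C(unitInterval, R) →L[ℝ] C(unitInterval, R) :=
  (volterra (Curve.velL1 σ)).comp (pointwise T (A.comp (Curve.posL σ)))

variable (T : (Mink →L[ℝ] R) →L[ℝ] R →L[ℝ] (Mink →L[ℝ] R)) (A : C(Mink, Mink →L[ℝ] R))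

theorem connOp_apply (σ : Curve p) (w : C(unitInterval, R)) (t : unitInterval) :
    connOp T A σ w t = ∫ s in (0 : ℝ)..t, T (A (σ.val s)) (extendI w s) (σ.vel s) := by
  refine (volterra_apply _ _ _).trans (intervalIntegral_congr_ae_leb t ?_)
  filter_upwards [σ.coeFn_velL1] with s hs
  rw [hs, ← Curve.extendI_posL]
  rfl

theorem isUnit_one_add_connOp [CompleteSpace R] (σ : Curve p) : IsUnit (1 + connOp T A σ) := by
  have hTA : Continuous fun x => ‖T (A x)‖ :=
    (T.continuous.comp A.continuous).norm (E := R →L[ℝ] Mink →L[ℝ] R)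
  have hA := hTA.comp_continuousOn σ.hasWeakDeriv.continuousOn
  have hint : Integrable (fun s => ‖T (A (σ.val s))‖ * ‖σ.vel s‖) leb :=
    integrable_clm_apply_of_continuousOn
      ((ContinuousLinearMap.mul ℝ ℝ).continuous.comp_continuousOn hA) σ.hasWeakDeriv.integrable.norm
  refine isUnit_one_add_of_norm_apply_le_integral _ hint (fun s => by positivity) fun w t => ?_
  rw [connOp_apply]
  refine intervalIntegral.norm_integral_le_of_norm_le t.2.1 (.of_forall fun s _ => ?_) ?_
  · calc ‖T (A (σ.val s)) (extendI w s) (σ.vel s)‖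
        ≤ ‖T (A (σ.val s))‖ * ‖extendI w s‖ * ‖σ.vel s‖ := ContinuousLinearMap.le_opNorm₂ _ _ _
      _ = ‖T (A (σ.val s))‖ * ‖σ.vel s‖ * ‖extendI w s‖ := mul_right_comm _ _ _
  · exact (intervalIntegrable_of_integrable_leb hint (by simp) t.2).mul_continuousOn
      (continuous_extendI w.continuous).norm.continuousOn

theorem eq_of_add_connOp_eq [CompleteSpace R] {σ : Curve p} {w z : C(unitInterval, R)}
    (h : w + connOp T A σ w = z + connOp T A σ z) : w = z := by
  have hinv := Ring.inverse_mul_cancel _ (isUnit_one_add_connOp T A σ)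
  have happly (w : C(unitInterval, R)) :
      Ring.inverse (1 + connOp T A σ) (w + connOp T A σ w) = w := congr($hinv w)
  rw [← happly w, h, happly]

theorem eqOn_of_hasWeakDeriv_connection [CompleteSpace R] {σ : Curve p} {w z : ℝ → R}
    (hw : HasWeakDeriv w fun t => -T (A (σ.val t)) (w t) (σ.vel t))
    (hz : HasWeakDeriv z fun t => -T (A (σ.val t)) (z t) (σ.vel t)) (h0 : w 0 = z 0) :
    EqOn w z (Icc 0 1) := by
  have hsub := hw.sub hz
  let d : C(unitInterval, R) := ⟨fun t => w t - z t, hsub.continuousOn.domRestrict⟩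
  have hd : d + connOp T A σ d = 0 + connOp T A σ 0 := by
    ext t
    have hint := hsub.eq_add_integral t.2
    rw [h0, sub_self, zero_add] at hint
    rw [map_zero, add_zero, ContinuousMap.add_apply, connOp_apply, ContinuousMap.zero_apply]
    refine (congrArg₂ (· + ·) hint rfl).trans ?_
    rw [← eq_neg_iff_add_eq_zero, ← intervalIntegral.integral_neg]
    refine intervalIntegral_congr_ae_leb t ?_
    filter_upwards [ae_leb_mem_Ioo] with s hs
    have hds : extendI d s = w s - z s := IccExtend_of_mem zero_le_one _ ⟨hs.1.le, hs.2.le⟩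
    rw [hds, map_sub, sub_apply]
    abel
  intro t ht
  exact sub_eq_zero.1 congr($(eq_of_add_connOp_eq T A hd) ⟨t, ht⟩)

/-- The parallel transport `t ↦ U_{t,0}(σ)`. -/
def transportC (σ : Curve p) : C(unitInterval, R) := Ring.inverse (1 + connOp actR A σ) 1

theorem transportC_add_connOp [CompleteSpace R] (σ : Curve p) :
    transportC A σ + connOp actR A σ (transportC A σ) = 1 :=
  congr($(Ring.mul_inverse_cancel _ (isUnit_one_add_connOp actR A σ)) 1)

theorem extendI_transportC_zero [CompleteSpace R] (σ : Curve p) :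
    extendI (transportC A σ) 0 = 1 := by
  have h := congr($(transportC_add_connOp A σ) 0)
  have hzero : connOp actR A σ (transportC A σ) 0 = 0 := by
    simp only [connOp_apply, Icc.coe_zero, intervalIntegral.integral_same]
  rw [ContinuousMap.add_apply, hzero, add_zero] at h
  exact (extendI_coe (transportC A σ) 0).trans h

theorem hasWeakDeriv_transportC [CompleteSpace R] (σ : Curve p) :
    HasWeakDeriv (extendI (transportC A σ))
      (fun t => -(A (σ.val t) (σ.vel t) * extendI (transportC A σ) t)) := by
  have h := (HasWeakDeriv.const (1 : R)).sub (hasWeakDeriv_volterra (Curve.velL1 σ)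
    (pointwise actR (A.comp (Curve.posL σ)) (transportC A σ)))
  refine (h.congr fun t ht => ?_).congr_deriv ?_
  · rw [extendI, extendI, IccExtend_of_mem _ _ ht, IccExtend_of_mem _ _ ht]
    exact sub_eq_of_eq_add congr($(transportC_add_connOp A σ) ⟨t, ht⟩).symm
  · filter_upwards [σ.coeFn_velL1] with s hs
    rw [hs, zero_sub, ← Curve.extendI_posL]
    rfl

theorem eqOn_transportC [CompleteSpace R] {σ : Curve p} {w : ℝ → R}
    (hw : HasWeakDeriv w fun t => -(A (σ.val t) (σ.vel t) * w t)) (h0 : w 0 = 1) :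
    EqOn w (extendI (transportC A σ)) (Icc 0 1) :=
  eqOn_of_hasWeakDeriv_connection actR A hw (hasWeakDeriv_transportC A σ)
    (h0.trans (extendI_transportC_zero A σ).symm)

variable {A} (hA : ContDiff ℝ ∞ A)
include hA

theorem contDiff_connOp : ContDiff ℝ ∞ (connOp (p := p) T A) :=
  (volterra.contDiff.comp Curve.velL1.contDiff).clm_comp
    ((pointwise T).contDiff.comp (contDiff_comp_posL hA))

variable [CompleteSpace R]

theorem contDiff_transportC : ContDiff ℝ ∞ (transportC (p := p) A) := by
  have hinv : ContDiff ℝ ∞ fun σ : Curve p => Ring.inverse (1 + connOp actR A σ) := by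
    rw [contDiff_iff_contDiffAt]
    intro σ
    obtain ⟨x, hx⟩ := isUnit_one_add_connOp actR A σ
    have hring := contDiffAt_ringInverse (n := ∞) ℝ
      (R := C(unitInterval, R) →L[ℝ] C(unitInterval, R)) x
    rw [hx] at hring
    exact hring.comp σ (contDiff_const.add (contDiff_connOp actR hA)).contDiffAt
  exact hinv.clm_apply contDiff_const

theorem differentiable_transportC : Differentiable ℝ (transportC (p := p) A) :=
  (contDiff_transportC hA).differentiable (by simp)

theorem fderiv_transportC_eq_neg_volterra (σ u : Curve p) :
    fderiv ℝ (transportC A) σ u =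
      -(volterra (Curve.velL1 u) (pointwise actR (A.comp (Curve.posL σ)) (transportC A σ)) +
        volterra (Curve.velL1 σ) (pointwise actR (pointwise (evalB Mink (Mink →L[ℝ] R))
          ((fderivC hA).comp (Curve.posL σ)) (Curve.posL u)) (transportC A σ)) +
        volterra (Curve.velL1 σ) (pointwise actR (A.comp (Curve.posL σ))
          (fderiv ℝ (transportC A) σ u))) := by
  have leibniz := fderiv_eq_of_add_bilin_eq_const (E := Curve p) (X := Lp Mink 1 leb)
    (Y := C(unitInterval, Mink →L[ℝ] R)) (Z := C(unitInterval, R))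
    (D := C(unitInterval, Mink →L[ℝ] R)) volterra (pointwise actR)
    Curve.velL1 (f := fun σ => A.comp (Curve.posL σ)) (W := transportC A) (c := 1)
  have h := leibniz ((contDiff_comp_posL hA).differentiable (by simp))
    (differentiable_transportC hA) (transportC_add_connOp A) σ u
  rwa [fderiv_comp_posL hA] at h

theorem extendI_fderiv_transportC_zero (σ u : Curve p) :
    extendI (fderiv ℝ (transportC A) σ u) 0 = 0 := by
  refine (extendI_coe (fderiv ℝ (transportC A) σ u) 0).trans ?_
  rw [fderiv_transportC_eq_neg_volterra hA σ u]
  simp [volterra_apply]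

theorem hasWeakDeriv_fderiv_transportC (σ u : Curve p) :
    HasWeakDeriv (extendI (fderiv ℝ (transportC A) σ u))
      (fun t => -(A (σ.val t) (u.vel t) * extendI (transportC A σ) t +
        fderiv ℝ A (σ.val t) (u.val t) (σ.vel t) * extendI (transportC A σ) t +
        A (σ.val t) (σ.vel t) * extendI (fderiv ℝ (transportC A) σ u) t)) := by
  have h := (((hasWeakDeriv_volterra (Curve.velL1 u)
      (pointwise actR (A.comp (Curve.posL σ)) (transportC A σ))).add
    (hasWeakDeriv_volterra (Curve.velL1 σ) (pointwise actR (pointwise (evalB Mink (Mink →L[ℝ] R))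
      ((fderivC hA).comp (Curve.posL σ)) (Curve.posL u)) (transportC A σ)))).add
    (hasWeakDeriv_volterra (Curve.velL1 σ) (pointwise actR (A.comp (Curve.posL σ))
      (fderiv ℝ (transportC A) σ u)))).neg
  refine (h.congr fun t ht => ?_).congr_deriv ?_
  · simp only [extendI, IccExtend_of_mem _ _ ht]
    exact congr($(fderiv_transportC_eq_neg_volterra hA σ u) ⟨t, ht⟩).symm
  · filter_upwards [σ.coeFn_velL1, u.coeFn_velL1] with s hs hu
    rw [hs, hu, ← Curve.extendI_posL, ← Curve.extendI_posL]
    rfl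

end Transport

section Curvature

variable {R : Type*} [NormedRing R] [NormedAlgebra ℝ R]

/-- The commutator `(u, v) ↦ L u * M v - M v * L u` of two `R`-valued linear forms. -/
def commB (L M : Mink →L[ℝ] R) : Mink →L[ℝ] Mink →L[ℝ] R :=
  (((ContinuousLinearMap.mul ℝ R).comp L).flip.comp M).flip -
    (((ContinuousLinearMap.mul ℝ R).flip.comp L).flip.comp M).flip

/-- The curvature two-form `F(u, v) = ∂_u A(v) - ∂_v A(u) + [A(u), A(v)]`. -/
def curvForm (A : Mink → Mink →L[ℝ] R) (x : Mink) : Mink →L[ℝ] Mink →L[ℝ] R :=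
  fderiv ℝ A x - (fderiv ℝ A x).flip + commB (A x) (A x)

/-- The covariant derivative `∇_w F(u, v)` of the curvature. -/
def covCurv (A : Mink → Mink →L[ℝ] R) (x w u : Mink) : Mink →L[ℝ] R :=
  fderiv ℝ (curvForm A) x w u + (actL (A x w) (curvForm A x u) - actR (curvForm A x u) (A x w))

theorem curvForm_apply (A : Mink → Mink →L[ℝ] R) (x u v : Mink) : curvForm A x u v =
    fderiv ℝ A x u v - fderiv ℝ A x v u + (A x u * A x v - A x v * A x u) := rfl

theorem covCurv_apply (A : Mink → Mink →L[ℝ] R) (x w u v : Mink) : covCurv A x w u v =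
    fderiv ℝ (curvForm A) x w u v + (A x w * curvForm A x u v - curvForm A x u v * A x w) := rfl

theorem contDiff_curvForm {A : Mink → Mink →L[ℝ] R} (hA : ContDiff ℝ ∞ A) :
    ContDiff ℝ ∞ (curvForm A) := by
  have hfderiv : ContDiff ℝ ∞ (fderiv ℝ A) := hA.fderiv_right (m := ∞) (by simp)
  refine contDiff_clm_apply_iff.2 fun u => contDiff_clm_apply_iff.2 fun v => ?_
  have happly (u : Mink) : ContDiff ℝ ∞ fun x => A x u := hA.clm_apply contDiff_const
  have hfderiv_apply (u v : Mink) : ContDiff ℝ ∞ fun x => fderiv ℝ A x u v :=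
    (hfderiv.clm_apply contDiff_const).clm_apply contDiff_const
  exact ((hfderiv_apply u v).sub (hfderiv_apply v u)).add
    (((happly u).mul (happly v)).sub ((happly v).mul (happly u)))

end Curvature

section UnitaryTransport

variable {R : Type*} [NormedRing R] [NormedAlgebra ℝ R] [StarRing R]
  {p : ℝ≥0∞} [Fact (1 ≤ p)] {A : C(Mink, Mink →L[ℝ] R)}

/-- The conjugation `X ↦ U_{0,t} X U_{t,0}` along the curve `σ`, for a skew-Hermitian connection
`A`; it transports operators at `σ(t)` back to the origin. -/
def conjL (A : C(Mink, Mink →L[ℝ] R)) (σ : Curve p) (t : ℝ) : R →L[ℝ] R :=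
  (ContinuousLinearMap.mul ℝ R (star (extendI (transportC A σ) t))).comp
    ((ContinuousLinearMap.mul ℝ R).flip (extendI (transportC A σ) t))

theorem conjL_apply (σ : Curve p) (t : ℝ) (X : R) : conjL A σ t X =
    star (extendI (transportC A σ) t) * (X * extendI (transportC A σ) t) := rfl

variable [CompleteSpace R] [NormedStarGroup R] [StarModule ℝ R] (hs : ∀ x v, star (A x v) = -A x v)
include hs

theorem hasWeakDeriv_star_transportC (σ : Curve p) :
    HasWeakDeriv (fun t => star (extendI (transportC A σ) t))
      (fun t => star (extendI (transportC A σ) t) * A (σ.val t) (σ.vel t)) := by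
  refine ((hasWeakDeriv_transportC A σ).clm_comp
    (starL' ℝ : R ≃L[ℝ] R).toContinuousLinearMap).congr_deriv (.of_forall fun t => ?_)
  simp [hs]

theorem star_transportC_mul (σ : Curve p) {t : ℝ} (ht : t ∈ Icc (0 : ℝ) 1) :
    star (extendI (transportC A σ) t) * extendI (transportC A σ) t = 1 := by
  have h := ((hasWeakDeriv_star_transportC hs σ).mul (hasWeakDeriv_transportC A σ)).congr_deriv
    (g' := fun _ => 0) (.of_forall fun t => by noncomm_ring)
  rw [h.eq_of_deriv_zero ht, extendI_transportC_zero, star_one, one_mul]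

/-- Both `U U*` and `1` solve the linear equation `w' = -[A(σ)(σ̇), w]` with `w(0) = 1`. -/
theorem transportC_mul_star (σ : Curve p) {t : ℝ} (ht : t ∈ Icc (0 : ℝ) 1) :
    extendI (transportC A σ) t * star (extendI (transportC A σ) t) = 1 := by
  let ad : (Mink →L[ℝ] R) →L[ℝ] R →L[ℝ] (Mink →L[ℝ] R) :=
    ((ContinuousLinearMap.compL ℝ Mink R R).comp
      ((ContinuousLinearMap.mul ℝ R).flip - ContinuousLinearMap.mul ℝ R)).flip
  have had (L : Mink →L[ℝ] R) (w : R) (v : Mink) : ad L w v = L v * w - w * L v := rfl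
  have hsq := ((hasWeakDeriv_transportC A σ).mul (hasWeakDeriv_star_transportC hs σ)).congr_deriv
    (g' := fun t => -ad (A (σ.val t)) (extendI (transportC A σ) t *
      star (extendI (transportC A σ) t)) (σ.vel t))
    (.of_forall fun t => by simp only [had]; noncomm_ring)
  have hone := (HasWeakDeriv.const (1 : R)).congr_deriv
    (g' := fun t => -ad (A (σ.val t)) 1 (σ.vel t)) (.of_forall fun t => by simp [had])
  exact eqOn_of_hasWeakDeriv_connection ad A hsq hone
    (by rw [extendI_transportC_zero, star_one, mul_one]) ht

end UnitaryTransport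

set_option maxSynthPendingDepth 3

section Bilinear

variable {E D M X Y Z X' Y' Z' : Type*} [NormedAddCommGroup E] [NormedSpace ℝ E]
  [NormedAddCommGroup D] [NormedSpace ℝ D] [NormedAddCommGroup M] [NormedSpace ℝ M]
  [NormedAddCommGroup X] [NormedSpace ℝ X] [NormedAddCommGroup Y] [NormedSpace ℝ Y]
  [NormedAddCommGroup Z] [NormedSpace ℝ Z] [NormedAddCommGroup X'] [NormedSpace ℝ X']
  [NormedAddCommGroup Y'] [NormedSpace ℝ Y'] [NormedAddCommGroup Z'] [NormedSpace ℝ Z']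
  (B : X →L[ℝ] X' →L[ℝ] Z') (B₁ : Y →L[ℝ] Y' →L[ℝ] X') (B₂ : Z →L[ℝ] Y →L[ℝ] Y')
  (B₃ : D →L[ℝ] M →L[ℝ] Z) {h : E → X} {f g : E → Y} {k : E → D} (c : M)

theorem contDiff_bilin_nested {n : WithTop ℕ∞} (hh : ContDiff ℝ n h) (hf : ContDiff ℝ n f)
    (hk : ContDiff ℝ n k) (hg : ContDiff ℝ n g) :
    ContDiff ℝ n fun σ => B (h σ) (B₁ (f σ) (B₂ (B₃ (k σ) c) (g σ))) :=
  contDiff_bilin B hh (contDiff_bilin B₁ hf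
    (contDiff_bilin B₂ (contDiff_bilin B₃ hk contDiff_const) hg))

theorem fderiv_bilin_nested_apply (hh : Differentiable ℝ h) (hf : Differentiable ℝ f)
    (hk : Differentiable ℝ k) (hg : Differentiable ℝ g) (σ v : E) :
    fderiv ℝ (fun σ => B (h σ) (B₁ (f σ) (B₂ (B₃ (k σ) c) (g σ)))) σ v =
      B (fderiv ℝ h σ v) (B₁ (f σ) (B₂ (B₃ (k σ) c) (g σ))) +
      (B (h σ) (B₁ (fderiv ℝ f σ v) (B₂ (B₃ (k σ) c) (g σ))) +
      (B (h σ) (B₁ (f σ) (B₂ (B₃ (fderiv ℝ k σ v) c) (g σ))) +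
        B (h σ) (B₁ (f σ) (B₂ (B₃ (k σ) c) (fderiv ℝ g σ v))))) := by
  have d₃ : Differentiable ℝ fun σ => B₃ (k σ) c :=
    (B₃.differentiable.comp hk).clm_apply (differentiable_const c)
  have d₂ : Differentiable ℝ fun σ => B₂ (B₃ (k σ) c) (g σ) :=
    (B₂.differentiable.comp d₃).clm_apply hg
  have d₁ : Differentiable ℝ fun σ => B₁ (f σ) (B₂ (B₃ (k σ) c) (g σ)) :=
    (B₁.differentiable.comp hf).clm_apply d₂
  rw [fderiv_bilin_apply B (hh σ) (d₁ σ), fderiv_bilin_apply B₁ (hf σ) (d₂ σ),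
    fderiv_bilin_apply B₂ (d₃ σ) (hg σ), fderiv_bilin_apply B₃ (hk σ) (differentiableAt_const c)]
  simp only [fderiv_fun_const, Pi.zero_apply, zero_apply, map_zero, add_zero, map_add]

end Bilinear

section SandwichInt

variable {R : Type*} [NormedRing R] [NormedAlgebra ℝ R]

/-- The function `t ↦ ∫₀ᵗ V(s) F(s)(u(s), h(s)) W(s) ds`. -/
def sandwichInt (h : Lp Mink 1 leb) (V : C(unitInterval, R))
    (F : C(unitInterval, Mink →L[ℝ] Mink →L[ℝ] R)) (u : C(unitInterval, Mink))
    (W : C(unitInterval, R)) : C(unitInterval, R) :=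
  volterra h (pointwise actL V
    (pointwise actR (pointwise (evalB Mink (Mink →L[ℝ] R)) F u) W))

variable (h : Lp Mink 1 leb) (V : C(unitInterval, R))
    (F : C(unitInterval, Mink →L[ℝ] Mink →L[ℝ] R)) (u : C(unitInterval, Mink))
    (W : C(unitInterval, R))

theorem extendI_sandwichInt_zero : extendI (sandwichInt h V F u W) 0 = 0 := by
  refine (extendI_coe (sandwichInt h V F u W) 0).trans ?_
  simp [sandwichInt, volterra_apply]

theorem hasWeakDeriv_sandwichInt [CompleteSpace R] :
    HasWeakDeriv (extendI (sandwichInt h V F u W)) fun t =>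
      extendI V t * (extendI F t (extendI u t) (h t) * extendI W t) :=
  hasWeakDeriv_volterra _ _

variable {E : Type*} [NormedAddCommGroup E] [NormedSpace ℝ E] {h : E → Lp Mink 1 leb}
  {V W : E → C(unitInterval, R)} {F : E → C(unitInterval, Mink →L[ℝ] Mink →L[ℝ] R)}

theorem contDiff_sandwichInt {n : WithTop ℕ∞} (hh : ContDiff ℝ n h) (hV : ContDiff ℝ n V)
    (hF : ContDiff ℝ n F) (hW : ContDiff ℝ n W) :
    ContDiff ℝ n fun σ => sandwichInt (h σ) (V σ) (F σ) u (W σ) := by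
  have smooth := contDiff_bilin_nested (E := E) (D := C(unitInterval, Mink →L[ℝ] Mink →L[ℝ] R))
    (M := C(unitInterval, Mink)) (X := Lp Mink 1 leb) (Y := C(unitInterval, R))
    (Z := C(unitInterval, Mink →L[ℝ] R)) (X' := C(unitInterval, Mink →L[ℝ] R))
    (Y' := C(unitInterval, Mink →L[ℝ] R)) (Z' := C(unitInterval, R)) volterra (pointwise actL)
    (pointwise actR) (pointwise (evalB Mink (Mink →L[ℝ] R))) (h := h) (f := V) (g := W) (k := F) u
    (n := n)
  exact smooth hh hV hF hW

theorem fderiv_sandwichInt (hh : Differentiable ℝ h) (hV : Differentiable ℝ V)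
    (hF : Differentiable ℝ F) (hW : Differentiable ℝ W) (σ v : E) :
    fderiv ℝ (fun σ => sandwichInt (h σ) (V σ) (F σ) u (W σ)) σ v =
      sandwichInt (fderiv ℝ h σ v) (V σ) (F σ) u (W σ) +
      (sandwichInt (h σ) (fderiv ℝ V σ v) (F σ) u (W σ) +
      (sandwichInt (h σ) (V σ) (fderiv ℝ F σ v) u (W σ) +
        sandwichInt (h σ) (V σ) (F σ) u (fderiv ℝ W σ v))) := by
  have leibniz := fderiv_bilin_nested_apply (E := E)
    (D := C(unitInterval, Mink →L[ℝ] Mink →L[ℝ] R))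
    (M := C(unitInterval, Mink)) (X := Lp Mink 1 leb) (Y := C(unitInterval, R))
    (Z := C(unitInterval, Mink →L[ℝ] R)) (X' := C(unitInterval, Mink →L[ℝ] R))
    (Y' := C(unitInterval, Mink →L[ℝ] R)) (Z' := C(unitInterval, R)) volterra (pointwise actL)
    (pointwise actR) (pointwise (evalB Mink (Mink →L[ℝ] R))) (h := h) (f := V) (g := W) (k := F) u
  exact leibniz hh hV hF hW σ v

end SandwichInt

section CurvInt

variable {R : Type*} [NormedRing R] [NormedAlgebra ℝ R] [StarRing R] [NormedStarGroup R]
  [StarModule ℝ R] {p : ℝ≥0∞} [Fact (1 ≤ p)] {A : C(Mink, Mink →L[ℝ] R)} (hA : ContDiff ℝ ∞ A)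

/-- The curvature as a continuous map. -/
def curvC : C(Mink, Mink →L[ℝ] Mink →L[ℝ] R) := ⟨curvForm A, (contDiff_curvForm hA).continuous⟩

variable (R) in
/-- The pointwise involution on continuous functions. -/
def starC : C(unitInterval, R) →L[ℝ] C(unitInterval, R) :=
  (starL' ℝ : R ≃L[ℝ] R).toContinuousLinearMap.compLeftContinuous ℝ unitInterval

/-- The function `t ↦ ∫₀ᵗ U_{0,s} F(u(s), σ̇(s)) U_{s,0} ds`, in terms of which the derivative of
the parallel transport is expressed. -/
def curvInt (σ u : Curve p) : C(unitInterval, R) :=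
  sandwichInt (Curve.velL1 σ) (starC R (transportC A σ)) ((curvC hA).comp (Curve.posL σ))
    (Curve.posL u) (transportC A σ)

theorem extendI_curvInt_zero (σ u : Curve p) : extendI (curvInt hA σ u) 0 = 0 :=
  extendI_sandwichInt_zero _ _ _ _ _

variable [CompleteSpace R]

theorem hasWeakDeriv_curvInt (σ u : Curve p) :
    HasWeakDeriv (extendI (curvInt hA σ u))
      (fun t => conjL A σ t (curvForm A (σ.val t) (u.val t) (σ.vel t))) := by
  refine (hasWeakDeriv_sandwichInt _ _ _ _ _).congr_deriv ?_
  filter_upwards [σ.coeFn_velL1] with s hs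
  rw [hs, ← Curve.extendI_posL, ← Curve.extendI_posL]
  rfl

theorem contDiff_curvInt (u : Curve p) : ContDiff ℝ ∞ fun σ : Curve p => curvInt hA σ u :=
  contDiff_sandwichInt _ Curve.velL1.contDiff ((starC R).contDiff.comp (contDiff_transportC hA))
    (contDiff_comp_posL (f := curvC hA) (contDiff_curvForm hA)) (contDiff_transportC hA)

theorem fderiv_curvInt (σ u v : Curve p) :
    fderiv ℝ (fun σ : Curve p => curvInt hA σ u) σ v =
      sandwichInt (Curve.velL1 v) (starC R (transportC A σ)) ((curvC hA).comp (Curve.posL σ))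
        (Curve.posL u) (transportC A σ) +
      (sandwichInt (Curve.velL1 σ) (starC R (fderiv ℝ (transportC A) σ v))
        ((curvC hA).comp (Curve.posL σ)) (Curve.posL u) (transportC A σ) +
      (sandwichInt (Curve.velL1 σ) (starC R (transportC A σ))
        (pointwise (evalB Mink (Mink →L[ℝ] Mink →L[ℝ] R))
          ((fderivC (f := curvC hA) (contDiff_curvForm hA)).comp (Curve.posL σ)) (Curve.posL v))
        (Curve.posL u) (transportC A σ) +
      sandwichInt (Curve.velL1 σ) (starC R (transportC A σ)) ((curvC hA).comp (Curve.posL σ))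
        (Curve.posL u) (fderiv ℝ (transportC A) σ v))) := by
  have hcurv := contDiff_curvForm hA
  have hcurvσ := contDiff_comp_posL (p := p) (f := curvC hA) hcurv
  have hW := differentiable_transportC (p := p) hA
  have hstar (σ : Curve p) : fderiv ℝ (fun σ => starC R (transportC A σ)) σ v =
      starC R (fderiv ℝ (transportC A) σ v) :=
    congr($(((starC R).hasFDerivAt.comp σ (hW σ).hasFDerivAt).fderiv) v)
  have leibniz := fderiv_sandwichInt (Curve.posL u) (E := Curve p) (h := Curve.velL1)
    (V := fun σ => starC R (transportC A σ)) (W := transportC A)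
    (F := fun σ => (curvC hA).comp (Curve.posL σ)) Curve.velL1.differentiable
    ((starC R).differentiable.comp hW) (hcurvσ.differentiable (by simp)) hW σ v
  rw [hstar, fderiv_comp_posL hcurv, ContinuousLinearMap.fderiv] at leibniz
  exact leibniz

end CurvInt

theorem HasWeakDeriv.extendI_add {V : Type*} [NormedAddCommGroup V] [NormedSpace ℝ V]
    {f g : C(unitInterval, V)} {f' g' : ℝ → V} (hf : HasWeakDeriv (extendI f) f')
    (hg : HasWeakDeriv (extendI g) g') :
    HasWeakDeriv (extendI (f + g : C(unitInterval, V))) fun t => f' t + g' t :=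
  hf.add hg

/-- Evaluation at `t` of the constant continuation of a function on `[0,1]`, as a continuous linear
map. -/
def evalAt (V : Type*) [NormedAddCommGroup V] [NormedSpace ℝ V] (t : ℝ) :
    C(unitInterval, V) →L[ℝ] V :=
  ContinuousMap.evalCLM ℝ (projIcc 0 1 zero_le_one t)

theorem evalAt_apply {V : Type*} [NormedAddCommGroup V] [NormedSpace ℝ V] (t : ℝ)
    (f : C(unitInterval, V)) : evalAt V t f = extendI f t := rfl

section SecondDerivative

variable {R : Type*} [NormedRing R] [NormedAlgebra ℝ R] [CompleteSpace R] [StarRing R]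
  [NormedStarGroup R] [StarModule ℝ R] {p : ℝ≥0∞} [Fact (1 ≤ p)] {A : C(Mink, Mink →L[ℝ] R)}
  (hA : ContDiff ℝ ∞ A)

section

variable (hs : ∀ x v, star (A x v) = -A x v)
include hA hs

omit [CompleteSpace R] in
theorem star_curvForm (x u v : Mink) : star (curvForm A x u v) = -curvForm A x u v := by
  have hfderiv (u v : Mink) : star (fderiv ℝ A x u v) = -fderiv ℝ A x u v := by
    have hAv := (hA.differentiable (by simp) x).hasFDerivAt.clm_apply (hasFDerivAt_const v x)
    have hsum := (hAv.star.add hAv).congr_of_eventuallyEq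
      (f₁ := fun _ => 0) (.of_forall fun y => by simp [hs])
    have h := congr($(hsum.unique (hasFDerivAt_const 0 x)) u)
    exact eq_neg_of_add_eq_zero_left (by simpa using h)
  simp only [curvForm_apply, star_add, star_sub, star_mul, hfderiv, hs]
  noncomm_ring

theorem star_mul_fderiv_transportC (σ u : Curve p) {t : ℝ} (ht : t ∈ Icc (0 : ℝ) 1) :
    star (extendI (transportC A σ) t) * extendI (fderiv ℝ (transportC A) σ u) t =
      -(conjL A σ t (A (σ.val t) (u.val t)) + extendI (curvInt hA σ u) t) := by
  have hW := hasWeakDeriv_transportC A σ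
  have hV := hasWeakDeriv_star_transportC hs σ
  have hsum := ((hV.mul (hasWeakDeriv_fderiv_transportC hA σ u)).add
    ((hV.mul ((hasWeakDeriv_comp_val hA σ u).mul hW)).add
      (hasWeakDeriv_curvInt hA σ u))).congr_deriv (g' := fun _ => 0) (.of_forall fun t => by
        simp only [conjL_apply, curvForm_apply]
        noncomm_ring)
  have h := hsum.eq_of_deriv_zero ht
  rw [extendI_fderiv_transportC_zero hA, extendI_curvInt_zero, u.val_zero, map_zero, zero_mul,
    mul_zero, add_zero, add_zero] at h
  exact eq_neg_of_add_eq_zero_left h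

theorem fderiv_transportC_apply (σ u : Curve p) {t : ℝ} (ht : t ∈ Icc (0 : ℝ) 1) :
    extendI (fderiv ℝ (transportC A) σ u) t =
      -(A (σ.val t) (u.val t) * extendI (transportC A σ) t +
        extendI (transportC A σ) t * extendI (curvInt hA σ u) t) := by
  have h := congr(extendI (transportC A σ) t * $(star_mul_fderiv_transportC hA hs σ u ht))
  simp only [conjL_apply, ← mul_assoc, transportC_mul_star hs σ ht, one_mul, mul_neg, mul_add] at h
  exact h

theorem star_curvInt (σ u : Curve p) {t : ℝ} (ht : t ∈ Icc (0 : ℝ) 1) :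
    star (extendI (curvInt hA σ u) t) = -extendI (curvInt hA σ u) t := by
  have hderiv := hasWeakDeriv_curvInt hA σ u
  have hsum := ((hderiv.clm_comp (starL' ℝ : R ≃L[ℝ] R).toContinuousLinearMap).add
    hderiv).congr_deriv (g' := fun _ => 0) (.of_forall fun t => by
      simp [conjL_apply, star_curvForm hA hs, mul_assoc])
  have h := hsum.eq_of_deriv_zero ht
  simp only [ContinuousLinearEquiv.coe_coe, starL'_apply, extendI_curvInt_zero hA, star_zero,
    add_zero] at h
  exact eq_neg_of_add_eq_zero_left h

theorem star_fderiv_transportC (σ v : Curve p) {t : ℝ} (ht : t ∈ Icc (0 : ℝ) 1) :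
    star (extendI (fderiv ℝ (transportC A) σ v) t) =
      star (extendI (transportC A σ) t) * A (σ.val t) (v.val t) +
        extendI (curvInt hA σ v) t * star (extendI (transportC A σ) t) := by
  rw [fderiv_transportC_apply hA hs σ v ht]
  simp only [star_neg, star_add, star_mul, hs, star_curvInt hA hs σ v ht]
  noncomm_ring

end

theorem hasWeakDeriv_fderiv_curvInt_leibniz (σ u v : Curve p) :
    HasWeakDeriv (extendI (fderiv ℝ (fun σ : Curve p => curvInt hA σ u) σ v)) fun t =>
      star (extendI (transportC A σ) t) *
        (curvForm A (σ.val t) (u.val t) (v.vel t) * extendI (transportC A σ) t) +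
      (star (extendI (fderiv ℝ (transportC A) σ v) t) *
        (curvForm A (σ.val t) (u.val t) (σ.vel t) * extendI (transportC A σ) t) +
      (star (extendI (transportC A σ) t) *
        (fderiv ℝ (curvForm A) (σ.val t) (v.val t) (u.val t) (σ.vel t) *
          extendI (transportC A σ) t) +
      star (extendI (transportC A σ) t) *
        (curvForm A (σ.val t) (u.val t) (σ.vel t) *
          extendI (fderiv ℝ (transportC A) σ v) t))) := by
  have hcurv (t : ℝ) : extendI ((curvC hA).comp (Curve.posL σ)) t = curvForm A (σ.val t) := by
    rw [← Curve.extendI_posL σ]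
    rfl
  have hfderiv (t : ℝ) : extendI (pointwise (evalB Mink (Mink →L[ℝ] Mink →L[ℝ] R))
      ((fderivC (f := curvC hA) (contDiff_curvForm hA)).comp (Curve.posL σ)) (Curve.posL v)) t =
        fderiv ℝ (curvForm A) (σ.val t) (v.val t) := by
    rw [← Curve.extendI_posL σ, ← Curve.extendI_posL v]
    rfl
  have hstar (W : C(unitInterval, R)) (t : ℝ) : extendI (starC R W) t = star (extendI W t) := rfl
  have hsandwich (h V F W) := hasWeakDeriv_sandwichInt (R := R) h V F (Curve.posL u) W
  have hsum := (hsandwich (Curve.velL1 v) (starC R (transportC A σ))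
    ((curvC hA).comp (Curve.posL σ)) (transportC A σ)).extendI_add
      ((hsandwich (Curve.velL1 σ) (starC R (fderiv ℝ (transportC A) σ v))
        ((curvC hA).comp (Curve.posL σ)) (transportC A σ)).extendI_add
      ((hsandwich (Curve.velL1 σ) (starC R (transportC A σ))
        (pointwise (evalB Mink (Mink →L[ℝ] Mink →L[ℝ] R))
          ((fderivC (f := curvC hA) (contDiff_curvForm hA)).comp (Curve.posL σ)) (Curve.posL v))
        (transportC A σ)).extendI_add
      (hsandwich (Curve.velL1 σ) (starC R (transportC A σ))
        ((curvC hA).comp (Curve.posL σ)) (fderiv ℝ (transportC A) σ v))))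
  rw [fderiv_curvInt]
  refine hsum.congr_deriv ?_
  filter_upwards [σ.coeFn_velL1, v.coeFn_velL1] with t hσ hv
  simp only [hσ, hv, hcurv, hfderiv, Curve.extendI_posL u, hstar]

theorem hasWeakDeriv_fderiv_curvInt (hs : ∀ x v, star (A x v) = -A x v) (σ u v : Curve p) :
    HasWeakDeriv (extendI (fderiv ℝ (fun σ : Curve p => curvInt hA σ u) σ v)) fun t =>
      conjL A σ t (curvForm A (σ.val t) (u.val t) (v.vel t)) +
      conjL A σ t (covCurv A (σ.val t) (v.val t) (u.val t) (σ.vel t)) +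
      (extendI (curvInt hA σ v) t * conjL A σ t (curvForm A (σ.val t) (u.val t) (σ.vel t)) -
        conjL A σ t (curvForm A (σ.val t) (u.val t) (σ.vel t)) * extendI (curvInt hA σ v) t) := by
  refine (hasWeakDeriv_fderiv_curvInt_leibniz hA σ u v).congr_deriv ?_
  filter_upwards [ae_leb_mem_Ioo] with t ht
  have ht' : t ∈ Icc (0 : ℝ) 1 := ⟨ht.1.le, ht.2.le⟩
  rw [star_fderiv_transportC hA hs σ v ht', fderiv_transportC_apply hA hs σ v ht']
  simp only [conjL_apply, covCurv_apply]
  noncomm_ring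

theorem extendI_fderiv_curvInt_zero (σ u v : Curve p) :
    extendI (fderiv ℝ (fun σ : Curve p => curvInt hA σ u) σ v) 0 = 0 := by
  have hadd (f g : C(unitInterval, R)) :
      extendI (f + g : C(unitInterval, R)) 0 = extendI f 0 + extendI g 0 := rfl
  simp only [fderiv_curvInt, hadd, extendI_sandwichInt_zero, add_zero]

variable (hs : ∀ x v, star (A x v) = -A x v)
include hs

theorem fderiv_transportC_one (σ u : Curve p) (hu : u.val 1 = 0) :
    fderiv ℝ (fun σ : Curve p => extendI (transportC A σ) 1) σ u =
      -(extendI (transportC A σ) 1 * extendI (curvInt hA σ u) 1) := by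
  have hcomp : fderiv ℝ (fun σ : Curve p => extendI (transportC A σ) 1) σ u =
      extendI (fderiv ℝ (transportC A) σ u) 1 :=
    congr($(((evalAt R 1).hasFDerivAt.comp σ (differentiable_transportC hA σ).hasFDerivAt).fderiv)
      u)
  rw [hcomp, fderiv_transportC_apply hA hs σ u ⟨zero_le_one, le_rfl⟩, hu, map_zero, zero_mul,
    zero_add]

theorem fderiv_fderiv_transportC_one (σ u v : Curve p) (hu : u.val 1 = 0) (hv : v.val 1 = 0) :
    fderiv ℝ (fderiv ℝ fun σ : Curve p => extendI (transportC A σ) 1) σ v u =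
      extendI (transportC A σ) 1 *
        (extendI (curvInt hA σ v) 1 * extendI (curvInt hA σ u) 1 -
          extendI (fderiv ℝ (fun σ : Curve p => curvInt hA σ u) σ v) 1) := by
  have hf : ContDiff ℝ ∞ fun σ : Curve p => extendI (transportC A σ) 1 :=
    (evalAt R 1).contDiff.comp (contDiff_transportC hA)
  have hf' : Differentiable ℝ (fderiv ℝ fun σ : Curve p => extendI (transportC A σ) 1) :=
    (hf.fderiv_right (m := ∞) (by simp)).differentiable (by simp)
  have hG : HasFDerivAt (fun σ : Curve p => extendI (curvInt hA σ u) 1)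
      ((evalAt R 1).comp (fderiv ℝ (fun σ : Curve p => curvInt hA σ u) σ)) σ :=
    (evalAt R 1).hasFDerivAt.comp σ ((contDiff_curvInt hA u).differentiable (by simp) σ).hasFDerivAt
  have hprod := ((hf.differentiable (by simp) σ).hasFDerivAt.mul' hG).neg
  have heval := (hf' σ).hasFDerivAt.clm_apply (hasFDerivAt_const u σ)
  have h := congr($(heval.unique (hprod.congr_of_eventuallyEq
    (.of_forall fun τ => fderiv_transportC_one hA hs τ u hu))) v)
  have hU := fderiv_transportC_one hA hs σ v hv
  simp only [_root_.add_apply, _root_.neg_apply, ContinuousLinearMap.comp_apply,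
    ContinuousLinearMap.flip_apply, _root_.smul_apply, _root_.zero_apply, map_zero, zero_add, hU,
    evalAt_apply, smul_eq_mul, MulOpposite.smul_eq_mul_unop, MulOpposite.unop_op] at h
  rw [h]
  noncomm_ring

theorem fderiv_fderiv_transportC (σ u v : Curve p) (hu : u.val 1 = 0) (hv : v.val 1 = 0) :
    fderiv ℝ (fderiv ℝ fun σ : Curve p => extendI (transportC A σ) 1) σ v u =
      extendI (transportC A σ) 1 *
        ∫ t, conjL A σ t (curvForm A (σ.val t) (v.val t) (σ.vel t)) *
            extendI (curvInt hA σ u) t +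
          conjL A σ t (curvForm A (σ.val t) (u.val t) (σ.vel t)) * extendI (curvInt hA σ v) t -
          conjL A σ t (curvForm A (σ.val t) (u.val t) (v.vel t)) -
          conjL A σ t (covCurv A (σ.val t) (v.val t) (u.val t) (σ.vel t)) ∂leb := by
  have hderiv := (((hasWeakDeriv_curvInt hA σ v).mul (hasWeakDeriv_curvInt hA σ u)).sub
    (hasWeakDeriv_fderiv_curvInt hA hs σ u v)).eq_add_integral ⟨zero_le_one, le_rfl⟩
  rw [extendI_fderiv_curvInt_zero, extendI_curvInt_zero, zero_mul, sub_zero, zero_add,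
    ← integral_leb_eq_intervalIntegral] at hderiv
  rw [fderiv_fderiv_transportC_one hA hs σ u v hu hv, hderiv]
  congr 2
  funext t
  abel

end SecondDerivative

section Shrink

variable {p : ℝ≥0∞} (r : unitInterval) (σ : Curve p)

theorem coe_mul_mem_Icc (r : unitInterval) {t : ℝ} (ht : t ∈ Icc (0 : ℝ) 1) :
    (r : ℝ) * t ∈ Icc (0 : ℝ) 1 :=
  ⟨mul_nonneg r.2.1 ht.1, mul_le_one₀ r.2.2 ht.1 ht.2⟩

theorem extendI_comp_mul {X : Type*} (f : unitInterval → X) {t : ℝ} (ht : t ∈ Icc (0 : ℝ) 1) :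
    extendI (fun s => f (r * s)) t = extendI f (r * t) := by
  rw [extendI, extendI, IccExtend_of_mem _ _ ht, IccExtend_of_mem _ _ (coe_mul_mem_Icc r ht)]
  rfl

theorem Curve.shrink_val {t : ℝ} (ht : t ∈ Icc (0 : ℝ) 1) :
    (Curve.shrink r σ).val t = σ.val (r * t) :=
  extendI_comp_mul r σ.1 ht

theorem Curve.shrink_vel {t : ℝ} (ht : t ∈ Ioo (0 : ℝ) 1) :
    (Curve.shrink r σ).vel t = (r : ℝ) • σ.vel (r * t) := by
  have hval : (Curve.shrink r σ).val =ᶠ[𝓝 t] fun t => σ.val (r * t) := by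
    filter_upwards [Ioo_mem_nhds ht.1 ht.2] with s hs
    exact Curve.shrink_val r σ ⟨hs.1.le, hs.2.le⟩
  rw [Curve.vel, hval.deriv_eq]
  exact deriv_comp_mul_left (r : ℝ) σ.val t

variable {R : Type*} [NormedRing R] [NormedAlgebra ℝ R] [Fact (1 ≤ p)]
  (A : C(Mink, Mink →L[ℝ] R))

theorem connOp_shrink (w : C(unitInterval, R)) (t : unitInterval) :
    connOp actR A (Curve.shrink r σ) (w.comp ⟨fun t => r * t, by fun_prop⟩) t =
      connOp actR A σ w (r * t) := by
  have hsubst := intervalIntegral.smul_integral_comp_mul_left (a := 0) (b := t)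
    (fun s => actR (A (σ.val s)) (extendI w s) (σ.vel s)) (r : ℝ)
  rw [mul_zero] at hsubst
  rw [connOp_apply, connOp_apply, Set.Icc.coe_mul, ← hsubst,
    ← intervalIntegral.integral_smul]
  refine intervalIntegral_congr_ae_leb t ?_
  filter_upwards [ae_leb_mem_Ioo] with s hs
  have hs' : s ∈ Icc (0 : ℝ) 1 := ⟨hs.1.le, hs.2.le⟩
  rw [Curve.shrink_val r σ hs', Curve.shrink_vel r σ hs, map_smul]
  exact congrArg (fun x => (r : ℝ) • actR (A (σ.val (r * s))) x (σ.vel (r * s)))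
    (extendI_comp_mul r w hs')

variable [CompleteSpace R]

theorem transportC_shrink :
    transportC A (Curve.shrink r σ) = (transportC A σ).comp ⟨fun t => r * t, by fun_prop⟩ := by
  refine eq_of_add_connOp_eq actR A (σ := Curve.shrink r σ) ?_
  rw [transportC_add_connOp]
  ext1 t
  rw [ContinuousMap.add_apply, connOp_shrink]
  exact (congrArg (fun w : C(unitInterval, R) => w (r * t)) (transportC_add_connOp A σ)).symm

theorem extendI_transportC_shrink_one :
    extendI (transportC A (Curve.shrink r σ)) 1 = extendI (transportC A σ) r := by
  rw [transportC_shrink, extendI_coe]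
  refine (extendI_coe _ (1 : unitInterval)).trans ?_
  exact congrArg (transportC A σ) (mul_one r)

end Shrink

section Fubini

variable {R : Type*} [NormedRing R] [NormedAlgebra ℝ R] {g h : ℝ → R}

omit [NormedAlgebra ℝ R] in
theorem integrable_triangle (hg : Integrable g leb) (hh : Integrable h leb) :
    Integrable ({x : ℝ × ℝ | x.2 < x.1}.indicator fun x => g x.1 * h x.2) (leb.prod leb) :=
  (hg.mul_prod hh).indicator (measurableSet_lt measurable_snd measurable_fst)

theorem integral_triangle [CompleteSpace R] (hg : Integrable g leb) (hh : Integrable h leb) :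
    ∫ x, {x : ℝ × ℝ | x.2 < x.1}.indicator (fun x => g x.1 * h x.2) x ∂(leb.prod leb) =
      ∫ t, g t * (∫ s in (0 : ℝ)..t, h s) ∂leb := by
  rw [integral_prod _ (integrable_triangle hg hh)]
  refine integral_congr_ae ?_
  filter_upwards [ae_restrict_mem measurableSet_Icc] with t ht
  have hslice : (fun s => {x : ℝ × ℝ | x.2 < x.1}.indicator (fun x => g x.1 * h x.2) (t, s)) =
      fun s => g t * (Iio t).indicator h s := by
    funext s
    by_cases hs : s < t <;> simp [indicator, hs]
  have hIco : Iio t ∩ Icc (0 : ℝ) 1 = Ico 0 t := by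
    ext s
    exact ⟨fun h => ⟨h.2.1, h.1⟩, fun h => ⟨h.2, h.1, h.2.le.trans ht.2⟩⟩
  rw [hslice, integral_const_mul_of_integrable (hh.indicator measurableSet_Iio),
    integral_indicator measurableSet_Iio, Measure.restrict_restrict measurableSet_Iio, hIco,
    intervalIntegral.integral_of_le ht.1, ← integral_Ico_eq_integral_Ioc]

omit [NormedAlgebra ℝ R] in
theorem integrable_triangle_swap (hg : Integrable g leb) (hh : Integrable h leb) :
    Integrable ({x : ℝ × ℝ | x.1 < x.2}.indicator fun x => g x.2 * h x.1) (leb.prod leb) :=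
  (integrable_triangle hg hh).swap

theorem integral_triangle_swap [CompleteSpace R] (hg : Integrable g leb)
    (hh : Integrable h leb) :
    ∫ x, {x : ℝ × ℝ | x.1 < x.2}.indicator (fun x => g x.2 * h x.1) x ∂(leb.prod leb) =
      ∫ t, g t * (∫ s in (0 : ℝ)..t, h s) ∂leb := by
  rw [← integral_triangle hg hh, ← integral_prod_swap]
  rfl

end Fubini

section Components

theorem eq_sum_smul_basisVec (u : Mink) : u = ∑ μ, u μ • basisVec μ := by
  ext ν
  simp [basisVec, Finset.sum_apply, Pi.single_apply]

theorem map_eq_sum_basisVec {Y : Type*} [NormedAddCommGroup Y] [NormedSpace ℝ Y]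
    (L : Mink →L[ℝ] Y) (u : Mink) : L u = ∑ μ, u μ • L (basisVec μ) := by
  conv_lhs => rw [eq_sum_smul_basisVec u]
  simp

variable {R : Type*} [NormedRing R] [NormedAlgebra ℝ R] (A : Mink → Mink →L[ℝ] R)

theorem curvForm_antisymm (x u v : Mink) : curvForm A x u v = -curvForm A x v u := by
  simp only [curvForm_apply]
  abel

theorem curvForm_eq_sum_left (x u v : Mink) :
    curvForm A x u v = ∑ μ, u μ • curvForm A x (basisVec μ) v := by
  conv_lhs => rw [map_eq_sum_basisVec (curvForm A x) u]
  simp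

theorem curvForm_eq_sum_right (x u v : Mink) :
    curvForm A x u v = ∑ μ, v μ • curvForm A x u (basisVec μ) :=
  map_eq_sum_basisVec (curvForm A x u) v

theorem covCurv_eq_sum_left (x w u v : Mink) :
    covCurv A x w u v = ∑ μ, w μ • covCurv A x (basisVec μ) u v := by
  simp only [covCurv_apply]
  conv_lhs => rw [map_eq_sum_basisVec (fderiv ℝ (curvForm A) x) w, map_eq_sum_basisVec (A x) w]
  simp [smul_add, smul_sub, Finset.sum_add_distrib, Finset.sum_sub_distrib, Finset.sum_mul,
    Finset.mul_sum]

theorem covCurv_eq_sum_middle (x w u v : Mink) :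
    covCurv A x w u v = ∑ μ, u μ • covCurv A x w (basisVec μ) v := by
  simp only [covCurv_apply]
  conv_lhs => rw [map_eq_sum_basisVec (fderiv ℝ (curvForm A) x w) u, curvForm_eq_sum_left]
  simp [smul_add, smul_sub, Finset.sum_add_distrib, Finset.sum_sub_distrib, Finset.sum_mul,
    Finset.mul_sum]

end Components

section OrderedProduct

variable {R : Type*} [NormedRing R] [NormedAlgebra ℝ R]

/-- The product of `W` with `f s` and `g t` placed in decreasing order of the parameters: it is the
kernel of the path-ordered double integral of `f` and `g`. -/
def orderedProd (W : R) (f g : ℝ → R) (x : ℝ × ℝ) : R :=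
  {x : ℝ × ℝ | x.2 < x.1}.indicator (fun x => W * f x.1 * g x.2) x +
    {x : ℝ × ℝ | x.1 < x.2}.indicator (fun x => W * g x.2 * f x.1) x

omit [NormedAlgebra ℝ R] in
theorem integrable_orderedProd (W : R) {f g : ℝ → R} (hf : Integrable f leb)
    (hg : Integrable g leb) : Integrable (orderedProd W f g) (leb.prod leb) :=
  (integrable_triangle (hf.const_mul W) hg).add (integrable_triangle_swap (hg.const_mul W) hf)

theorem integral_orderedProd [CompleteSpace R] (W : R) {f g F G : ℝ → R}
    (hf : Integrable f leb) (hg : Integrable g leb)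
    (hF : ∀ t ∈ Icc (0 : ℝ) 1, ∫ s in (0 : ℝ)..t, f s = F t)
    (hG : ∀ t ∈ Icc (0 : ℝ) 1, ∫ s in (0 : ℝ)..t, g s = G t) :
    ∫ x, orderedProd W f g x ∂(leb.prod leb) =
      (∫ t, W * (f t * G t) ∂leb) + ∫ t, W * (g t * F t) ∂leb := by
  simp only [orderedProd]
  rw [integral_add (integrable_triangle (hf.const_mul W) hg)
    (integrable_triangle_swap (hg.const_mul W) hf), integral_triangle (hf.const_mul W) hg,
    integral_triangle_swap (hg.const_mul W) hf]
  congr 1 <;> refine integral_congr_ae ?_ <;>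
    filter_upwards [ae_restrict_mem measurableSet_Icc] with t ht
  · rw [hG t ht, mul_assoc]
  · rw [hF t ht, mul_assoc]

theorem sum_sum_smul_mul_mul (a b : Mink) (c : R) (x y : Fin 4 → R) :
    ∑ μ, ∑ ν, (a μ * b ν) • (c * x μ * y ν) = c * (∑ μ, a μ • x μ) * ∑ ν, b ν • y ν := by
  simp only [Finset.mul_sum, Finset.sum_mul, mul_smul_comm, smul_mul_assoc, mul_smul,
    Finset.smul_sum]
  rw [Finset.sum_comm]
  exact Finset.sum_congr rfl fun μ _ => Finset.sum_congr rfl fun ν _ => smul_comm _ _ _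

theorem sum_sum_smul_orderedProd (W : R) (k : Fin 4 → ℝ → R) (a b : ℝ → Mink) (x : ℝ × ℝ) :
    ∑ μ, ∑ ν, (a x.1 μ * b x.2 ν) • orderedProd W (k μ) (k ν) x =
      orderedProd W (fun t => ∑ μ, a t μ • k μ t) (fun t => ∑ ν, b t ν • k ν t) x := by
  rcases lt_trichotomy x.1 x.2 with h | h | h
  · simp only [orderedProd, indicator, mem_ofPred_eq, h, h.not_gt, if_true, if_false, zero_add]
    rw [← sum_sum_smul_mul_mul, Finset.sum_comm]
    simp only [mul_comm]
  · simp [orderedProd, indicator, h]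
  · simp only [orderedProd, indicator, mem_ofPred_eq, h, h.not_gt, if_true, if_false, add_zero]
    exact sum_sum_smul_mul_mul _ _ _ _ _

end OrderedProduct

section Components

variable {R : Type*} [NormedRing R] [NormedAlgebra ℝ R] (A : Mink → Mink →L[ℝ] R)

theorem sum_sum_smul_curvForm (x u v : Mink) :
    ∑ μ, ∑ ν, (u μ * v ν) • curvForm A x (basisVec μ) (basisVec ν) = curvForm A x u v := by
  rw [curvForm_eq_sum_left A x u v]
  refine Finset.sum_congr rfl fun μ _ => ?_
  rw [curvForm_eq_sum_right A x _ v, Finset.smul_sum]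
  simp only [mul_smul]

theorem sum_sum_smul_covCurv (x w u v : Mink) :
    ∑ μ, ∑ ν, (w μ * u ν) • covCurv A x (basisVec μ) (basisVec ν) v = covCurv A x w u v := by
  rw [covCurv_eq_sum_left A x w u v]
  refine Finset.sum_congr rfl fun μ _ => ?_
  rw [covCurv_eq_sum_middle A x _ u v, Finset.smul_sum]
  simp only [mul_smul]

theorem eta_comm (μ ν : Fin 4) : eta μ ν = eta ν μ := by
  by_cases h : μ = ν
  · rw [h]
  · simp [eta, h, Ne.symm h]

theorem half_smul_sum_eta_smul_add_swap {V : Type*} [AddCommGroup V] [Module ℝ V]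
    (c : Fin 4 → Fin 4 → V) :
    (1 / 2 : ℝ) • ∑ μ, ∑ ν, eta μ ν • (c μ ν + c ν μ) = ∑ μ, ∑ ν, eta μ ν • c μ ν := by
  have hswap : ∑ μ, ∑ ν, eta μ ν • c ν μ = ∑ μ, ∑ ν, eta μ ν • c μ ν := by
    rw [Finset.sum_comm]
    simp only [eta_comm]
  simp only [smul_add, Finset.sum_add_distrib, hswap]
  rw [← smul_add, ← two_smul ℝ, smul_smul]
  norm_num

end Components

section LevyTrace

variable {R : Type*} [NormedRing R] [NormedAlgebra ℝ R] [StarRing R] [NormedStarGroup R]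
  {p : ℝ≥0∞} [Fact (1 ≤ p)] {A : C(Mink, Mink →L[ℝ] R)}

theorem continuous_conjL (σ : Curve p) : Continuous (conjL A σ) := by
  have hU := continuous_extendI (transportC A σ).continuous
  exact ((ContinuousLinearMap.mul ℝ R).continuous.comp hU.star).clm_comp
    ((ContinuousLinearMap.mul ℝ R).flip.continuous.comp hU)

variable (hA : ContDiff ℝ ∞ A) {a b c : ℝ → Mink}
include hA

theorem continuousOn_conjL_comp_curvForm (σ : Curve p) (ha : ContinuousOn a (Icc 0 1)) :
    ContinuousOn (fun t => (conjL A σ t).comp (curvForm A (σ.val t) (a t))) (Icc 0 1) :=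
  (continuous_conjL σ).continuousOn.clm_comp
    (((contDiff_curvForm hA).continuous.comp_continuousOn σ.hasWeakDeriv.continuousOn).clm_apply ha)

theorem integrable_conjL_curvForm (σ : Curve p) (ha : ContinuousOn a (Icc 0 1))
    (hb : Integrable b leb) :
    Integrable (fun t => conjL A σ t (curvForm A (σ.val t) (a t) (b t))) leb :=
  integrable_clm_apply_of_continuousOn
    (φ := fun t => (conjL A σ t).comp (curvForm A (σ.val t) (a t)))
    (continuousOn_conjL_comp_curvForm hA σ ha) hb

theorem integrable_conjL_covCurv (σ : Curve p) (ha : ContinuousOn a (Icc 0 1))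
    (hb : ContinuousOn b (Icc 0 1)) (hc : Integrable c leb) :
    Integrable (fun t => conjL A σ t (covCurv A (σ.val t) (a t) (b t) (c t))) leb := by
  have hσ := σ.hasWeakDeriv.continuousOn
  have hF := ((contDiff_curvForm hA).continuous.comp_continuousOn hσ).clm_apply hb
  have hAa := (A.continuous.comp_continuousOn hσ).clm_apply ha
  have hdF := ((((contDiff_curvForm hA).continuous_fderiv (by simp)).comp_continuousOn
    hσ).clm_apply ha).clm_apply hb
  refine integrable_clm_apply_of_continuousOn (φ := fun t => (conjL A σ t).comp
    (covCurv A (σ.val t) (a t) (b t))) ((continuous_conjL σ).continuousOn.clm_comp ?_) hc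
  exact hdF.add ((((actL (R := R)).continuous.comp_continuousOn hAa).clm_apply hF).sub
    (((actR (R := R)).continuous.comp_continuousOn hF).clm_apply hAa))

theorem memLp_top_conjL_curvForm (W : R) (σ : Curve p) (x y : Mink) :
    MemLp (fun t => W * conjL A σ t (curvForm A (σ.val t) x y)) ∞ leb := by
  have hcont : ContinuousOn (fun t => W * conjL A σ t (curvForm A (σ.val t) x y)) (Icc 0 1) :=
    continuousOn_const.mul ((continuousOn_conjL_comp_curvForm hA σ
      (a := fun _ => x) continuousOn_const).clm_apply continuousOn_const)
  obtain ⟨C, hC⟩ := isCompact_Icc.exists_bound_of_continuousOn hcont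
  refine memLp_top_of_bound (hcont.aestronglyMeasurable measurableSet_Icc) C ?_
  filter_upwards [ae_restrict_mem measurableSet_Icc] with t ht using hC t ht

theorem integral_sum_conjL_covCurv (W : R) (σ u v : Curve p) :
    ∫ t, ∑ μ, ∑ ν, (u.val t μ * v.val t ν) • (-(1 / 2 : ℝ)) • (W *
        (conjL A σ t (covCurv A (σ.val t) (basisVec μ) (basisVec ν) (σ.vel t)) +
          conjL A σ t (covCurv A (σ.val t) (basisVec ν) (basisVec μ) (σ.vel t)))) ∂leb =
      (-(1 / 2 : ℝ)) • (W *
        ∫ t, conjL A σ t (covCurv A (σ.val t) (u.val t) (v.val t) (σ.vel t)) +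
          conjL A σ t (covCurv A (σ.val t) (v.val t) (u.val t) (σ.vel t)) ∂leb) := by
  have hint (u v : Curve p) := integrable_conjL_covCurv hA σ u.hasWeakDeriv.continuousOn
    v.hasWeakDeriv.continuousOn σ.hasWeakDeriv.integrable
  rw [← integral_const_mul_of_integrable ((hint u v).fun_add (hint v u)), ← integral_smul]
  refine integral_congr_ae (.of_forall fun t => ?_)
  beta_reduce
  rw [← sum_sum_smul_covCurv _ _ (u.val t), ← sum_sum_smul_covCurv _ _ (v.val t),
    Finset.sum_comm (f := fun μ ν => (v.val t μ * u.val t ν) • covCurv A (σ.val t)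
      (basisVec μ) (basisVec ν) (σ.vel t))]
  simp only [map_sum, map_smul, ← Finset.sum_add_distrib, Finset.mul_sum, Finset.smul_sum]
  refine Finset.sum_congr rfl fun μ _ => Finset.sum_congr rfl fun ν _ => ?_
  rw [smul_comm, mul_comm (v.val t ν), ← smul_add, mul_smul_comm]

theorem integral_sum_conjL_curvForm (W : R) (σ u v : Curve p) :
    ∫ t, ∑ μ, ∑ ν, (u.vel t μ * v.val t ν + v.vel t μ * u.val t ν) •
        (W * conjL A σ t (curvForm A (σ.val t) (basisVec μ) (basisVec ν))) ∂leb =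
      -(W * ∫ t, conjL A σ t (curvForm A (σ.val t) (v.val t) (u.vel t)) +
        conjL A σ t (curvForm A (σ.val t) (u.val t) (v.vel t)) ∂leb) := by
  have hint (u v : Curve p) := integrable_conjL_curvForm hA σ v.hasWeakDeriv.continuousOn
    u.hasWeakDeriv.integrable
  rw [← integral_const_mul_of_integrable ((hint u v).fun_add (hint v u)), ← integral_neg]
  refine integral_congr_ae (.of_forall fun t => ?_)
  beta_reduce
  rw [curvForm_antisymm _ _ (v.val t), curvForm_antisymm _ _ (u.val t), map_neg, map_neg,
    ← neg_add, mul_neg, neg_neg, ← sum_sum_smul_curvForm _ _ (u.vel t),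
    ← sum_sum_smul_curvForm _ _ (v.vel t)]
  simp only [map_sum, map_smul, ← Finset.sum_add_distrib, Finset.mul_sum, add_smul, mul_add,
    mul_smul_comm]

theorem integral_sum_eta_conjL_covCurv (W : R) (σ : Curve p) :
    ∫ t, ∑ μ, ∑ ν, eta μ ν • (-(1 / 2 : ℝ)) • (W *
        (conjL A σ t (covCurv A (σ.val t) (basisVec μ) (basisVec ν) (σ.vel t)) +
          conjL A σ t (covCurv A (σ.val t) (basisVec ν) (basisVec μ) (σ.vel t)))) ∂leb =
      -(W * ∫ t, conjL A σ t (∑ μ, ∑ ν, eta μ ν •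
        covCurv A (σ.val t) (basisVec μ) (basisVec ν) (σ.vel t)) ∂leb) := by
  have hint : Integrable (fun t => conjL A σ t (∑ μ, ∑ ν, eta μ ν •
      covCurv A (σ.val t) (basisVec μ) (basisVec ν) (σ.vel t))) leb := by
    simp only [map_sum, map_smul]
    exact integrable_finsetSum _ fun μ _ => integrable_finsetSum _ fun ν _ =>
      (integrable_conjL_covCurv hA σ continuousOn_const continuousOn_const
        σ.hasWeakDeriv.integrable).smul (eta μ ν)
  rw [← integral_const_mul_of_integrable hint, ← integral_neg]
  refine integral_congr_ae (.of_forall fun t => ?_)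
  simp only [map_sum, map_smul]
  rw [← half_smul_sum_eta_smul_add_swap fun μ ν =>
    conjL A σ t (covCurv A (σ.val t) (basisVec μ) (basisVec ν) (σ.vel t)),
    mul_smul_comm, ← neg_smul]
  simp only [Finset.mul_sum, Finset.smul_sum, mul_smul_comm]
  exact Finset.sum_congr rfl fun μ _ => Finset.sum_congr rfl fun ν _ => smul_comm _ _ _

variable [StarModule ℝ R]

theorem integrable_conjL_curvForm_mul_curvInt (σ u v : Curve p) :
    Integrable (fun t => conjL A σ t (curvForm A (σ.val t) (u.val t) (σ.vel t)) *
      extendI (curvInt hA σ v) t) leb :=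
  integrable_clm_apply_of_continuousOn
    (φ := fun t => (ContinuousLinearMap.mul ℝ R).flip (extendI (curvInt hA σ v) t))
    ((ContinuousLinearMap.continuous _).comp
      (continuous_extendI (curvInt hA σ v).continuous)).continuousOn
    (integrable_conjL_curvForm hA σ u.hasWeakDeriv.continuousOn σ.hasWeakDeriv.integrable)

variable [CompleteSpace R]

theorem integral_sum_orderedProd_conjL_curvForm (W : R) (σ u v : Curve p) :
    ∫ x, ∑ μ, ∑ ν, (u.val x.1 μ * v.val x.2 ν) • orderedProd W
        (fun t => conjL A σ t (curvForm A (σ.val t) (basisVec μ) (σ.vel t)))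
        (fun t => conjL A σ t (curvForm A (σ.val t) (basisVec ν) (σ.vel t))) x ∂(leb.prod leb) =
      W * ∫ t, conjL A σ t (curvForm A (σ.val t) (u.val t) (σ.vel t)) *
          extendI (curvInt hA σ v) t +
        conjL A σ t (curvForm A (σ.val t) (v.val t) (σ.vel t)) *
          extendI (curvInt hA σ u) t ∂leb := by
  have hcomp (u : Curve p) : (fun t => ∑ μ, u.val t μ •
      conjL A σ t (curvForm A (σ.val t) (basisVec μ) (σ.vel t))) =
      fun t => conjL A σ t (curvForm A (σ.val t) (u.val t) (σ.vel t)) := by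
    funext t
    rw [curvForm_eq_sum_left]
    simp only [map_sum, map_smul]
  have hint (u : Curve p) := integrable_conjL_curvForm hA σ u.hasWeakDeriv.continuousOn
    σ.hasWeakDeriv.integrable
  have hprim (u : Curve p) (t : ℝ) (ht : t ∈ Icc (0 : ℝ) 1) : ∫ s in (0 : ℝ)..t,
      conjL A σ s (curvForm A (σ.val s) (u.val s) (σ.vel s)) = extendI (curvInt hA σ u) t := by
    rw [(hasWeakDeriv_curvInt hA σ u).eq_add_integral ht, extendI_curvInt_zero, zero_add]
  have hmul (u v : Curve p) := integrable_conjL_curvForm_mul_curvInt hA σ u v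
  have hexpand (x : ℝ × ℝ) := sum_sum_smul_orderedProd W
    (fun μ t => conjL A σ t (curvForm A (σ.val t) (basisVec μ) (σ.vel t))) u.val v.val x
  simp only [hexpand, hcomp]
  rw [integral_orderedProd W (hint u) (hint v) (hprim u) (hprim v),
    integral_const_mul_of_integrable (hmul u v), integral_const_mul_of_integrable (hmul v u),
    ← mul_add, integral_add (hmul u v) (hmul v u)]

variable (hs : ∀ x v, star (A x v) = -A x v)
include hs

theorem fderiv_fderiv_transportC_eq_integrals (σ u v : Curve p) (hu : u.val 1 = 0)
    (hv : v.val 1 = 0) :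
    fderiv ℝ (fderiv ℝ fun σ : Curve p => extendI (transportC A σ) 1) σ u v =
      extendI (transportC A σ) 1 *
        ((∫ t, conjL A σ t (curvForm A (σ.val t) (u.val t) (σ.vel t)) *
              extendI (curvInt hA σ v) t +
            conjL A σ t (curvForm A (σ.val t) (v.val t) (σ.vel t)) *
              extendI (curvInt hA σ u) t ∂leb) -
          (∫ t, conjL A σ t (curvForm A (σ.val t) (v.val t) (u.vel t)) ∂leb) -
          ∫ t, conjL A σ t (covCurv A (σ.val t) (u.val t) (v.val t) (σ.vel t)) ∂leb) := by
  have hI := (integrable_conjL_curvForm_mul_curvInt hA σ u v).fun_add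
    (integrable_conjL_curvForm_mul_curvInt hA σ v u)
  have hJ := integrable_conjL_curvForm hA σ v.hasWeakDeriv.continuousOn u.hasWeakDeriv.integrable
  have hK := integrable_conjL_covCurv hA σ u.hasWeakDeriv.continuousOn
    v.hasWeakDeriv.continuousOn σ.hasWeakDeriv.integrable
  rw [fderiv_fderiv_transportC hA hs σ v u hv hu, ← integral_sub hI hJ,
    ← integral_sub (hI.sub' hJ) hK]

omit hs [StarRing R] [NormedStarGroup R] [StarModule ℝ R] in
theorem fderiv_fderiv_transportC_comm (σ u v : Curve p) :
    fderiv ℝ (fderiv ℝ fun σ : Curve p => extendI (transportC A σ) 1) σ u v =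
      fderiv ℝ (fderiv ℝ fun σ : Curve p => extendI (transportC A σ) 1) σ v u := by
  have hsmooth : ContDiff ℝ ∞ fun σ : Curve p => extendI (transportC A σ) 1 :=
    (evalAt R 1).contDiff.comp (contDiff_transportC hA)
  exact (hsmooth.contDiffAt (x := σ)).isSymmSndFDerivAt
    (by rw [minSmoothness_of_isRCLikeNormedField]; exact WithTop.coe_le_coe.2 le_top) u v

/-- The second derivative is symmetric, so the formula for it may be averaged over `(u, v)` and
`(v, u)`; this produces the symmetric Lévy part. -/
theorem hasLevyTrace_transportC (σ : Curve p) :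
    HasLevyTrace (fderiv ℝ (fderiv ℝ fun σ : Curve p => extendI (transportC A σ) 1) σ)
      (-(extendI (transportC A σ) 1 * ∫ t, conjL A σ t (∑ μ, ∑ ν, eta μ ν •
        covCurv A (σ.val t) (basisVec μ) (basisVec ν) (σ.vel t)) ∂leb)) := by
  set W := extendI (transportC A σ) 1
  have hF (μ : Fin 4) := integrable_conjL_curvForm hA σ (a := fun _ => basisVec μ)
    continuousOn_const σ.hasWeakDeriv.integrable
  have hcov (μ ν : Fin 4) := integrable_conjL_covCurv hA σ (a := fun _ => basisVec μ)
    (b := fun _ => basisVec ν) continuousOn_const continuousOn_const σ.hasWeakDeriv.integrable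
  refine ⟨_, _, _, fun μ ν => integrable_orderedProd W (hF μ) (hF ν),
    fun μ ν => (((hcov μ ν).add (hcov ν μ)).const_mul W).smul (-(1 / 2 : ℝ)),
    fun μ ν => memLp_top_conjL_curvForm hA W σ (basisVec μ) (basisVec ν),
    fun μ ν => .of_forall fun t => ?_, fun μ ν => .of_forall fun t => ?_,
    fun u v hu hv => ?_, (integral_sum_eta_conjL_covCurv hA W σ).symm⟩
  · simp only [Pi.smul_apply, Pi.add_apply, add_comm]
  · simp only [Pi.neg_apply]
    rw [curvForm_antisymm, map_neg, mul_neg]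
  · refine Eq.trans ?_ (congrArg₂ _ (congrArg₂ _
      (integral_sum_orderedProd_conjL_curvForm hA W σ u v).symm
      (integral_sum_conjL_covCurv hA W σ u v).symm)
      (congrArg _ (integral_sum_conjL_curvForm hA W σ u v).symm))
    have hJ (u v : Curve p) := integrable_conjL_curvForm hA σ v.hasWeakDeriv.continuousOn
      u.hasWeakDeriv.integrable
    have hK (u v : Curve p) := integrable_conjL_covCurv hA σ u.hasWeakDeriv.continuousOn
      v.hasWeakDeriv.continuousOn σ.hasWeakDeriv.integrable
    have huv := fderiv_fderiv_transportC_eq_integrals hA hs σ u v hu hv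
    have hvu := fderiv_fderiv_transportC_eq_integrals hA hs σ v u hv hu
    rw [← fderiv_fderiv_transportC_comm hA σ u v] at hvu
    simp only [add_comm (conjL A σ _ (curvForm A _ (v.val _) (σ.vel _)) * _)] at hvu
    rw [integral_add (hJ u v) (hJ v u), integral_add (hK u v) (hK v u)]
    have haverage := congrArg₂ (fun x y => (1 / 2 : ℝ) • (x + y)) huv hvu
    rw [← two_smul ℝ, smul_smul, one_div, inv_mul_cancel₀ two_ne_zero, one_smul] at haverage
    rw [haverage]
    simp only [mul_add, mul_sub]
    module

end LevyTrace

section SmoothCurves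

theorem HasWeakDeriv.of_contDiff {V : Type*} [NormedAddCommGroup V] [NormedSpace ℝ V]
    [CompleteSpace V] {f : ℝ → V} (hf : ContDiff ℝ 1 f) : HasWeakDeriv f (deriv f) := by
  have hcont : Continuous (deriv f) := hf.continuous_deriv le_rfl
  have hint : Integrable (deriv f) leb := hcont.continuousOn.integrableOn_compact isCompact_Icc
  refine ((HasWeakDeriv.const (f 0)).add (HasWeakDeriv.primitive hint)).congr_deriv
    (.of_forall fun t => zero_add _) |>.congr fun t _ => ?_
  rw [intervalIntegral.integral_deriv_eq_sub (fun x _ => hf.differentiable one_ne_zero x)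
    (hcont.intervalIntegrable _ _)]
  abel

namespace Curve

variable {p : ℝ≥0∞} {f : ℝ → Mink}

theorem hasWeakDeriv_extendI_of_contDiff (hf : ContDiff ℝ 1 f) :
    HasWeakDeriv (extendI fun t : unitInterval => f t) (deriv f) :=
  (HasWeakDeriv.of_contDiff hf).congr fun t ht => by rw [extendI, IccExtend_of_mem _ _ ht]

/-- The restriction to `[0,1]` of a continuously differentiable curve starting at the origin. -/
def ofContDiff (p : ℝ≥0∞) (hf : ContDiff ℝ 1 f) (h0 : f 0 = 0) : Curve p :=
  ⟨fun t => f t, by simpa using h0,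
    (hasWeakDeriv_extendI_of_contDiff hf).absolutelyContinuousOnInterval, by
      have hcont : Continuous (deriv f) := hf.continuous_deriv le_rfl
      obtain ⟨C, hC⟩ := isCompact_Icc.exists_bound_of_continuousOn (s := Icc (0 : ℝ) 1)
        hcont.continuousOn
      refine MemLp.ae_eq (f := deriv f) ?_ (MemLp.of_bound hcont.aestronglyMeasurable C ?_)
      · filter_upwards [(hasWeakDeriv_extendI_of_contDiff hf).ae_hasDerivAt] with t ht
          using ht.deriv.symm
      · filter_upwards [ae_restrict_mem measurableSet_Icc] with t ht using hC t ht⟩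

theorem ofContDiff_val (hf : ContDiff ℝ 1 f) (h0 : f 0 = 0) {t : ℝ} (ht : t ∈ Icc (0 : ℝ) 1) :
    (ofContDiff p hf h0).val t = f t :=
  IccExtend_of_mem _ (fun t : unitInterval => f t) ht

theorem ae_vel_apply_eq_zero [Fact (1 ≤ p)] (σ : Curve p) {κ : Fin 4}
    (h : ∀ t ∈ Icc (0 : ℝ) 1, σ.val t κ = 0) : ∀ᵐ t ∂leb, σ.vel t κ = 0 := by
  filter_upwards [σ.hasWeakDeriv.ae_hasDerivAt, ae_leb_mem_Ioo] with t ht hmem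
  have hcoord := (EuclideanSpace.proj (𝕜 := ℝ) κ).hasFDerivAt.comp_hasDerivAt t ht
  refine (hcoord.congr_of_eventuallyEq (f₁ := fun _ => 0) ?_).unique (hasDerivAt_const t 0)
  filter_upwards [Ioo_mem_nhds hmem.1 hmem.2] with s hs using (h s (Ioo_subset_Icc_self hs)).symm

end Curve

end SmoothCurves

section RiemannLebesgue

open Real FourierTransform

variable {X F : Type*} [NormedAddCommGroup X] [MeasurableSpace X]
  [NormedAddCommGroup F] {μ : Measure X} {f : X → F}

theorem integrable_cos_smul [NormedSpace ℝ F] [OpensMeasurableSpace X]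
    (hf : Integrable f μ) {c : X → ℝ}
    (hc : Continuous c) : Integrable (fun x => cos (c x) • f x) μ :=
  hf.mono ((continuous_cos.comp hc).aestronglyMeasurable.smul hf.1) (.of_forall fun x => by
    rw [norm_smul]
    exact mul_le_of_le_one_left (norm_nonneg _) (abs_cos_le_one _))

variable [NormedSpace ℂ F] [NormedSpace ℝ X] [FiniteDimensional ℝ X] [BorelSpace X]

theorem tendsto_integral_cos_smul_cocompact [μ.IsAddHaarMeasure] (hf : Integrable f μ) :
    Tendsto (fun w : StrongDual ℝ X => ∫ x, cos (2 * π * w x) • f x ∂μ)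
      (cocompact (StrongDual ℝ X)) (𝓝 0) := by
  have hint (w : StrongDual ℝ X) : Integrable (fun x => 𝐞 (-w x) • f x) μ := by
    have hcont : Continuous fun x => ((𝐞 (-w x) : Circle) : ℂ) := by fun_prop
    exact hf.mono (hcont.aestronglyMeasurable.smul hf.1) (.of_forall fun x => by simp)
  have hexp := tendsto_integral_exp_smul_cocompact f μ
  have hexp_neg := hexp.comp
    (Homeomorph.neg (StrongDual ℝ X)).isClosedEmbedding.tendsto_cocompact
  have hsum := (hexp.add hexp_neg).const_smul (1 / 2 : ℂ)
  rw [add_zero, smul_zero] at hsum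
  refine hsum.congr fun w => ?_
  change (1 / 2 : ℂ) • ((∫ x, 𝐞 (-w x) • f x ∂μ) + ∫ x, 𝐞 (-(-w) x) • f x ∂μ) = _
  rw [← integral_add (hint w) (hint (-w)), ← integral_smul]
  refine integral_congr_ae (.of_forall fun x => ?_)
  simp only [Circle.smul_def, fourierChar_apply, ← add_smul, smul_smul]
  rw [← algebraMap_smul ℂ (cos (2 * π * w x)) (f x)]
  congr 1
  simp only [_root_.neg_apply, Complex.coe_algebraMap, Complex.ofReal_cos, Complex.cos]
  push_cast
  ring_nf

/-- The isometric embedding of a real normed space into the complex Banach space of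
`ℂ`-valued functionals on its dual; it carries the Riemann–Lebesgue lemma over to real spaces. -/
def complexBidualEmbedding (V : Type*) [NormedAddCommGroup V] [NormedSpace ℝ V] :
    V →ₗᵢ[ℝ] StrongDual ℝ V →L[ℝ] ℂ where
  toLinearMap := ((ContinuousLinearMap.compL ℝ (StrongDual ℝ V) ℝ ℂ Complex.ofRealCLM).comp
    (NormedSpace.inclusionInDoubleDual ℝ V)).toLinearMap
  norm_map' v := Complex.ofRealLI.norm_toContinuousLinearMap_comp.trans
    ((NormedSpace.inclusionInDoubleDualLi ℝ).norm_map v)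

theorem tendsto_setIntegral_cos_smul {V : Type*} [NormedAddCommGroup V] [NormedSpace ℝ V]
    [CompleteSpace V] [μ.IsAddHaarMeasure] {f : X → V} {s : Set X} (hs : MeasurableSet s)
    (hf : IntegrableOn f s μ) {L : StrongDual ℝ X} (hL : L ≠ 0) :
    Tendsto (fun n : ℕ => ∫ x in s, cos (2 * π * (n * L x)) • f x ∂μ) atTop (𝓝 0) := by
  have hL_tendsto : Tendsto (fun n : ℕ => (n : ℝ) • L) atTop (cocompact (StrongDual ℝ X)) := by
    have : ProperSpace (StrongDual ℝ X) := FiniteDimensional.proper ℝ _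
    rw [← Metric.cobounded_eq_cocompact, ← tendsto_norm_atTop_iff_cobounded]
    simp only [norm_smul, Real.norm_natCast]
    exact tendsto_natCast_atTop_atTop.atTop_mul_const (norm_pos_iff.2 hL)
  let J := complexBidualEmbedding V
  have hJf : Integrable (s.indicator fun x => J (f x)) μ :=
    (integrable_indicator_iff hs).2 (J.toContinuousLinearMap.integrable_comp hf)
  have hind := (tendsto_integral_cos_smul_cocompact hJf).comp hL_tendsto
  rw [tendsto_zero_iff_norm_tendsto_zero] at hind ⊢
  refine hind.congr fun n => ?_
  rw [← J.norm_map, ← J.integral_comp_comm, ← integral_indicator hs]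
  simp only [map_smul, indicator_smul]
  rfl

end RiemannLebesgue

section SineCurves

open Real

variable {p : ℝ≥0∞}

/-- The curves `√2 sin(π n t) p_μ`, which detect the Lévy trace: the squares of the coordinates
converge weakly to `1`, while the tensor squares converge weakly to `0`. -/
def sineCurve (p : ℝ≥0∞) (n : ℕ) (μ : Fin 4) : Curve p :=
  Curve.ofContDiff p (f := fun t => (√2 * sin (π * n * t)) • basisVec μ)
    ((contDiff_const.mul (contDiff_sin.comp (contDiff_const.mul contDiff_id))).smul contDiff_const)
    (by simp)

theorem sineCurve_val (n : ℕ) (μ κ : Fin 4) {t : ℝ} (ht : t ∈ Icc (0 : ℝ) 1) :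
    (sineCurve p n μ).val t κ = if κ = μ then √2 * sin (π * n * t) else 0 := by
  rw [sineCurve, Curve.ofContDiff_val _ _ ht]
  simp [basisVec]

theorem sineCurve_val_one (n : ℕ) (μ : Fin 4) : (sineCurve p n μ).val 1 = 0 := by
  rw [sineCurve, Curve.ofContDiff_val _ _ (by simp), mul_one, mul_comm π, sin_nat_mul_pi]
  simp

theorem sum_sum_sineCurve_val_mul_smul {F : Type*} [AddCommGroup F] [Module ℝ F] (n : ℕ)
    (μ : Fin 4) {s t : ℝ} (hs : s ∈ Icc (0 : ℝ) 1) (ht : t ∈ Icc (0 : ℝ) 1)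
    (c : Fin 4 → Fin 4 → F) :
    ∑ κ, ∑ ν, ((sineCurve p n μ).val s κ * (sineCurve p n μ).val t ν) • c κ ν =
      (√2 * sin (π * n * s) * (√2 * sin (π * n * t))) • c μ μ := by
  simp [sineCurve_val _ _ _ hs, sineCurve_val _ _ _ ht, ite_smul]

variable {F : Type*} [NormedAddCommGroup F] [NormedSpace ℝ F] [CompleteSpace F]

theorem tendsto_integral_sin_mul_sin_smul {f : ℝ → F} (hf : Integrable f leb) :
    Tendsto (fun n : ℕ => ∫ t, (√2 * sin (π * n * t) * (√2 * sin (π * n * t))) • f t ∂leb) atTop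
      (𝓝 (∫ t, f t ∂leb)) := by
  have hcos := (tendsto_setIntegral_cos_smul measurableSet_Icc hf
    (L := ContinuousLinearMap.id ℝ ℝ) one_ne_zero).const_sub (∫ t, f t ∂leb)
  rw [sub_zero] at hcos
  refine hcos.congr fun n => ?_
  rw [← integral_sub hf (integrable_cos_smul hf (by fun_prop))]
  refine integral_congr_ae (.of_forall fun t => ?_)
  beta_reduce
  rw [ContinuousLinearMap.id_apply, mul_assoc 2, ← mul_assoc π, cos_two_mul, cos_sq',
    mul_mul_mul_comm, mul_self_sqrt zero_le_two]
  module

theorem tendsto_integral_prod_sin_mul_sin_smul {f : ℝ × ℝ → F}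
    (hf : Integrable f (leb.prod leb)) :
    Tendsto (fun n : ℕ => ∫ x, (√2 * sin (π * n * x.1) * (√2 * sin (π * n * x.2))) • f x
      ∂(leb.prod leb)) atTop (𝓝 0) := by
  have hprod : leb.prod leb = volume.restrict (Icc (0 : ℝ) 1 ×ˢ Icc (0 : ℝ) 1) :=
    Measure.prod_restrict _ _
  rw [hprod] at hf ⊢
  have htendsto {L : StrongDual ℝ (ℝ × ℝ)} (hL : L (1, 0) ≠ 0) :=
    tendsto_setIntegral_cos_smul (measurableSet_Icc.prod measurableSet_Icc) hf
      (L := L) (ne_of_apply_ne (fun L => L (1, 0)) hL)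
  have hdiff := (htendsto (L := (1 / 2 : ℝ) • (.fst ℝ ℝ ℝ - .snd ℝ ℝ ℝ)) (by simp)).sub
    (htendsto (L := (1 / 2 : ℝ) • (.fst ℝ ℝ ℝ + .snd ℝ ℝ ℝ)) (by simp))
  rw [sub_zero] at hdiff
  refine hdiff.congr fun n => ?_
  rw [← integral_sub (integrable_cos_smul hf (by fun_prop))
    (integrable_cos_smul hf (by fun_prop))]
  refine integral_congr_ae (.of_forall fun x => ?_)
  beta_reduce
  rw [← sub_smul]
  congr 1
  have hminus : 2 * π * (n * (((1 / 2 : ℝ) • (ContinuousLinearMap.fst ℝ ℝ ℝ -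
      ContinuousLinearMap.snd ℝ ℝ ℝ)) x)) = π * n * x.1 - π * n * x.2 := by
    simp only [_root_.smul_apply, _root_.sub_apply, ContinuousLinearMap.coe_fst',
      ContinuousLinearMap.coe_snd', smul_eq_mul]
    ring
  have hplus : 2 * π * (n * (((1 / 2 : ℝ) • (ContinuousLinearMap.fst ℝ ℝ ℝ +
      ContinuousLinearMap.snd ℝ ℝ ℝ)) x)) = π * n * x.1 + π * n * x.2 := by
    simp only [_root_.smul_apply, _root_.add_apply, ContinuousLinearMap.coe_fst',
      ContinuousLinearMap.coe_snd', smul_eq_mul]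
    ring
  rw [hminus, hplus, cos_sub, cos_add, mul_mul_mul_comm, mul_self_sqrt zero_le_two]
  ring

end SineCurves

section LevyTraceUnique

open Real

variable {p : ℝ≥0∞} [Fact (1 ≤ p)]

theorem integral_sum_sum_eta_smul {V : Type*} [NormedAddCommGroup V] [NormedSpace ℝ V]
    {c : Fin 4 → Fin 4 → ℝ → V} (hc : ∀ μ ν, Integrable (c μ ν) leb) :
    ∫ t, ∑ μ, ∑ ν, eta μ ν • c μ ν t ∂leb = ∑ μ, eta μ μ • ∫ t, c μ μ t ∂leb := by
  have hdiag (t : ℝ) : ∑ μ, ∑ ν, eta μ ν • c μ ν t = ∑ μ, eta μ μ • c μ μ t :=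
    Finset.sum_congr rfl fun μ _ => Finset.sum_eq_single_of_mem μ (Finset.mem_univ _)
      fun ν _ hν => by simp [eta, hν.symm]
  simp only [hdiag]
  have hint (μ) : Integrable (fun t => eta μ μ • c μ μ t) leb := (hc μ μ).smul _
  rw [integral_finsetSum _ fun μ _ => hint μ]
  simp only [integral_smul]

theorem integral_sum_sum_sineCurve_vel_mul_val_smul {V : Type*} [NormedAddCommGroup V]
    [NormedSpace ℝ V] (n : ℕ) (μ : Fin 4) {c : Fin 4 → Fin 4 → ℝ → V}
    (hc : c μ μ =ᵐ[leb] -c μ μ) :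
    ∫ t, ∑ κ, ∑ ν, ((sineCurve p n μ).vel t κ * (sineCurve p n μ).val t ν +
      (sineCurve p n μ).vel t κ * (sineCurve p n μ).val t ν) • c κ ν t ∂leb = 0 := by
  have hvel : ∀ᵐ t ∂leb, ∀ κ, κ ≠ μ → (sineCurve p n μ).vel t κ = 0 :=
    ae_all_iff.2 fun κ => ae_all_iff.2 fun hκ => (sineCurve p n μ).ae_vel_apply_eq_zero
      fun t ht => by rw [sineCurve_val n μ κ ht, if_neg hκ]
  have : IsAddTorsionFree V := .of_isTorsionFree ℝ V
  refine integral_eq_zero_of_ae ?_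
  filter_upwards [hvel, ae_restrict_mem measurableSet_Icc, hc] with t hvel ht hct
  have hdiag : c μ μ t = 0 := self_eq_neg.1 hct
  refine Finset.sum_eq_zero fun κ _ => Finset.sum_eq_zero fun ν _ => ?_
  by_cases hκ : κ = μ
  · by_cases hν : ν = μ
    · rw [hκ, hν, hdiag, smul_zero]
    · rw [sineCurve_val _ _ _ ht, if_neg hν, mul_zero, add_zero, zero_smul]
  · rw [hvel κ hκ, zero_mul, add_zero, zero_smul]

variable {F : Type*} [NormedAddCommGroup F] [NormedSpace ℝ F] [CompleteSpace F]

theorem HasLevyTrace.tendsto {Q : Curve p →L[ℝ] Curve p →L[ℝ] F} {w : F} (h : HasLevyTrace Q w) :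
    Tendsto (fun n : ℕ => ∑ μ, eta μ μ • Q (sineCurve p n μ) (sineCurve p n μ)) atTop (𝓝 w) := by
  obtain ⟨QV, QL, QS, hV, hL, -, -, hS, hQ, rfl⟩ := h
  rw [integral_sum_sum_eta_smul hL]
  refine tendsto_finsetSum _ fun μ _ => Tendsto.const_smul ?_ _
  have hlim := (tendsto_integral_prod_sin_mul_sin_smul (hV μ μ)).add
    (tendsto_integral_sin_mul_sin_smul (hL μ μ))
  rw [zero_add] at hlim
  refine hlim.congr fun n => ?_
  rw [hQ _ _ (sineCurve_val_one n μ) (sineCurve_val_one n μ),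
    integral_sum_sum_sineCurve_vel_mul_val_smul n μ (hS μ μ), smul_zero, add_zero]
  congr 1
  · rw [Measure.prod_restrict]
    exact setIntegral_congr_fun (measurableSet_Icc.prod measurableSet_Icc) fun x hx =>
      (sum_sum_sineCurve_val_mul_smul n μ hx.1 hx.2 fun κ ν => QV κ ν x).symm
  · exact setIntegral_congr_fun measurableSet_Icc fun t ht =>
      (sum_sum_sineCurve_val_mul_smul n μ ht ht fun κ ν => QL κ ν t).symm

theorem HasLevyTrace.unique {Q : Curve p →L[ℝ] Curve p →L[ℝ] F} {w w' : F}
    (h : HasLevyTrace Q w) (h' : HasLevyTrace Q w') : w = w' :=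
  tendsto_nhds_unique h.tendsto h'.tendsto

end LevyTraceUnique

section VectorMeasure

variable {α V : Type*} [MeasurableSpace α] [NormedAddCommGroup V] [NormedSpace ℝ V]
  [CompleteSpace V] {μ : Measure α} {ρ : α → V}

theorem isFiniteMeasure_variation_withDensityᵥ (hρ : Integrable ρ μ) :
    IsFiniteMeasure (μ.withDensityᵥ ρ).variation := by
  rw [Measure.variation_withDensityᵥ hρ]
  exact isFiniteMeasure_withDensity hρ.2.ne

theorem integral_withDensityᵥ_simpleFunc (hρ : Integrable ρ μ) (φ : SimpleFunc α ℝ) :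
    ∫ᵛ x, φ x ∂•(μ.withDensityᵥ ρ) = ∫ x, φ x • ρ x ∂μ := by
  have := isFiniteMeasure_variation_withDensityᵥ hρ
  have hint (φ : SimpleFunc α ℝ) : Integrable (fun x => φ x • ρ x) μ := by
    obtain ⟨C, hC⟩ := φ.exists_forall_norm_le
    exact hρ.bdd_smul C φ.stronglyMeasurable.aestronglyMeasurable (.of_forall hC)
  induction φ using SimpleFunc.induction with
  | @const c s hs =>
    have hcoe : ⇑(SimpleFunc.piecewise s hs (SimpleFunc.const α c) (SimpleFunc.const α 0)) =
        s.indicator fun _ => c := by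
      ext x
      by_cases hx : x ∈ s <;> simp [hx]
    rw [hcoe, VectorMeasure.integral_indicator_const _ hs, withDensityᵥ_apply hρ hs]
    simp only [← indicator_smul_left]
    rw [integral_indicator hs, integral_smul, ContinuousLinearMap.lsmul_apply]
  | @add f g _ hf hg =>
    rw [SimpleFunc.coe_add, VectorMeasure.integral_add f.integrable_of_isFiniteMeasure
      g.integrable_of_isFiniteMeasure, hf, hg, ← integral_add (hint f) (hint g)]
    simp only [Pi.add_apply, add_smul]

theorem integral_withDensityᵥ (hρ : Integrable ρ μ) {f : α → ℝ} (hf : StronglyMeasurable f)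
    {C : ℝ} (hC : ∀ x, ‖f x‖ ≤ C) :
    ∫ᵛ x, f x ∂•(μ.withDensityᵥ ρ) = ∫ x, f x • ρ x ∂μ := by
  have := isFiniteMeasure_variation_withDensityᵥ hρ
  rcases isEmpty_or_nonempty α with hα | ⟨⟨x₀⟩⟩
  · rw [VectorMeasure.integral_of_isEmpty, Measure.eq_zero_of_isEmpty μ, integral_zero_measure]
  have hbound (n : ℕ) (x : α) : ‖hf.approxBounded C n x‖ ≤ C :=
    hf.norm_approxBounded_le ((norm_nonneg _).trans (hC x₀)) n x
  have hlim (x : α) : Tendsto (fun n => hf.approxBounded C n x) atTop (𝓝 (f x)) :=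
    hf.tendsto_approxBounded_of_norm_le (hC x)
  have hmeas (n : ℕ) {m : Measure α} : AEStronglyMeasurable (hf.approxBounded C n) m :=
    (hf.approxBounded C n).stronglyMeasurable.aestronglyMeasurable
  have hleft : Tendsto (fun n => ∫ᵛ x, hf.approxBounded C n x ∂•(μ.withDensityᵥ ρ)) atTop
      (𝓝 (∫ᵛ x, f x ∂•(μ.withDensityᵥ ρ))) :=
    VectorMeasure.tendsto_integral_filter_of_norm_le_const (.of_forall fun n => hmeas n)
      ⟨C, .of_forall fun n => .of_forall (hbound n)⟩ (.of_forall hlim)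
  have hright : Tendsto (fun n => ∫ x, hf.approxBounded C n x • ρ x ∂μ) atTop
      (𝓝 (∫ x, f x • ρ x ∂μ)) :=
    tendsto_integral_of_dominated_convergence (fun x => C * ‖ρ x‖)
      (fun n => (hmeas n).smul hρ.1) (hρ.norm.const_mul C)
      (fun n => .of_forall fun x => (norm_smul_le _ _).trans
        (mul_le_mul_of_nonneg_right (hbound n x) (norm_nonneg _)))
      (.of_forall fun x => (hlim x).smul_const _)
  exact tendsto_nhds_unique hleft
    (hright.congr fun n => (integral_withDensityᵥ_simpleFunc hρ _).symm)

end VectorMeasure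

section Endpoint

/-- The curve `t ↦ t ^ (n + 1) h`; as `n → ∞` these concentrate at the endpoint `t = 1`. -/
def powCurve (p : ℝ≥0∞) (n : ℕ) (h : Mink) : Curve p :=
  Curve.ofContDiff p (f := fun t => t ^ (n + 1) • h) ((contDiff_id.pow _).smul contDiff_const)
    (by simp)

theorem powCurve_val_apply {p : ℝ≥0∞} (n : ℕ) (h : Mink) (μ : Fin 4) {t : ℝ}
    (ht : t ∈ Icc (0 : ℝ) 1) : (powCurve p n h).val t μ = t ^ (n + 1) * h μ := by
  rw [powCurve, Curve.ofContDiff_val _ _ ht, PiLp.smul_apply, smul_eq_mul]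

theorem tendsto_pow_succ_mul_indicator_one (x : ℝ) (t : unitInterval) :
    Tendsto (fun n : ℕ => (t : ℝ) ^ (n + 1) * x) atTop
      (𝓝 (({1} : Set unitInterval).indicator (fun _ => x) t)) := by
  by_cases ht : t = 1
  · simp [ht]
  · have hlt : (t : ℝ) < 1 := t.2.2.lt_of_ne fun h => ht (Subtype.ext h)
    simpa [ht] using ((tendsto_pow_atTop_nhds_zero_of_lt_one t.2.1 hlt).comp
      (tendsto_add_atTop_nat 1)).mul_const x

variable {V : Type*} [NormedAddCommGroup V]

theorem integrable_unitInterval {ρ : ℝ → V} (hρ : Integrable ρ leb) :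
    Integrable fun t : unitInterval => ρ t :=
  (unitInterval.measurePreserving_coe.integrable_comp_emb
    unitInterval.measurableEmbedding_coe).2 hρ

theorem isFiniteMeasure_variation_dirac {α : Type*} [MeasurableSpace α] (a : α) (c : V) :
    IsFiniteMeasure (VectorMeasure.dirac a c).variation := by
  rw [VectorMeasure.variation_dirac]
  exact Measure.smul_finite _ enorm_ne_top

variable [NormedSpace ℝ V] {p : ℝ≥0∞} [Fact (1 ≤ p)]

theorem Curve.exists_norm_val_apply_le (u : Curve p) (μ : Fin 4) :
    ∃ C, ∀ t ∈ Icc (0 : ℝ) 1, ‖u.val t μ‖ ≤ C :=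
  isCompact_Icc.exists_bound_of_continuousOn
    ((EuclideanSpace.proj (𝕜 := ℝ) μ).continuous.comp_continuousOn u.hasWeakDeriv.continuousOn)

theorem Curve.continuous_val_apply (u : Curve p) (μ : Fin 4) :
    Continuous fun t : unitInterval => u.val t μ :=
  (EuclideanSpace.proj (𝕜 := ℝ) μ).continuous.comp
    (u.hasWeakDeriv.continuousOn.comp_continuous continuous_subtype_val Subtype.prop)

theorem Curve.integrable_val_smul (u : Curve p) (μ : Fin 4) {ρ : ℝ → V}
    (hρ : Integrable ρ leb) : Integrable (fun t => u.val t μ • ρ t) leb := by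
  obtain ⟨C, hC⟩ := u.exists_norm_val_apply_le μ
  exact hρ.bdd_smul C
    (((EuclideanSpace.proj (𝕜 := ℝ) μ).continuous.comp_continuousOn
      u.hasWeakDeriv.continuousOn).aestronglyMeasurable measurableSet_Icc)
    ((ae_restrict_iff' measurableSet_Icc).2 (.of_forall hC))

variable {h : Mink} {T : Curve p →L[ℝ] V} [CompleteSpace V]

theorem HasEndpointValue.tendsto {v : V} (H : HasEndpointValue h T v) :
    Tendsto (fun n : ℕ => T (powCurve p n h)) atTop (𝓝 v) := by
  obtain ⟨ν, hν, hT, rfl⟩ := H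
  simp only [hT]
  refine tendsto_finsetSum _ fun μ _ => ?_
  have := hν μ
  have hval (n : ℕ) (t : unitInterval) : (powCurve p n h).val t μ = (t : ℝ) ^ (n + 1) * h μ :=
    powCurve_val_apply n h μ t.2
  simp only [hval]
  have hone : ∫ᵛ t, ({1} : Set unitInterval).indicator (fun _ => h μ) t ∂•(ν μ) =
      h μ • ν μ {1} :=
    VectorMeasure.integral_indicator_const (h μ) (measurableSet_singleton _)
  rw [← hone]
  refine VectorMeasure.tendsto_integral_filter_of_norm_le_const
    (.of_forall fun n => ?_) ⟨|h μ|, .of_forall fun n => .of_forall fun t => ?_⟩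
    (.of_forall (tendsto_pow_succ_mul_indicator_one (h μ)))
  · exact Continuous.aestronglyMeasurable (by fun_prop)
  · rw [norm_mul, norm_pow, Real.norm_eq_abs, Real.norm_eq_abs, abs_of_nonneg t.2.1]
    exact mul_le_of_le_one_left (abs_nonneg _) (pow_le_one₀ t.2.1 t.2.2)

theorem HasEndpointValue.unique {v v' : V} (H : HasEndpointValue h T v)
    (H' : HasEndpointValue h T v') : v = v' :=
  tendsto_nhds_unique H.tendsto H'.tendsto

theorem Curve.integral_dirac_add_withDensityᵥ (u : Curve p) (μ : Fin 4) (c : V) {ρ : ℝ → V}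
    (hρ : Integrable ρ leb) :
    ∫ᵛ t, u.val t μ ∂•(VectorMeasure.dirac (1 : unitInterval) c +
      (volume : Measure unitInterval).withDensityᵥ fun t => ρ t) =
      u.val 1 μ • c + ∫ t, u.val t μ • ρ t ∂leb := by
  have hu := u.continuous_val_apply μ
  obtain ⟨C, hC⟩ := u.exists_norm_val_apply_le μ
  have hint (m : Measure unitInterval) [IsFiniteMeasure m] :
      Integrable (fun t : unitInterval => u.val t μ) m :=
    .of_bound hu.aestronglyMeasurable C (.of_forall fun t => hC t t.2)
  have := isFiniteMeasure_variation_dirac (1 : unitInterval) c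
  have := isFiniteMeasure_variation_withDensityᵥ (integrable_unitInterval hρ)
  rw [VectorMeasure.integral_add_vectorMeasure (hint _) (hint _), VectorMeasure.integral_dirac,
    integral_withDensityᵥ (integrable_unitInterval hρ) hu.stronglyMeasurable fun t => hC t t.2]
  congr 1
  exact unitInterval.measurePreserving_coe.integral_comp
    unitInterval.measurableEmbedding_coe fun t => u.val t μ • ρ t

theorem hasEndpointValue_of_eq_integral (h : Mink) {c : Fin 4 → V} {ρ : Fin 4 → ℝ → V}
    (hρ : ∀ μ, Integrable (ρ μ) leb)
    (hT : ∀ u : Curve p, T u = ∑ μ, u.val 1 μ • c μ + ∫ t, ∑ μ, u.val t μ • ρ μ t ∂leb) :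
    HasEndpointValue h T (∑ μ, h μ • c μ) := by
  refine ⟨fun μ => VectorMeasure.dirac (1 : unitInterval) (c μ) +
    (volume : Measure unitInterval).withDensityᵥ fun t => ρ μ t, fun μ => ?_, fun u => ?_, ?_⟩
  · have := isFiniteMeasure_variation_dirac (1 : unitInterval) (c μ)
    have := isFiniteMeasure_variation_withDensityᵥ (integrable_unitInterval (hρ μ))
    exact isFiniteMeasure_of_le _ VectorMeasure.variation_add_le
  · rw [hT u, integral_finsetSum _ fun μ _ => u.integrable_val_smul μ (hρ μ),
      ← Finset.sum_add_distrib]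
    exact Finset.sum_congr rfl fun μ _ => (u.integral_dirac_add_withDensityᵥ μ _ (hρ μ)).symm
  · refine Finset.sum_congr rfl fun μ _ => congrArg (h μ • ·) ?_
    rw [_root_.add_apply, VectorMeasure.dirac_apply_of_mem (measurableSet_singleton _)
      (mem_singleton _), withDensityᵥ_apply (integrable_unitInterval (hρ μ))
      (measurableSet_singleton _)]
    simp

end Endpoint

section TransportedSection

variable {R : Type*} [NormedRing R] [NormedAlgebra ℝ R] [CompleteSpace R]
  [StarRing R] [NormedStarGroup R] [StarModule ℝ R]
  {p : ℝ≥0∞} [Fact (1 ≤ p)] {A : C(Mink, Mink →L[ℝ] R)}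
  {S : Type*} [NormedAddCommGroup S] [NormedSpace ℝ S]
  (B : R →L[ℝ] S →L[ℝ] S) {ψ : Mink → S}

/-- The endpoint map `σ ↦ σ(1)`. -/
def endpointL (p : ℝ≥0∞) [Fact (1 ≤ p)] : Curve p →L[ℝ] Mink :=
  (ContinuousMap.evalCLM ℝ (1 : unitInterval)).comp Curve.posL

theorem endpointL_apply (σ : Curve p) : endpointL p σ = σ.val 1 := Curve.posL_apply σ 1

/-- The section `ψ` at the endpoint of `σ`, transported back to the origin along `σ`; the algebra
`R` acts on the fibre through `B`. -/
def transportedSection (A : C(Mink, Mink →L[ℝ] R)) (ψ : Mink → S) (σ : Curve p) : S :=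
  B (star (extendI (transportC A σ) 1)) (ψ (σ.val 1))

variable (hA : ContDiff ℝ ∞ A) (hψ : ContDiff ℝ ∞ ψ)
include hA hψ

theorem contDiff_transportedSection : ContDiff ℝ ∞ (transportedSection (p := p) B A ψ) := by
  have hU : ContDiff ℝ ∞ fun σ : Curve p => star (extendI (transportC A σ) 1) :=
    ((evalAt R 1).comp (starC R)).contDiff.comp (contDiff_transportC hA)
  have hend : ContDiff ℝ ∞ fun σ : Curve p => ψ (σ.val 1) := by
    simpa only [Function.comp_def, endpointL_apply] using hψ.comp (endpointL p).contDiff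
  exact contDiff_bilin B hU hend

variable (hs : ∀ x v, star (A x v) = -A x v) (hB : ∀ X Y s, B (X * Y) s = B X (B Y s))
include hs hB

theorem fderiv_transportedSection (σ u : Curve p) :
    fderiv ℝ (transportedSection B A ψ) σ u =
      B (star (extendI (transportC A σ) 1))
        (B (A (σ.val 1) (u.val 1)) (ψ (σ.val 1)) + fderiv ℝ ψ (σ.val 1) (u.val 1)) +
      B (extendI (curvInt hA σ u) 1 * star (extendI (transportC A σ) 1)) (ψ (σ.val 1)) := by
  have hU : HasFDerivAt (fun σ : Curve p => star (extendI (transportC A σ) 1))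
      (((evalAt R 1).comp (starC R)).comp (fderiv ℝ (transportC A) σ)) σ :=
    ((evalAt R 1).comp (starC R)).hasFDerivAt.comp σ (differentiable_transportC hA σ).hasFDerivAt
  have hend : HasFDerivAt (fun σ : Curve p => ψ (σ.val 1))
      ((fderiv ℝ ψ (σ.val 1)).comp (endpointL p)) σ := by
    have hψ1 : HasFDerivAt ψ (fderiv ℝ ψ (endpointL p σ)) (endpointL p σ) :=
      (hψ.differentiable (by simp) _).hasFDerivAt
    simpa only [Function.comp_def, endpointL_apply] using
      hψ1.comp σ (endpointL p).hasFDerivAt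
  have hstar : fderiv ℝ (fun σ : Curve p => star (extendI (transportC A σ) 1)) σ u =
      star (extendI (transportC A σ) 1) * A (σ.val 1) (u.val 1) +
        extendI (curvInt hA σ u) 1 * star (extendI (transportC A σ) 1) := by
    rw [hU.fderiv, ← star_fderiv_transportC hA hs σ u (by simp)]
    rfl
  have hsection : fderiv ℝ (fun σ : Curve p => ψ (σ.val 1)) σ u =
      fderiv ℝ ψ (σ.val 1) (u.val 1) := by
    rw [hend.fderiv, ContinuousLinearMap.comp_apply, endpointL_apply]
  refine (fderiv_bilin_apply B hU.differentiableAt hend.differentiableAt u).trans ?_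
  rw [hstar, hsection, map_add, map_add, _root_.add_apply, hB]
  abel

theorem hasEndpointValue_transportedSection [CompleteSpace S] (h : Mink) (σ : Curve p) :
    HasEndpointValue h (fderiv ℝ (transportedSection B A ψ) σ)
      (B (star (extendI (transportC A σ) 1))
        (B (A (σ.val 1) h) (ψ (σ.val 1)) + fderiv ℝ ψ (σ.val 1) h)) := by
  let c : Mink →L[ℝ] S := (B (star (extendI (transportC A σ) 1))).comp
    ((B.flip (ψ (σ.val 1))).comp (A (σ.val 1)) + fderiv ℝ ψ (σ.val 1))
  let L : R →L[ℝ] S := (B.flip (ψ (σ.val 1))).comp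
    ((ContinuousLinearMap.mul ℝ R).flip (star (extendI (transportC A σ) 1)))
  have hint {u : ℝ → Mink} (hu : ContinuousOn u (Icc 0 1)) :
      Integrable (fun t => conjL A σ t (curvForm A (σ.val t) (u t) (σ.vel t))) leb :=
    integrable_conjL_curvForm hA σ hu σ.hasWeakDeriv.integrable
  suffices HasEndpointValue h (fderiv ℝ (transportedSection B A ψ) σ)
      (∑ μ, h μ • c (basisVec μ)) by
    rwa [← map_eq_sum_basisVec c] at this
  refine hasEndpointValue_of_eq_integral h (ρ := fun μ t =>
    L (conjL A σ t (curvForm A (σ.val t) (basisVec μ) (σ.vel t))))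
    (fun μ => L.integrable_comp (hint continuousOn_const)) fun u => ?_
  have hcurv : extendI (curvInt hA σ u) 1 =
      ∫ t, conjL A σ t (curvForm A (σ.val t) (u.val t) (σ.vel t)) ∂leb := by
    rw [(hasWeakDeriv_curvInt hA σ u).eq_add_integral (t := 1) (by simp),
      extendI_curvInt_zero, zero_add, integral_leb_eq_intervalIntegral]
  have hL : L (extendI (curvInt hA σ u) 1) = ∫ t, ∑ μ, u.val t μ •
      L (conjL A σ t (curvForm A (σ.val t) (basisVec μ) (σ.vel t))) ∂leb := by
    rw [hcurv, ← L.integral_comp_comm (hint u.hasWeakDeriv.continuousOn)]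
    refine integral_congr_ae (.of_forall fun t => ?_)
    simp only [curvForm_eq_sum_left A (σ.val t) (u.val t), map_sum, map_smul]
  rw [fderiv_transportedSection B hA hψ hs hB, ← map_eq_sum_basisVec c, ← hL]
  rfl

end TransportedSection

section Divergence

variable {R : Type*} [NormedRing R] [NormedAlgebra ℝ R]

/-- The one-form `v ↦ ∇^μ F_{μν} v^ν`. -/
def divCurv (A : Mink → Mink →L[ℝ] R) (x : Mink) : Mink →L[ℝ] R :=
  ∑ μ, ∑ ν, eta μ ν • covCurv A x (basisVec μ) (basisVec ν)

theorem divCurv_apply (A : Mink → Mink →L[ℝ] R) (x v : Mink) : divCurv A x v =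
    ∑ μ, ∑ ν, eta μ ν • covCurv A x (basisVec μ) (basisVec ν) v := by
  simp only [divCurv, _root_.sum_apply, FunLike.coe_smul, Pi.smul_apply]

theorem continuous_divCurv {A : Mink → Mink →L[ℝ] R} (hA : ContDiff ℝ ∞ A) :
    Continuous (divCurv A) := by
  have hF : Continuous (curvForm A) := (contDiff_curvForm hA).continuous
  have hdF : Continuous (fderiv ℝ (curvForm A)) :=
    (contDiff_curvForm hA).continuous_fderiv (by simp)
  have hAv (v : Mink) : Continuous fun x => A x v := hA.continuous.clm_apply continuous_const
  have hFv (v : Mink) : Continuous fun x => curvForm A x v := hF.clm_apply continuous_const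
  have hcov (w u : Mink) : Continuous fun x => covCurv A x w u :=
    ((hdF.clm_apply continuous_const).clm_apply continuous_const).add
      (((actL.continuous.comp (hAv w)).clm_apply (hFv u)).sub
        ((actR.continuous.comp (hFv u)).clm_apply (hAv w)))
  exact continuous_finsetSum _ fun μ _ => continuous_finsetSum _ fun ν _ =>
    (hcov (basisVec μ) (basisVec ν)).const_smul (eta μ ν)

end Divergence

section ConjugatedIntegral

variable {R : Type*} [NormedRing R] [NormedAlgebra ℝ R] [StarRing R]
  {p : ℝ≥0∞} [Fact (1 ≤ p)] {A : C(Mink, Mink →L[ℝ] R)} {K : Mink → Mink →L[ℝ] R}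

theorem conjL_shrink [CompleteSpace R] (r : unitInterval) (σ : Curve p) {t : ℝ}
    (ht : t ∈ Icc (0 : ℝ) 1) : conjL A (Curve.shrink r σ) t = conjL A σ (r * t) := by
  have htransport : extendI (transportC A (Curve.shrink r σ)) t =
      extendI (transportC A σ) (r * t) := by
    rw [transportC_shrink]
    exact extendI_comp_mul r _ ht
  rw [conjL, conjL, htransport]

theorem intervalIntegral_conjL_eq_integral_shrink [CompleteSpace R] {f : ℝ → Mink}
    (hf : ContDiff ℝ 1 f) (hf0 : f 0 = 0) (r : unitInterval) :
    ∫ s in (0 : ℝ)..r, conjL A (Curve.ofContDiff p hf hf0) s (K (f s) (deriv f s)) =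
      ∫ t, conjL A (Curve.shrink r (Curve.ofContDiff p hf hf0)) t
        (K ((Curve.shrink r (Curve.ofContDiff p hf hf0)).val t)
          ((Curve.shrink r (Curve.ofContDiff p hf hf0)).vel t)) ∂leb := by
  have hscale := intervalIntegral.smul_integral_comp_mul_left (a := 0) (b := 1)
    (fun s => conjL A (Curve.ofContDiff p hf hf0) s (K (f s) (deriv f s))) r
  rw [mul_zero, mul_one] at hscale
  rw [← hscale, ← intervalIntegral.integral_smul, ← integral_leb_eq_intervalIntegral]
  refine integral_congr_ae ?_
  filter_upwards [ae_leb_mem_Ioo] with t ht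
  have ht' : t ∈ Icc (0 : ℝ) 1 := Ioo_subset_Icc_self ht
  rw [conjL_shrink _ _ ht', Curve.shrink_val _ _ ht', Curve.shrink_vel _ _ ht, map_smul, map_smul,
    Curve.ofContDiff_val hf hf0 (coe_mul_mem_Icc r ht')]
  rcases r.2.1.eq_or_lt with hr | hr
  · rw [← hr, zero_smul, zero_smul]
  have hrt : (r : ℝ) * t ∈ Ioo (0 : ℝ) 1 :=
    ⟨mul_pos hr ht.1, (mul_le_of_le_one_left ht.1.le r.2.2).trans_lt ht.2⟩
  have heq : (Curve.ofContDiff p hf hf0).val =ᶠ[𝓝 (r * t)] f := by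
    filter_upwards [Ioo_mem_nhds hrt.1 hrt.2] with s hs
    exact Curve.ofContDiff_val hf hf0 (Ioo_subset_Icc_self hs)
  rw [← heq.deriv_eq]
  rfl

theorem exists_contDiff_through (x v : Mink) :
    ∃ f : ℝ → Mink, ContDiff ℝ 1 f ∧ f 0 = 0 ∧ f (1 / 2) = x ∧ HasDerivAt f v (1 / 2) := by
  refine ⟨fun t => (2 * t) • x + (t * (2 * t - 1)) • (v - (2 : ℝ) • x), by fun_prop, by simp,
    by norm_num, ?_⟩
  have hlin : HasDerivAt (fun t : ℝ => 2 * t) 2 (1 / 2) := by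
    simpa using (hasDerivAt_id (1 / 2 : ℝ)).const_mul 2
  have hquad : HasDerivAt (fun t : ℝ => t * (2 * t - 1)) 1 (1 / 2) :=
    ((hasDerivAt_id (1 / 2 : ℝ)).mul (hlin.sub_const 1)).congr_deriv (by norm_num)
  exact ((hlin.smul_const x).add (hquad.smul_const (v - (2 : ℝ) • x))).congr_deriv (by module)

variable [NormedStarGroup R]

theorem integrable_conjL_comp (hK : Continuous K) (σ : Curve p) :
    Integrable (fun t => conjL A σ t (K (σ.val t) (σ.vel t))) leb :=
  integrable_clm_apply_of_continuousOn (φ := fun t => (conjL A σ t).comp (K (σ.val t)))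
    ((continuous_conjL σ).continuousOn.clm_comp
      (hK.comp_continuousOn σ.hasWeakDeriv.continuousOn)) σ.hasWeakDeriv.integrable

variable [CompleteSpace R] [StarModule ℝ R] (hs : ∀ x v, star (A x v) = -A x v)
include hs

theorem eq_zero_of_conjL_eq_zero (σ : Curve p) {t : ℝ} (ht : t ∈ Icc (0 : ℝ) 1) {X : R}
    (h : conjL A σ t X = 0) : X = 0 := by
  have hU := transportC_mul_star hs σ ht
  calc
    X = extendI (transportC A σ) t * star (extendI (transportC A σ) t) * X *
        (extendI (transportC A σ) t * star (extendI (transportC A σ) t)) := by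
      rw [hU, one_mul, mul_one]
    _ = extendI (transportC A σ) t * conjL A σ t X * star (extendI (transportC A σ) t) := by
      simp only [conjL_apply, mul_assoc]
    _ = 0 := by rw [h, mul_zero, zero_mul]

/-- Shrinking a curve shows that the integral over each initial segment vanishes, and hence so does
the integrand along every `C¹` curve; such a curve passes through any point with any velocity. -/
theorem eq_zero_of_integral_conjL_eq_zero (hK : Continuous K)
    (h : ∀ σ : Curve p, ∫ t, conjL A σ t (K (σ.val t) (σ.vel t)) ∂leb = 0) (x v : Mink) :
    K x v = 0 := by
  obtain ⟨f, hf, hf0, rfl, hfd⟩ := exists_contDiff_through x v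
  let σ := Curve.ofContDiff p hf hf0
  let g (t : ℝ) : R := conjL A σ t (K (f t) (deriv f t))
  have hg : Continuous g := (continuous_conjL σ).clm_apply
    ((hK.comp hf.continuous).clm_apply (hf.continuous_deriv le_rfl))
  have hprim : (fun r => ∫ s in (0 : ℝ)..r, g s) =ᶠ[𝓝 (1 / 2)] fun _ => 0 := by
    filter_upwards [Icc_mem_nhds (a := (0 : ℝ)) (b := 1) (x := 1 / 2) (by norm_num) (by norm_num)]
      with r hr
    exact (intervalIntegral_conjL_eq_integral_shrink hf hf0 ⟨r, hr⟩).trans (h _)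
  have hzero : g (1 / 2) = 0 := (hg.integral_hasStrictDerivAt 0 (1 / 2)).hasDerivAt.unique
    ((hasDerivAt_const (1 / 2 : ℝ) (0 : R)).congr_of_eventuallyEq hprim)
  rw [← hfd.deriv]
  exact eq_zero_of_conjL_eq_zero hs σ (by norm_num) hzero

theorem map_integral_conjL (L : R →L[ℝ] R)
    (hL : ∀ U X : R, U * star U = 1 → L (star U * (X * U)) = star U * (L X * U))
    (hK : Continuous K) (σ : Curve p) :
    L (∫ t, conjL A σ t (K (σ.val t) (σ.vel t)) ∂leb) =
      ∫ t, conjL A σ t (L.comp (K (σ.val t)) (σ.vel t)) ∂leb := by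
  rw [← L.integral_comp_comm (integrable_conjL_comp hK σ)]
  exact setIntegral_congr_fun measurableSet_Icc fun t ht => hL _ _ (transportC_mul_star hs σ ht)

theorem hasLevyTrace_transportC_divCurv (hA : ContDiff ℝ ∞ A) (σ : Curve p) :
    HasLevyTrace (fderiv ℝ (fderiv ℝ fun σ : Curve p => extendI (transportC A σ) 1) σ)
      (-(extendI (transportC A σ) 1 *
        ∫ t, conjL A σ t (divCurv A (σ.val t) (σ.vel t)) ∂leb)) := by
  simpa only [divCurv_apply] using hasLevyTrace_transportC hA hs σ

theorem hasLevyDAlembertian_transportC (hA : ContDiff ℝ ∞ A) :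
    HasLevyDAlembertian (fun σ : Curve p => extendI (transportC A σ) 1) fun σ =>
      -(extendI (transportC A σ) 1 * ∫ t, conjL A σ t (divCurv A (σ.val t) (σ.vel t)) ∂leb) :=
  ⟨((evalAt R 1).contDiff.comp (contDiff_transportC hA)).of_le (WithTop.coe_le_coe.2 le_top),
    hasLevyTrace_transportC_divCurv hs hA⟩

theorem hasLevyDAlembertian_transportC_iff (hA : ContDiff ℝ ∞ A) (hK : Continuous K) :
    HasLevyDAlembertian (fun σ : Curve p => extendI (transportC A σ) 1) (fun σ =>
      extendI (transportC A σ) 1 * ∫ t, conjL A σ t (K (σ.val t) (σ.vel t)) ∂leb) ↔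
      ∀ x v, divCurv A x v = -K x v := by
  have hD : Continuous (divCurv A) := continuous_divCurv hA
  refine ⟨fun h x v => ?_, fun h => ?_⟩
  · refine eq_neg_of_add_eq_zero_left (eq_zero_of_integral_conjL_eq_zero hs (p := p)
      (hD.add hK) (fun σ => ?_) x v)
    have htrace := (hasLevyTrace_transportC_divCurv hs hA σ).unique (h.2 σ)
    have hcancel := congrArg (fun X => star (extendI (transportC A σ) 1) * X) htrace
    simp only [mul_neg, ← mul_assoc, star_transportC_mul hs σ (t := 1) (by simp), one_mul]
      at hcancel
    simp only [Pi.add_apply, _root_.add_apply, map_add]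
    rw [integral_add (integrable_conjL_comp hD σ) (integrable_conjL_comp hK σ), ← hcancel]
    exact add_neg_cancel _
  · simpa only [h, map_neg, integral_neg, mul_neg, neg_neg] using
      hasLevyDAlembertian_transportC (p := p) hs hA

end ConjugatedIntegral

section ConnectionForm

variable {R : Type*} [NormedRing R] [NormedAlgebra ℝ R]

/-- The `R`-valued one-form `A_μ dx^μ`. -/
def connForm (A : Fin 4 → Mink → R) (x : Mink) : Mink →L[ℝ] R :=
  ∑ μ, (EuclideanSpace.proj μ : Mink →L[ℝ] ℝ).smulRight (A μ x)

theorem connForm_apply (A : Fin 4 → Mink → R) (x v : Mink) :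
    connForm A x v = ∑ μ, v μ • A μ x := by
  simp [connForm]

theorem connForm_basisVec (A : Fin 4 → Mink → R) (x : Mink) (ν : Fin 4) :
    connForm A x (basisVec ν) = A ν x := by
  simp [connForm_apply, basisVec, ite_smul]

theorem continuous_connForm {A : Fin 4 → Mink → R} (hA : ∀ μ, Continuous (A μ)) :
    Continuous (connForm A) :=
  continuous_finsetSum _ fun μ _ =>
    (ContinuousLinearMap.smulRightL ℝ Mink R (EuclideanSpace.proj μ)).continuous.comp (hA μ)

theorem star_connForm [StarRing R] [StarModule ℝ R] {A : Fin 4 → Mink → R}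
    (hs : ∀ μ x, star (A μ x) = -A μ x) (x v : Mink) :
    star (connForm A x v) = -connForm A x v := by
  simp only [connForm_apply, star_sum, star_smul, star_trivial, hs, smul_neg,
    Finset.sum_neg_distrib]

variable {A : Fin 4 → Mink → R} (hA : ∀ μ, ContDiff ℝ ∞ (A μ))
include hA

theorem contDiff_connForm : ContDiff ℝ ∞ (connForm A) := by
  refine contDiff_clm_apply_iff.2 fun v => ?_
  simp only [connForm_apply]
  exact ContDiff.sum fun μ _ => (hA μ).const_smul (v μ)

theorem fderiv_connForm_apply (x u : Mink) (ν : Fin 4) :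
    fderiv ℝ (connForm A) x u (basisVec ν) = fderiv ℝ (A ν) x u := by
  have hcomp : (fun x => connForm A x (basisVec ν)) = A ν :=
    funext fun x => connForm_basisVec A x ν
  have hd : DifferentiableAt ℝ (connForm A) x := (contDiff_connForm hA).differentiable (by simp) x
  rw [← hcomp, fderiv_clm_apply hd (differentiableAt_const _)]
  simp

theorem curvForm_connForm (x : Mink) (μ ν : Fin 4) :
    curvForm (connForm A) x (basisVec μ) (basisVec ν) =
      pd μ (A ν) x - pd ν (A μ) x + (A μ x * A ν x - A ν x * A μ x) := by
  simp only [curvForm_apply, fderiv_connForm_apply hA, connForm_basisVec, pd]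

theorem covCurv_connForm (x : Mink) (κ μ ν : Fin 4) :
    covCurv (connForm A) x (basisVec κ) (basisVec μ) (basisVec ν) =
      pd κ (fun x => curvForm (connForm A) x (basisVec μ) (basisVec ν)) x +
        (A κ x * curvForm (connForm A) x (basisVec μ) (basisVec ν) -
          curvForm (connForm A) x (basisVec μ) (basisVec ν) * A κ x) := by
  have hd : DifferentiableAt ℝ (curvForm (connForm A)) x :=
    (contDiff_curvForm (contDiff_connForm hA)).differentiable (by simp) x
  rw [covCurv_apply, connForm_basisVec, pd,
    fderiv_clm_apply (hd.clm_apply (differentiableAt_const _)) (differentiableAt_const _),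
    fderiv_clm_apply hd (differentiableAt_const _)]
  simp

/-- The one-form `A_μ dx^μ` as a continuous map. -/
def connC : C(Mink, Mink →L[ℝ] R) := ⟨connForm A, (contDiff_connForm hA).continuous⟩

/-- The parallel transport `t ↦ U_{t,0}(σ)` on `[0,1]` of the connection with components `A_μ`,
continued by constants. -/
abbrev holonomy {p : ℝ≥0∞} [Fact (1 ≤ p)] (σ : Curve p) : ℝ → R :=
  extendI (transportC (connC hA) σ)

end ConnectionForm

section Holonomy

variable {R : Type*} [NormedRing R] [NormedAlgebra ℝ R] [CompleteSpace R]
  {A : Fin 4 → Mink → R} (hA : ∀ μ, ContDiff ℝ ∞ (A μ)) {p : ℝ≥0∞} [Fact (1 ≤ p)]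

theorem holonomy_shrink_one (r : unitInterval) (σ : Curve p) :
    holonomy hA (Curve.shrink r σ) 1 = holonomy hA σ r :=
  extendI_transportC_shrink_one r σ _

theorem hasWeakDeriv_holonomy_mul (σ : Curve p) (Y : R) :
    HasWeakDeriv (fun t => holonomy hA σ t * Y)
      (fun t => -(connForm A (σ.val t) (σ.vel t) * (holonomy hA σ t * Y))) :=
  ((hasWeakDeriv_transportC (connC hA) σ).clm_comp
    ((ContinuousLinearMap.mul ℝ R).flip Y)).congr_deriv
      (.of_forall fun _ => (neg_mul _ Y).trans (congrArg Neg.neg (mul_assoc _ _ Y)))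

theorem eqOn_holonomy {σ : Curve p} {w : ℝ → R} (hac : AbsolutelyContinuousOnInterval w 0 1)
    (hderiv : ∀ᵐ t, t ∈ Ioo 0 1 → HasDerivAt w (-(connForm A (σ.val t) (σ.vel t) * w t)) t)
    (h0 : w 0 = 1) : EqOn w (holonomy hA σ) (Icc 0 1) := by
  have hcont : ContinuousOn w (Icc 0 1) := by
    simpa only [uIcc_of_le zero_le_one] using hac.continuousOn
  have hconn : Integrable (fun t => connForm A (σ.val t) (σ.vel t)) leb :=
    integrable_clm_apply_of_continuousOn
      ((continuous_connForm fun μ => (hA μ).continuous).comp_continuousOn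
        σ.hasWeakDeriv.continuousOn)
      σ.hasWeakDeriv.integrable
  refine eqOn_transportC (connC hA) ⟨hac, ?_, ?_⟩ h0
  · exact (integrable_clm_apply_of_continuousOn
      (φ := fun t => (ContinuousLinearMap.mul ℝ R).flip (w t))
      ((ContinuousLinearMap.continuous _).comp_continuousOn hcont) hconn).neg
  · filter_upwards [ae_leb_mem_Ioo, ae_restrict_of_ae hderiv] with t ht hd using hd ht

variable [StarRing R] [NormedStarGroup R] [StarModule ℝ R] (hs : ∀ μ x, star (A μ x) = -A μ x)
include hs

theorem hasWeakDeriv_mul_star_holonomy (σ : Curve p) (Y : R) :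
    HasWeakDeriv (fun s => Y * star (holonomy hA σ s))
      (fun s => Y * star (holonomy hA σ s) * connForm A (σ.val s) (σ.vel s)) :=
  ((hasWeakDeriv_star_transportC (A := connC hA) (star_connForm hs) σ).clm_comp
    (ContinuousLinearMap.mul ℝ R Y)).congr_deriv
      (.of_forall fun _ => (mul_assoc Y _ _).symm)

theorem holonomy_mul_star (σ : Curve p) {t : ℝ} (ht : t ∈ Icc (0 : ℝ) 1) :
    holonomy hA σ t * star (holonomy hA σ t) = 1 :=
  transportC_mul_star (A := connC hA) (star_connForm hs) σ ht

theorem hasEndpointDeriv_transportedSection {S : Type*} [NormedAddCommGroup S] [NormedSpace ℝ S]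
    [CompleteSpace S] {act : R → S → S}
    (hact : IsBoundedBilinearMap ℝ fun x : R × S => act x.1 x.2)
    (hmul : ∀ X Y s, act (X * Y) s = act X (act Y s)) {ψ : Mink → S} (hψ : ContDiff ℝ ∞ ψ)
    (μ : Fin 4) :
    HasEndpointDeriv (basisVec μ) (fun σ : Curve p => act (star (holonomy hA σ 1)) (ψ (σ.val 1)))
      fun σ => act (star (holonomy hA σ 1))
        (pd μ ψ (σ.val 1) + act (A μ (σ.val 1)) (ψ (σ.val 1))) := by
  let B : R →L[ℝ] S →L[ℝ] S := hact.toContinuousLinearMap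
  have hC : ContDiff ℝ ∞ (connC hA) := contDiff_connForm hA
  refine ⟨(contDiff_transportedSection B hC hψ).of_le (WithTop.coe_le_coe.2 le_top), fun σ => ?_⟩
  have hvalue := hasEndpointValue_transportedSection B hC hψ (star_connForm hs) hmul
    (basisVec μ) σ
  have hbasis : connC hA (σ.val 1) (basisVec μ) = A μ (σ.val 1) := connForm_basisVec _ _ _
  rw [hbasis, add_comm] at hvalue
  exact hvalue

/-- Since `L` commutes with the conjugation by unitaries, it may be moved under the integral and
the conjugation. -/
theorem map_integral_conj_holonomy {L : R → R} (hL : IsBoundedLinearMap ℝ L)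
    (hconj : ∀ U X : R, U * star U = 1 → L (star U * (X * U)) = star U * (L X * U))
    {J : Fin 4 → Mink → R} (hJ : ∀ ν, Continuous (J ν)) (σ : Curve p) :
    L (∫ t, ∑ ν, σ.vel t ν •
        (star (holonomy hA σ t) * (J ν (σ.val t) * holonomy hA σ t)) ∂leb) =
      ∫ t, conjL (connC hA) σ t
        (connForm (fun ν x => L (J ν x)) (σ.val t) (σ.vel t)) ∂leb := by
  have hpull := map_integral_conjL (A := connC hA) (star_connForm hs) hL.toContinuousLinearMap
    hconj (continuous_connForm hJ) σ
  simp only [connForm_apply, map_sum, map_smul, ContinuousLinearMap.comp_apply] at hpull ⊢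
  exact hpull

theorem hasLevyDAlembertian_holonomy_iff {L : R → R} (hL : IsBoundedLinearMap ℝ L)
    (hconj : ∀ U X : R, U * star U = 1 → L (star U * (X * U)) = star U * (L X * U))
    {J : Fin 4 → Mink → R} (hJ : ∀ ν, Continuous (J ν)) :
    HasLevyDAlembertian (fun σ : Curve p => holonomy hA σ 1) (fun σ => holonomy hA σ 1 *
      L (∫ t, ∑ ν, σ.vel t ν •
        (star (holonomy hA σ t) * (J ν (σ.val t) * holonomy hA σ t)) ∂leb)) ↔
      ∀ x ν, divCurv (connForm A) x (basisVec ν) = -L (J ν x) := by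
  have hC : ContDiff ℝ ∞ (connC hA) := contDiff_connForm hA
  have hK : Continuous (connForm fun ν x => L (J ν x)) :=
    continuous_connForm fun ν => hL.continuous.comp (hJ ν)
  rw [funext fun σ : Curve p => congrArg (holonomy hA σ 1 * ·)
    (map_integral_conj_holonomy hA hs hL hconj hJ σ)]
  refine (hasLevyDAlembertian_transportC_iff (A := connC hA) (star_connForm hs) hC hK).trans
    ⟨fun h x ν => ?_, fun h x v => ?_⟩
  · rw [← connForm_basisVec (fun ν x => L (J ν x))]
    exact h x (basisVec ν)
  · rw [connForm_apply, map_eq_sum_basisVec (divCurv (connC hA) x) v, ← Finset.sum_neg_distrib]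
    exact Finset.sum_congr rfl fun ν _ => (congrArg (v ν • ·) (h x ν)).trans (smul_neg _ _)

end Holonomy

attribute [local instance] Matrix.frobeniusNormedRing Matrix.frobeniusNormedAlgebra

section MatrixAlgebra

variable {N : ℕ}

theorem colorAct_eq_mul (X : Mat N) (φ : Spinor N) : colorAct X φ = X * φ := rfl

theorem spinAct_eq_mul (M : Matrix (Fin 4) (Fin 4) ℂ) (φ : Spinor N) :
    spinAct M φ = φ * Mᵀ := by
  ext a α
  simp [spinAct, Matrix.mul_apply, mul_comm]

theorem bilin_eq_mul (γ : Fin 4 → Matrix (Fin 4) (Fin 4) ℂ) (μ : Fin 4) (φ : Spinor N) :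
    bilin γ μ φ = φ * (lowerGamma γ 0 * lowerGamma γ μ)ᵀ * φᴴ := by
  rw [← spinAct_eq_mul]
  rfl

theorem bilin_colorAct (γ : Fin 4 → Matrix (Fin 4) (Fin 4) ℂ) (μ : Fin 4) (X : Mat N)
    (φ : Spinor N) : bilin γ μ (colorAct X φ) = X * (bilin γ μ φ * Xᴴ) := by
  simp only [bilin_eq_mul, colorAct_eq_mul, Matrix.conjTranspose_mul, Matrix.mul_assoc]

theorem continuous_bilin (γ : Fin 4 → Matrix (Fin 4) (Fin 4) ℂ) (μ : Fin 4) :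
    Continuous fun φ : Spinor N => bilin γ μ φ := by
  simp only [bilin_eq_mul]
  exact (continuous_id.matrix_mul continuous_const).matrix_mul continuous_id.matrix_conjTranspose

theorem isBoundedBilinearMap_colorAct :
    IsBoundedBilinearMap ℝ fun x : Mat N × Spinor N => colorAct x.1 x.2 where
  add_left := Matrix.add_mul
  smul_left := Matrix.smul_mul
  add_right := Matrix.mul_add
  smul_right c X φ := Matrix.mul_smul X c φ
  bound := ⟨1, one_pos, fun X φ => (Matrix.frobenius_norm_mul X φ).trans_eq (by rw [one_mul])⟩

theorem isBoundedLinearMap_prSu_I_smul :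
    IsBoundedLinearMap ℝ fun X : Mat N => prSu (Complex.I • X) := by
  have hlin : IsLinearMap ℝ fun X : Mat N => prSu (Complex.I • X) := by
    refine ⟨fun X Y => ?_, fun r X => ?_⟩
    · simp only [prSu, smul_add, Matrix.trace_add, add_div, add_smul]
      abel
    · simp only [prSu, smul_comm Complex.I r, Matrix.trace_smul, smul_div_assoc, smul_assoc,
        smul_sub]
  exact (LinearMap.toContinuousLinearMap hlin.mk').isBoundedLinearMap

theorem prSu_I_smul_conj {U : Mat N} (hU : U * star U = 1) (X : Mat N) :
    prSu (Complex.I • (star U * (X * U))) = star U * (prSu (Complex.I • X) * U) := by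
  have htrace : (star U * (X * U)).trace = X.trace := by
    rw [Matrix.trace_mul_comm, Matrix.mul_assoc, hU, Matrix.mul_one]
  simp only [prSu, Matrix.trace_smul, htrace, sub_mul, mul_sub, Matrix.smul_mul,
    Matrix.mul_smul, one_mul, mul_eq_one_comm.1 hU]

theorem sum_spinAct_colorAct (γ : Fin 4 → Matrix (Fin 4) (Fin 4) ℂ) (c : ℂ) (X : Mat N)
    (χ : Fin 4 → Spinor N) (φ : Spinor N) :
    ∑ μ, spinAct (γ μ) (colorAct X (χ μ)) + c • colorAct X φ =
      colorAct X (∑ μ, spinAct (γ μ) (χ μ) + c • φ) := by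
  simp only [spinAct_eq_mul, colorAct_eq_mul, Matrix.mul_add, Matrix.mul_sum, Matrix.mul_smul,
    Matrix.mul_assoc]

theorem eq_zero_of_colorAct_eq_zero {X Y : Mat N} (hXY : X * Y = 1) {φ : Spinor N}
    (h : colorAct Y φ = 0) : φ = 0 := by
  rw [← Matrix.one_mul φ, ← hXY, Matrix.mul_assoc, ← colorAct_eq_mul Y, h, Matrix.mul_zero]

end MatrixAlgebra

section GaugeTransport

variable {N : ℕ} {p : ℝ≥0∞} [Fact (1 ≤ p)] {A : Fin 4 → Mink → Mat N}
  (hA : ∀ μ, ContDiff ℝ ∞ (A μ)) (hs : ∀ μ x, star (A μ x) = -A μ x)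

include hs in
theorem isParallelTransport_holonomy_mul_star (σ : Curve p) :
    IsParallelTransport A σ fun t s => holonomy hA σ t * star (holonomy hA σ s) where
  ac_left s hs01 := by
    refine (hasWeakDeriv_holonomy_mul hA σ _).absolutelyContinuousOnInterval.mono ?_
    rw [uIcc_of_le zero_le_one, uIcc_of_le hs01.2]
    exact Icc_subset_Icc_left hs01.1
  deriv_left s hs01 := by
    filter_upwards [(ae_restrict_iff' measurableSet_Icc).1
      (hasWeakDeriv_holonomy_mul hA σ (star (holonomy hA σ s))).ae_hasDerivAt] with t hderiv ht
    have hat := hderiv ⟨hs01.1.trans ht.1.le, ht.2.le⟩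
    rwa [connForm_apply] at hat
  ac_right t ht01 := by
    refine (hasWeakDeriv_mul_star_holonomy hA hs σ _).absolutelyContinuousOnInterval.mono ?_
    rw [uIcc_of_le zero_le_one, uIcc_of_le ht01.1]
    exact Icc_subset_Icc_right ht01.2
  deriv_right t ht01 := by
    filter_upwards [(ae_restrict_iff' measurableSet_Icc).1
      (hasWeakDeriv_mul_star_holonomy hA hs σ (holonomy hA σ t)).ae_hasDerivAt] with s hderiv hs'
    have hat := hderiv ⟨hs'.1.le, hs'.2.le.trans ht01.2⟩
    rwa [connForm_apply] at hat
  diag _ := holonomy_mul_star hA hs σ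

theorem IsParallelTransport.eq_holonomy {σ : Curve p} {U : ℝ → ℝ → Mat N}
    (hU : IsParallelTransport A σ U) : U 1 0 = holonomy hA σ 1 := by
  refine eqOn_holonomy hA (hU.ac_left 0 (by simp)) ?_ (hU.diag 0 (by simp)) (by simp)
  simp only [connForm_apply]
  exact hU.deriv_left 0 (by simp)

include hs

theorem transport_eq_holonomy (σ : Curve p) : transport A σ = holonomy hA σ 1 :=
  (Classical.epsilon_spec (p := IsParallelTransport A σ)
    ⟨_, isParallelTransport_holonomy_mul_star hA hs σ⟩).eq_holonomy hA

theorem transportedSpinor_eq (ψ : Mink → Spinor N) (σ : Curve p) :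
    transportedSpinor A ψ σ = colorAct (star (holonomy hA σ 1)) (ψ (σ.val 1)) := by
  rw [transportedSpinor, transport_eq_holonomy hA hs,
    Matrix.inv_eq_right_inv (holonomy_mul_star hA hs σ (by simp))]

theorem transportedSpinor_shrink (ψ : Mink → Spinor N) (σ : Curve p) (r : unitInterval) :
    transportedSpinor A ψ (Curve.shrink r σ) =
      colorAct (star (holonomy hA σ r)) (ψ (σ.val r)) := by
  rw [transportedSpinor_eq hA hs, Curve.shrink_val _ _ (by simp), mul_one, holonomy_shrink_one]

theorem hasEndpointDeriv_transportedSpinor {ψ : Mink → Spinor N} (hψ : ContDiff ℝ ∞ ψ)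
    (μ : Fin 4) :
    HasEndpointDeriv (p := p) (basisVec μ) (transportedSpinor A ψ) fun σ =>
      colorAct (star (holonomy hA σ 1))
        (pd μ ψ (σ.val 1) + colorAct (A μ (σ.val 1)) (ψ (σ.val 1))) := by
  rw [funext (transportedSpinor_eq hA hs ψ)]
  exact hasEndpointDeriv_transportedSection hA hs isBoundedBilinearMap_colorAct Matrix.mul_assoc
    hψ μ

theorem integral_bilin_transportedSpinor (γ : Fin 4 → Matrix (Fin 4) (Fin 4) ℂ)
    (ψ : Mink → Spinor N) (σ : Curve p) :
    ∫ r in Icc (0 : ℝ) 1, ∑ ν, σ.vel r ν • bilin γ ν (transportedSpinor A ψ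
        (Curve.shrink (projIcc 0 1 zero_le_one r) σ)) =
      ∫ t, ∑ ν, σ.vel t ν •
        (star (holonomy hA σ t) * (bilin γ ν (ψ (σ.val t)) * holonomy hA σ t)) ∂leb := by
  refine setIntegral_congr_fun measurableSet_Icc fun t ht => ?_
  simp only [projIcc_of_mem zero_le_one ht, transportedSpinor_shrink hA hs, bilin_colorAct,
    Matrix.star_eq_conjTranspose, Matrix.conjTranspose_conjTranspose]

end GaugeTransport

section Equations

variable {N : ℕ} {A : Fin 4 → Mink → Mat N} (hA : ∀ μ, ContDiff ℝ ∞ (A μ))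

include hA in
theorem divCurv_connForm_basisVec (x : Mink) (ν : Fin 4) :
    divCurv (connForm A) x (basisVec ν) = ∑ μ, ∑ κ, eta μ κ • covD A κ (curv A μ ν) x := by
  have hcurv (μ : Fin 4) :
      curv A μ ν = fun y => curvForm (connForm A) y (basisVec μ) (basisVec ν) :=
    funext fun y => (curvForm_connForm hA y μ ν).symm
  rw [divCurv_apply, Finset.sum_comm]
  refine Finset.sum_congr rfl fun μ _ => Finset.sum_congr rfl fun κ _ => ?_
  rw [covCurv_connForm hA, eta_comm, covD, hcurv]

variable (hs : ∀ μ x, star (A μ x) = -A μ x) (p : ℝ≥0∞) [Fact (1 ≤ p)]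
  (γ : Fin 4 → Matrix (Fin 4) (Fin 4) ℂ) {ψ : Mink → Spinor N} (hψ : ContDiff ℝ ∞ ψ)
include hA hs hψ

theorem dirac_equation_iff (c : ℂ) :
    (∀ x, (∑ μ, spinAct (γ μ) (pd μ ψ x + colorAct (A μ x) (ψ x))) + c • ψ x = 0) ↔
    ∃ DΨ : Fin 4 → Curve p → Spinor N,
      (∀ μ, HasEndpointDeriv (basisVec μ) (transportedSpinor A ψ) (DΨ μ)) ∧
      ∀ σ : Curve p, (∑ μ, spinAct (γ μ) (DΨ μ σ)) + c • transportedSpinor A ψ σ = 0 := by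
  have hD := hasEndpointDeriv_transportedSpinor (p := p) hA hs hψ
  constructor
  · intro h
    refine ⟨_, hD, fun σ => ?_⟩
    rw [transportedSpinor_eq hA hs, sum_spinAct_colorAct, h]
    exact Matrix.mul_zero (star (holonomy hA σ 1))
  · rintro ⟨DΨ, hDΨ, heq⟩ x
    let σ : Curve p := Curve.ofContDiff p (f := fun t => t • x)
      (contDiff_id.smul contDiff_const) (zero_smul ℝ x)
    have hσ : σ.val 1 = x := by rw [Curve.ofContDiff_val _ _ (by simp), one_smul]
    have hDΨσ (μ : Fin 4) := ((hDΨ μ).2 σ).unique ((hD μ).2 σ)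
    have hzero := heq σ
    simp only [hDΨσ] at hzero
    rw [transportedSpinor_eq hA hs, sum_spinAct_colorAct, hσ] at hzero
    exact eq_zero_of_colorAct_eq_zero (holonomy_mul_star hA hs σ (by simp)) hzero

theorem hasLevyDAlembertian_transport_iff :
    HasLevyDAlembertian (p := p) (fun σ => transport A σ) (fun σ => transport A σ *
      prSu (Complex.I • ∫ r in (Icc (0 : ℝ) 1), ∑ ν, σ.vel r ν • bilin γ ν
        (transportedSpinor A ψ (Curve.shrink (projIcc 0 1 zero_le_one r) σ)))) ↔
    ∀ x ν, ∑ μ, ∑ κ, eta μ κ • covD A κ (curv A μ ν) x =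
      -prSu (Complex.I • bilin γ ν (ψ x)) := by
  rw [funext fun σ : Curve p => show transport A σ * prSu _ = _ by
      rw [transport_eq_holonomy hA hs, integral_bilin_transportedSpinor hA hs],
    funext (transport_eq_holonomy hA hs)]
  refine (hasLevyDAlembertian_holonomy_iff hA hs isBoundedLinearMap_prSu_I_smul
    (fun _ X hU => prSu_I_smul_conj hU X)
    fun ν => (continuous_bilin γ ν).comp hψ.continuous).trans ?_
  simp only [divCurv_connForm_basisVec hA]
  rfl

end Equations

end LevyYM

end

theorem mainTheorem5_general (N : ℕ) (p : ENNReal) [Fact (1 ≤ p)]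
    (γ : Fin 4 → Matrix (Fin 4) (Fin 4) ℂ) (m : ℝ)
    (A : Fin 4 → LevyYM.Mink → LevyYM.Mat N)
    (hA : ∀ μ, ContDiff ℝ ∞ (A μ)) (hA_star : ∀ μ x, (A μ x)ᴴ = -A μ x)
    (ψ : LevyYM.Mink → LevyYM.Spinor N) (hψ : ContDiff ℝ ∞ ψ) :
    LevyYM.IsYangMillsDirac γ m A ψ ↔
      (∃ DΨ : Fin 4 → LevyYM.Curve p → LevyYM.Spinor N,
        (∀ μ, LevyYM.HasEndpointDeriv (LevyYM.basisVec μ)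
          (LevyYM.transportedSpinor A ψ) (DΨ μ)) ∧
        ∀ σ : LevyYM.Curve p, (∑ μ, LevyYM.spinAct (γ μ) (DΨ μ σ)) +
          (Complex.I * m) • LevyYM.transportedSpinor A ψ σ = 0) ∧
      LevyYM.HasLevyDAlembertian (p := p) (fun σ => LevyYM.transport A σ)
        (fun σ => LevyYM.transport A σ *
          LevyYM.prSu (Complex.I • ∫ r in (Set.Icc (0 : ℝ) 1), ∑ ν,
            σ.vel r ν • LevyYM.bilin γ ν (LevyYM.transportedSpinor A ψ
              (LevyYM.Curve.shrink (Set.projIcc 0 1 zero_le_one r) σ)))) :=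
  and_congr (LevyYM.dirac_equation_iff hA hA_star p γ hψ (Complex.I * m))
    (LevyYM.hasLevyDAlembertian_transport_iff hA hA_star p γ hψ).symm

theorem mainTheorem5 (N : ℕ) (p : ENNReal) [Fact (1 ≤ p)] (hp : p = 1 ∨ p = 2)
    (γ : Fin 4 → Matrix (Fin 4) (Fin 4) ℂ) (hγ : LevyYM.IsDirac γ) (m : ℝ)
    (A : Fin 4 → LevyYM.Mink → LevyYM.Mat N)
    (hA : ∀ μ, ContDiff ℝ ∞ (A μ)) (hAsu : ∀ μ x, A μ x ∈ LevyYM.su N)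
    (ψ : LevyYM.Mink → LevyYM.Spinor N) (hψ : ContDiff ℝ ∞ ψ) :
    LevyYM.IsYangMillsDirac γ m A ψ ↔
      (∃ DΨ : Fin 4 → LevyYM.Curve p → LevyYM.Spinor N,
        (∀ μ, LevyYM.HasEndpointDeriv (LevyYM.basisVec μ)
          (LevyYM.transportedSpinor A ψ) (DΨ μ)) ∧
        ∀ σ : LevyYM.Curve p, (∑ μ, LevyYM.spinAct (γ μ) (DΨ μ σ)) +
          (Complex.I * m) • LevyYM.transportedSpinor A ψ σ = 0) ∧
      LevyYM.HasLevyDAlembertian (p := p) (fun σ => LevyYM.transport A σ)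
        (fun σ => LevyYM.transport A σ *
          LevyYM.prSu (Complex.I • ∫ r in (Set.Icc (0 : ℝ) 1), ∑ ν,
            σ.vel r ν • LevyYM.bilin γ ν (LevyYM.transportedSpinor A ψ
              (LevyYM.Curve.shrink (Set.projIcc 0 1 zero_le_one r) σ)))) :=
  mainTheorem5_general N p γ m A hA (fun μ x => (hAsu μ x).1) ψ hψ
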